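/- **Setting.** Let $N\ge 1$ robots have states $x_i\in\mathbb{R}^{n_i}$, inputs $u_i\in\mathbb{R}^{m_i}$ and dynamics $\dot x_i=r_i(x_i,u_i)$; write $x=\mathrm{col}(x_1,\dots,x_N)$, $u=\mathrm{col}(u_1,\dots,u_N)$. Let $\phi_i:\mathbb{R}^{n_i}\to\mathbb{R}^d$, $\ell_i:\mathbb{R}^{n_i}\times\mathbb{R}^d\to\mathbb{R}$, $h_i:\mathbb{R}^{m_i}\to\mathbb{R}^{n_i}$, $h(u)=\mathrm{col}(h_i(u_i))$, $\sigma(x)=\frac1N\sum_i\phi_i(x_i)$, $f^\sigma(x)=\sum_i\ell_i(x_i,\sigma(x))$ and $f^{\sigma,h}(u)=f^\sigma(h(u))$. The robots communicate over a directed graph with weights $a_{ij}>0$ if robot $j$ sends to robot $i$ ($j\in\mathcal N_i$) and $a_{ij}=0$ otherwise. $\nabla h_i$, $\nabla\phi_i$ are transposed Jacobians, $\nabla_1\ell_i,\nabla_2\ell_i$ the partial gradients. **Assumptions.** (1) The graph is strongly connected and weight-balanced: $\sum_j a_{ij}=\sum_j a_{ji}$ for all $i$. (2) For every $i$ there are $\delta_1,\delta_2>0$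 such that for every constant $\bar u_i$: $r_i(h_i(\bar u_i),\bar u_i)=0$ and all trajectories of $\dot x_i=r_i(x_i,\bar u_i)$ satisfy $\|x_i(t)-h_i(\bar u_i)\|\le\delta_1\|x_i(0)-h_i(\bar u_i)\|e^{-\delta_2t}$, $t\ge0$; moreover $h_i$ and $r_i$ are Lipschitz. (3) $f^{\sigma,h}$ is radially unbounded and differentiable with Lipschitz gradient, $\nabla f^\sigma$ is Lipschitz, and $\nabla_1\ell_i,\nabla_2\ell_i,\phi_i$ are Lipschitz for all $i$. The gradients used by the control law exist: $\ell_i$ is differentiable, and $h_i,\phi_i$ are continuously differentiable. **Closed loop.** With parameters $\alpha_1,\alpha_2,\lambda,\nu>0$ and $d_i=\nabla h_i(u_i)\big(\nabla_1\ell_i(x_i,w_i+\phi_i(x_i))+\nabla\phi_i(x_i)(\nabla_2\ell_i(x_i,w_i+\phi_i(x_i))+z_i)\big)$, let $q_i=w_i+\phi_i(x_i)$, $s_i=z_i+\nabla_2\ell_i(x_i,q_i)$, and let $\hat q_i,\hat s_i$ be their values at the last triggering time of robot $i$. Then $$\dot x_i=r_i(x_i,u_i),\quad \dot u_i=-\alpha_1d_i,\quad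 \dot w_i=-\tfrac1{\alpha_2}\sum_{j\in\mathcal N_i}a_{ij}(\hat q_i-\hat q_j),\quad \dot z_i=-\tfrac1{\alpha_2}\sum_{j\in\mathcal N_i}a_{ij}(\hat s_i-\hat s_j),\quad \dot\xi_i=-\nu\xi_i,$$ with $w_i,z_i\in\mathbb{R}^d$, $\xi_i\in\mathbb{R}$. Robot $i$ triggers at $t_i^0=0$, and its next triggering time after $t_i^k$ is the time at which the error $e_i=(q_i-\hat q_i,\ s_i-\hat s_i)\in\mathbb{R}^{2d}$, with samples held since $t_i^k$, is about to exceed the threshold $\lambda\|d_i\|+|\xi_i|$: it satisfies $\|e_i\|\le\lambda\|d_i\|+|\xi_i|$ up to then and has reached the threshold at that time. A solution lives on $[0,T)$, $0<T\le\infty$, with finitely many triggerings before each time less than $T$; these may accumulate at $T$. It is complete if $T=\infty$. Let $X=\{(x,u): x=h(u),\ \nabla f^{\sigma,h}(u)=0\}$ be the set of stationary points of $\min f^\sigma(x)$ subject to $x=h(u)$. Let $\pi^w_i(x)=-\phi_i(x_i)+\sigma(x)$ and $\pi^z_i(x)=-\nabla_2\ell_i(x_i,\sigma(x))+\frac1N\sum_j\nabla_2\ell_j(x_j,\sigma(x))$.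 Put $\mathcal X=\{(x,u,w,z,\xi):(x,u)\in X,\ w=\pi^w(x),\ z=\pi^z(x),\ \xi=0\}$ and $\mathcal S=\{(x,u,w,z,\xi):\sum_iw_i=0,\ \sum_iz_i=0,\ \xi\ne0\}$. **Theorem.** There exist $\bar\alpha_1,\bar\alpha_2,\bar\lambda,\bar\nu>0$ such that for all $\alpha_1\in(0,\bar\alpha_1)$, $\alpha_2\in(0,\bar\alpha_2)$, $\lambda\in(0,\bar\lambda)$, $\nu>\bar\nu$ the following hold. 1. (Well-posedness.) From every initial condition in $\mathcal S$ with $\xi_i(0)\ne0$ for all $i$ there is a complete solution, and every solution from such an initial condition extends to a complete one. 2. (Convergence.) Every solution with $w(0)=z(0)=0$ and $\xi_i(0)\neq0$ for all $i$ is bounded, and if it is complete then the distance of $(x(t),u(t),w(t),z(t),\xi(t))$ to $\mathcal X$ tends to $0$ as $t\to\infty$. 3. (Stability.) If $\bar u\in\mathbb{R}^m$, $m=\sum_i m_i$, is an isolated stationary point and a local minimum of $f^{\sigma,h}$, then $(h(\bar u),\bar u,\pi^w(h(\bar u)),\pi^z(h(\bar u)),0)$ is an equilibrium that is locally asymptotically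 stable for the closed-loop system restricted to $\mathcal S$: solutions starting in $\mathcal S$ sufficiently close to it remain arbitrarily close as long as they exist, and complete solutions starting in $\mathcal S$ sufficiently close converge to it. 4. (No Zeno behavior.) For every solution from an initial condition in $\mathcal S$ with $\xi_i(0)\ne0$ for all $i$, no robot has triggering times that accumulate at a finite time. -/

import Mathlib

open Set Filter Topology

noncomputable section

namespace EventTriggered

/-- `ℝ^k` with its Euclidean norm. -/
abbrev Vec (k : ℕ) : Type := EuclideanSpace ℝ (Fin k)

/-- Stacked vectors `col(v_1, …, v_N)` with `v_i ∈ ℝ^{k_i}`, with the Euclidean norm. -/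
abbrev Stack {N : ℕ} (k : Fin N → ℕ) : Type := PiLp 2 (fun i => Vec (k i))

/-- The data of the problem: `N` robots, states in `ℝ^{n_i}`, inputs in `ℝ^{m_i}`, aggregative
variable in `ℝ^d`.  `graph.Adj i j` means that robot `j` sends information to robot `i`. -/
structure Problem (N d : ℕ) (n m : Fin N → ℕ) where
  /-- communication graph -/
  graph : Digraph (Fin N)
  /-- weighted adjacency matrix -/
  a : Matrix (Fin N) (Fin N) ℝ
  /-- robot dynamics `ẋ_i = r_i(x_i, u_i)` -/
  r : ∀ i, Vec (n i) → Vec (m i) → Vec (n i)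
  /-- steady-state maps -/
  h : ∀ i, Vec (m i) → Vec (n i)
  /-- aggregation rules -/
  φ : ∀ i, Vec (n i) → Vec d
  /-- local costs `ℓ_i(x_i, σ)` -/
  ℓ : ∀ i, Vec (n i) → Vec d → ℝ

/-- The tuning parameters `α₁, α₂, λ, ν` of the control law. -/
structure Params where
  α₁ : ℝ
  α₂ : ℝ
  lam : ℝ
  ν : ℝ

variable {N d : ℕ} {n m : Fin N → ℕ}

/-- The state space of `col(x, u, w, z, ξ)`.  It carries the maximum of the Euclidean norms of the
five blocks, which is equivalent to the Euclidean norm of the whole vector. -/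
abbrev State (N d : ℕ) (n m : Fin N → ℕ) : Type :=
  Stack n × Stack m × Stack (fun _ : Fin N => d) × Stack (fun _ : Fin N => d) × Vec N

namespace Problem

variable (P : Problem N d n m)

/-- `∇₁ ℓ_i(x, y)`. -/
def grad₁ (i : Fin N) (x : Vec (n i)) (y : Vec d) : Vec (n i) :=
  gradient (fun s => P.ℓ i s y) x

/-- `∇₂ ℓ_i(x, y)`. -/
def grad₂ (i : Fin N) (x : Vec (n i)) (y : Vec d) : Vec d :=
  gradient (fun s => P.ℓ i x s) y

/-- `∇h_i(u)`, the transposed Jacobian of `h_i`. -/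
def gradH (i : Fin N) (u : Vec (m i)) : Vec (n i) →L[ℝ] Vec (m i) :=
  ContinuousLinearMap.adjoint (fderiv ℝ (P.h i) u)

/-- `∇φ_i(x)`, the transposed Jacobian of `φ_i`. -/
def gradφ (i : Fin N) (x : Vec (n i)) : Vec d →L[ℝ] Vec (n i) :=
  ContinuousLinearMap.adjoint (fderiv ℝ (P.φ i) x)

/-- `h(u) = col(h_1(u_1), …, h_N(u_N))`. -/
def hStack (u : Stack m) : Stack n := WithLp.toLp 2 fun i => P.h i (u i)

/-- The aggregative variable `σ(x) = (1/N) ∑ φ_i(x_i)`. -/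
def σ (x : Stack n) : Vec d := (1 / (N : ℝ)) • ∑ i, P.φ i (x i)

/-- The cost `f^σ(x) = ∑ ℓ_i(x_i, σ(x))`. -/
def cost (x : Stack n) : ℝ := ∑ i, P.ℓ i (x i) (P.σ x)

/-- The reduced cost `f^{σ,h}(u) = ∑ ℓ_i(h_i(u_i), σ(h(u)))`. -/
def reducedCost (u : Stack m) : ℝ := P.cost (P.hStack u)

/-- The graph is strongly connected and weight-balanced (and the weights match the graph). -/
structure NetworkAssumption : Prop where
  weight_pos : ∀ i j, P.graph.Adj i j → 0 < P.a i j
  weight_zero : ∀ i j, ¬ P.graph.Adj i j → P.a i j = 0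
  strongly_connected : ∀ i j, Relation.ReflTransGen P.graph.Adj i j
  balanced : ∀ i, ∑ j, P.a i j = ∑ j, P.a j i

/-- For every constant input `ū_i` the point `h_i(ū_i)` is an exponentially stable equilibrium of
robot `i`, uniformly in `ū_i`; the maps `h_i` and `r_i` are Lipschitz.  The maps `h_i` are
continuously differentiable, since the control law uses `∇h_i`. -/
structure SteadyStateAssumption : Prop where
  equilibrium : ∀ i u, P.r i (P.h i u) u = 0
  exp_stable : ∀ i, ∃ δ₁ > 0, ∃ δ₂ > 0, ∀ (u : Vec (m i)) (y : ℝ → Vec (n i)),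
    (∀ t, 0 ≤ t → HasDerivWithinAt y (P.r i (y t) u) (Ici 0) t) →
    ∀ t, 0 ≤ t → ‖y t - P.h i u‖ ≤ δ₁ * ‖y 0 - P.h i u‖ * Real.exp (-δ₂ * t)
  h_lipschitz : ∃ β_h > 0, ∀ i u u', ‖P.h i u - P.h i u'‖ ≤ β_h * ‖u - u'‖
  r_lipschitz : ∃ β_r > 0, ∀ i x u x' u',
    ‖P.r i x u - P.r i x' u'‖ ≤ β_r * ‖x - x'‖ + β_r * ‖u - u'‖
  h_smooth : ∀ i, ContDiff ℝ 1 (P.h i)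

/-- The reduced cost is radially unbounded and differentiable with Lipschitz gradient, the
gradient of `f^σ` is Lipschitz, and `∇₁ ℓ_i`, `∇₂ ℓ_i`, `φ_i` are Lipschitz.  The `ℓ_i` are
differentiable and the `φ_i` continuously differentiable, since the control law uses `∇₁ ℓ_i`,
`∇₂ ℓ_i` and `∇φ_i`. -/
structure CostAssumption : Prop where
  radially_unbounded : Tendsto P.reducedCost (Bornology.cobounded (Stack m)) atTop
  reduced_differentiable : Differentiable ℝ P.reducedCost
  reduced_lipschitz : ∃ β, LipschitzWith β (gradient P.reducedCost)
  cost_lipschitz : ∃ β, LipschitzWith β (gradient P.cost)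
  grad₁_lipschitz : ∃ β, ∀ i,
    LipschitzWith β (fun p : Vec (n i) × Vec d => P.grad₁ i p.1 p.2)
  grad₂_lipschitz : ∃ β, ∀ i,
    LipschitzWith β (fun p : Vec (n i) × Vec d => P.grad₂ i p.1 p.2)
  φ_lipschitz : ∃ β, ∀ i, LipschitzWith β (P.φ i)
  ℓ_differentiable : ∀ i, Differentiable ℝ (fun p : Vec (n i) × Vec d => P.ℓ i p.1 p.2)
  φ_smooth : ∀ i, ContDiff ℝ 1 (P.φ i)

/-- The set `X` of stationary points `(x, u)` of `min f^σ(x)` subject to `x = h(u)`. -/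
def stationary : Set (Stack n × Stack m) :=
  {p | p.1 = P.hStack p.2 ∧ gradient P.reducedCost p.2 = 0}

/-- `π^w(x)`. -/
def πw (x : Stack n) : Stack (fun _ : Fin N => d) :=
  WithLp.toLp 2 fun i => -P.φ i (x i) + P.σ x

/-- `π^z(x)`. -/
def πz (x : Stack n) : Stack (fun _ : Fin N => d) :=
  WithLp.toLp 2 fun i =>
    -P.grad₂ i (x i) (P.σ x) + (1 / (N : ℝ)) • ∑ j, P.grad₂ j (x j) (P.σ x)

/-- The set `𝒳` of stationary configurations. -/
def configX : Set (State N d n m) :=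
  {(x, u, w, z, ξ) | (x, u) ∈ P.stationary ∧ w = P.πw x ∧ z = P.πz x ∧ ξ = 0}

/-- The point `col(h(ū), ū, π^w(h(ū)), π^z(h(ū)), 0)`. -/
def eqPoint (u : Stack m) : State N d n m :=
  (P.hStack u, u, P.πw (P.hStack u), P.πz (P.hStack u), 0)

/-- The direction
`d_i = ∇h_i(u_i) (∇₁ ℓ_i(x_i, w_i + φ_i(x_i)) + ∇φ_i(x_i) (∇₂ ℓ_i(x_i, w_i + φ_i(x_i)) + z_i))`. -/
def dir (i : Fin N) (x : Vec (n i)) (u : Vec (m i)) (w z : Vec d) : Vec (m i) :=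
  P.gradH i u (P.grad₁ i x (w + P.φ i x) + P.gradφ i x (P.grad₂ i x (w + P.φ i x) + z))

end Problem

/-- The set `𝒮`: `1ᵀ w = 0`, `1ᵀ z = 0`, `ξ ≠ 0`. -/
def setS : Set (State N d n m) :=
  {(_, _, w, z, ξ) | ∑ i, w i = 0 ∧ ∑ i, z i = 0 ∧ ξ ≠ 0}

/-- The part of `𝒮` in which every component of `ξ` is nonzero. -/
def setS' : Set (State N d n m) :=
  {(_, _, w, z, ξ) | ∑ i, w i = 0 ∧ ∑ i, z i = 0 ∧ ∀ i, ξ i ≠ 0}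

/-- A candidate run of the closed loop: trajectories and, for each robot `i`, its sequence of
triggering times `τ i 0, τ i 1, …`; the value `⊤` means that no further triggering occurs. -/
structure Run (N d : ℕ) (n m : Fin N → ℕ) where
  x : ℝ → Stack n
  u : ℝ → Stack m
  w : ℝ → Stack (fun _ : Fin N => d)
  z : ℝ → Stack (fun _ : Fin N => d)
  ξ : ℝ → Vec N
  τ : Fin N → ℕ → EReal

namespace Run

variable (c : Run N d n m) (P : Problem N d n m) (p : Params)

/-- The state `col(x, u, w, z, ξ)` at time `t`. -/
def state (t : ℝ) : State N d n m := (c.x t, c.u t, c.w t, c.z t, c.ξ t)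

/-- The last triggering time of robot `i` up to time `t`. -/
def last (i : Fin N) (t : ℝ) : ℝ := sSup {s : ℝ | s ≤ t ∧ ∃ k, c.τ i k = (s : EReal)}

/-- `w_i + φ_i(x_i)` at time `t`. -/
def sigW (i : Fin N) (t : ℝ) : Vec d := c.w t i + P.φ i (c.x t i)

/-- `z_i + ∇₂ ℓ_i(x_i, w_i + φ_i(x_i))` at time `t`. -/
def sigZ (i : Fin N) (t : ℝ) : Vec d := c.z t i + P.grad₂ i (c.x t i) (c.sigW P i t)

/-- `d_i` at time `t`. -/
def dirAt (i : Fin N) (t : ℝ) : Vec (m i) := P.dir i (c.x t i) (c.u t i) (c.w t i) (c.z t i)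

/-- `‖e_i(t)‖`, where `e_i(t) ∈ ℝ^{2d}` is the error at time `t` with respect to the values
sampled at time `s`. -/
def errNorm (i : Fin N) (s t : ℝ) : ℝ :=
  ‖WithLp.toLp 2 (c.sigW P i t - c.sigW P i s, c.sigZ P i t - c.sigZ P i s)‖

/-- The triggering threshold `λ ‖d_i‖ + |ξ_i|` at time `t`. -/
def threshold (i : Fin N) (t : ℝ) : ℝ := p.lam * ‖c.dirAt P i t‖ + |c.ξ t i|

/-- `c` is a solution of the event-triggered closed loop on `[0, T)`, where `0 < T ≤ ∞`.

Right derivatives are used since the right-hand sides of `w` and `z` jump at triggering times.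
Sums over the neighbours of `i` are sums over all `j`, as `a i j = 0` for the other `j`.

Triggering: the time `0` is the first sampling instant of each robot.  The next triggering time
after `τ i k` is the time at which the error with respect to the sample taken at `τ i k` is about
to exceed the threshold: up to then it does not exceed it, and at that time it has reached it.
Each trajectory with `τ i (k + 1) = inf {t > τ i k | ‖e_i(t)‖ > λ ‖d_i(t)‖ + |ξ_i(t)|}`, and each
trajectory with `≥` in place of `>` there, is of this kind.

Only finitely many triggerings occur up to each time before `T`; they may accumulate at `T`. -/
structure IsSolution (T : EReal) : Prop where
  pos : 0 < T
  cont : ContinuousOn c.state {t : ℝ | 0 ≤ t ∧ (t : EReal) < T}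
  ode_x : ∀ t : ℝ, 0 ≤ t → (t : EReal) < T → ∀ i,
    HasDerivWithinAt (fun s => c.x s i) (P.r i (c.x t i) (c.u t i)) (Ici t) t
  ode_u : ∀ t : ℝ, 0 ≤ t → (t : EReal) < T → ∀ i,
    HasDerivWithinAt (fun s => c.u s i) (-(p.α₁ • c.dirAt P i t)) (Ici t) t
  ode_w : ∀ t : ℝ, 0 ≤ t → (t : EReal) < T → ∀ i,
    HasDerivWithinAt (fun s => c.w s i)
      (-((1 / p.α₂) •
        ∑ j, P.a i j • (c.sigW P i (c.last i t) - c.sigW P j (c.last j t)))) (Ici t) t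
  ode_z : ∀ t : ℝ, 0 ≤ t → (t : EReal) < T → ∀ i,
    HasDerivWithinAt (fun s => c.z s i)
      (-((1 / p.α₂) •
        ∑ j, P.a i j • (c.sigZ P i (c.last i t) - c.sigZ P j (c.last j t)))) (Ici t) t
  ode_ξ : ∀ t : ℝ, 0 ≤ t → (t : EReal) < T → ∀ i,
    HasDerivWithinAt (fun s => c.ξ s i) (-(p.ν * c.ξ t i)) (Ici t) t
  τ_zero : ∀ i, c.τ i 0 = 0
  τ_dom : ∀ i k, c.τ i k < T ∨ c.τ i k = ⊤
  τ_lt : ∀ i k, c.τ i k < ⊤ → c.τ i k < c.τ i (k + 1)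
  τ_top : ∀ i k, c.τ i k = ⊤ → c.τ i (k + 1) = ⊤
  not_exceeded : ∀ i k (t : ℝ), c.τ i k ≤ (t : EReal) → (t : EReal) < c.τ i (k + 1) →
    (t : EReal) < T → c.errNorm P i (c.τ i k).toReal t ≤ c.threshold P p i t
  reached : ∀ i k, c.τ i (k + 1) < ⊤ →
    c.threshold P p i (c.τ i (k + 1)).toReal ≤
      c.errNorm P i (c.τ i k).toReal (c.τ i (k + 1)).toReal
  locally_finite : ∀ i (t : ℝ), (t : EReal) < T → ∃ k, (t : EReal) < c.τ i k

/-- `c'` is a complete solution (defined for all `t ≥ 0`) that coincides with `c` on `[0, T)`,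
triggering times included. -/
def HasCompletion (T : EReal) : Prop :=
  ∃ c' : Run N d n m, c'.IsSolution P p ⊤ ∧
    (∀ t : ℝ, 0 ≤ t → (t : EReal) < T → c'.state t = c.state t) ∧
    ∀ i k, min (c'.τ i k) T = min (c.τ i k) T

/-- Zeno behavior of robot `i`: its triggering times accumulate at a finite time. -/
def IsZeno (i : Fin N) : Prop := ∃ b : ℝ, Tendsto (c.τ i) atTop (𝓝 (b : EReal))

end Run

/-- `s` is an equilibrium of the closed loop: staying at `s` without ever triggering again is a
solution. -/
def IsEquilibrium (P : Problem N d n m) (p : Params) (s : State N d n m) : Prop :=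
  ∃ c : Run N d n m, c.IsSolution P p ⊤ ∧ (∀ t : ℝ, 0 ≤ t → c.state t = s) ∧
    ∀ i k, c.τ i (k + 1) = ⊤

/-- `s` is a locally asymptotically stable equilibrium of the closed loop restricted to `S`:
it is an equilibrium; solutions that start in `S` close to `s` stay close to `s` as long as they
exist; complete solutions that start in `S` close to `s` converge to `s`. -/
def LocallyAsymptoticallyStable (P : Problem N d n m) (p : Params) (S : Set (State N d n m))
    (s : State N d n m) : Prop :=
  IsEquilibrium P p s ∧
  (∀ ε > 0, ∃ δ > 0, ∀ (c : Run N d n m) (T : EReal), c.IsSolution P p T →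
    c.state 0 ∈ S → dist (c.state 0) s < δ →
    ∀ t : ℝ, 0 ≤ t → (t : EReal) < T → dist (c.state t) s < ε) ∧
  ∃ δ > 0, ∀ c : Run N d n m, c.IsSolution P p ⊤ → c.state 0 ∈ S → dist (c.state 0) s < δ →
    Tendsto c.state atTop (𝓝 s)

end EventTriggered

end

noncomputable section

namespace EventTriggered

/-! The closed loop is a perturbed gradient flow of the reduced cost in `u`, coupled to three stable
error dynamics: the plant error `x - h(u)` and the two consensus errors `w - π^w(x)`, `z - π^z(x)`.
The triggering rule bounds the sampling error by `λ‖d‖ + |ξ_i|`. The proof is a composite Lyapunov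
argument with the function `(1/α₁) f^{σ,h}(u) + W`, where `W` is a weighted sum of squared errors
and of `‖ξ‖²`.

When all tracking errors vanish, `d` is exactly the gradient of the reduced cost; in general the
difference is linear in those errors (`exists_dirStack_sub_gradient_le`). Hence the cost dissipates
`‖d‖²/2` up to squared errors. The plant error is handled by a converse Lyapunov function
(`exists_converse_lyapunov`), disturbed only by the speed `α₁‖d‖` of the input. The consensus errors
have zero sum, where the Laplacian of a strongly connected balanced graph is coercive
(`exists_laplacian_coercive`); they are disturbed by the sampling error and, with the small factor
`α₂`, by the motion of `x`. Small `α₁`, `α₂`, `λ` let the dissipation absorb every cross term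
(`exists_weights`), so the composite function decreases at a rate proportional to `dissip`, the
squared gradient plus all squared errors (`exists_isLyapunov`). The converse Lyapunov function and
the maps `π^w`, `π^z` are used only through Lipschitz bounds, and the right-hand sides jump at
triggering times, so decay is expressed with upper right Dini derivatives.

Radial unboundedness makes sublevel sets relatively compact, so solutions are bounded and Lipschitz
in time; a Barbalat argument sends `dissip` to zero, and its zeros are the stationary
configurations. At an isolated stationary local minimum the composite function has a strict local
minimum, which gives asymptotic stability.

On a bounded time interval `|ξ_i|` stays above a positive constant while the transmitted signals are
Lipschitz, so successive triggerings of a robot are separated (`exists_dwell_time`) and Zeno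
behavior is impossible. Hence a solution on a finite horizon has a left limit and finitely many
triggerings; after resampling the robots that have reached their threshold, Peano's theorem
continues it (`exists_extension`). Zorn's lemma then produces a complete extension; uniqueness of
solutions is never needed. -/

/-- `b` bounds the upper right Dini derivative of `f` at `t`. -/
def DiniLE (f : ℝ → ℝ) (b t : ℝ) : Prop :=
  ∀ r > b, ∀ᶠ s in 𝓝[>] t, f s ≤ f t + r * (s - t)

/-! ### Calculus of upper right Dini derivatives. -/

namespace DiniLE

variable {f g : ℝ → ℝ} {a b t : ℝ}

theorem mono (hf : DiniLE f a t) (hab : a ≤ b) : DiniLE f b t :=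
  fun r hr => hf r (hab.trans_lt hr)

theorem add (hf : DiniLE f a t) (hg : DiniLE g b t) :
    DiniLE (fun s => f s + g s) (a + b) t := by
  intro r hr
  filter_upwards [hf (a + (r - (a + b)) / 2) (by linarith),
    hg (b + (r - (a + b)) / 2) (by linarith)] with s h1 h2
  nlinarith

theorem const_mul (hf : DiniLE f a t) {c : ℝ} (hc : 0 ≤ c) :
    DiniLE (fun s => c * f s) (c * a) t := by
  rcases hc.eq_or_lt with rfl | hc
  · intro r hr
    filter_upwards [self_mem_nhdsWithin] with s hs
    have : 0 < s - t := sub_pos.2 hs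
    simp only [zero_mul] at hr ⊢
    nlinarith [mul_pos hr this]
  · intro r hr
    filter_upwards [hf (r / c) (by rw [gt_iff_lt, lt_div_iff₀ hc]; linarith)] with s h
    calc c * f s ≤ c * (f t + r / c * (s - t)) := by gcongr
      _ = c * f t + r * (s - t) := by field_simp

theorem sum {ι : Type*} (S : Finset ι) {F : ι → ℝ → ℝ} {B : ι → ℝ}
    (h : ∀ i ∈ S, DiniLE (F i) (B i) t) :
    DiniLE (fun s => ∑ i ∈ S, F i s) (∑ i ∈ S, B i) t := by
  classical
  induction S using Finset.induction_on with
  | empty =>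
    intro r hr
    filter_upwards [self_mem_nhdsWithin] with s hs
    have : 0 < s - t := sub_pos.2 hs
    simp only [Finset.sum_empty] at hr ⊢
    nlinarith [mul_pos hr this]
  | insert i S hi ih =>
    simp only [Finset.sum_insert hi]
    exact (h i (Finset.mem_insert_self i S)).add
      (ih fun j hj => h j (Finset.mem_insert_of_mem hj))

theorem _root_.HasDerivWithinAt.diniLE (h : HasDerivWithinAt f a (Ici t) t) : DiniLE f a t := by
  intro r hr
  have h1 := hasDerivWithinAt_iff_tendsto_slope' (by simp) |>.1 h.Ioi_of_Ici
  filter_upwards [h1.eventually_lt_const hr, self_mem_nhdsWithin] with s h2 hs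
  have hs' : 0 < s - t := sub_pos.2 hs
  rw [slope_def_field, div_lt_iff₀ hs'] at h2
  linarith

/-- Factor `f(s)² - f(t)² = (f(s) - f(t))(f(s) + f(t))`: the second factor is nonnegative, so the
one-sided bound on the first survives, and it tends to `2 f(t)`. -/
theorem sq (hf : DiniLE f b t) (hc : ContinuousWithinAt f (Ioi t) t) (h0 : ∀ s, 0 ≤ f s) :
    DiniLE (fun s => f s ^ 2) (2 * f t * b) t := by
  intro r hr
  obtain ⟨q, hq, hqr⟩ : ∃ q > b, 2 * f t * q < r := by
    have : Tendsto (fun q => 2 * f t * q) (𝓝[>] b) (𝓝 (2 * f t * b)) :=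
      (Continuous.tendsto (by fun_prop) b).mono_left nhdsWithin_le_nhds
    obtain ⟨q, h1, h2⟩ := ((this.eventually_lt_const hr).and self_mem_nhdsWithin).exists
    exact ⟨q, h2, h1⟩
  have h2 : Tendsto (fun s => (f s + f t) * q) (𝓝[>] t) (𝓝 ((f t + f t) * q)) :=
    (hc.tendsto.add_const _).mul_const _
  filter_upwards [hf q hq, self_mem_nhdsWithin,
    h2.eventually_lt_const (show (f t + f t) * q < r by linarith)] with s h3 hs h4
  have hs' : 0 < s - t := sub_pos.2 hs
  have h5 : 0 ≤ f s + f t := add_nonneg (h0 s) (h0 t)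
  nlinarith [mul_le_mul_of_nonneg_left h3 h5, mul_lt_mul_of_pos_right h4 hs']

/-- The fencing theorem against an affine majorant. It is the step from infinitesimal decay to
inequalities between values at two times. -/
theorem le_of_const {v m : ℝ} {y : ℝ → ℝ} (hv : v ≤ m) (hc : ContinuousOn y (Icc v m))
    {B : ℝ} (h : ∀ s ∈ Ico v m, DiniLE y B s) : y m ≤ y v + B * (m - v) := by
  have := image_le_of_liminf_slope_right_le_deriv_boundary (f := y) (a := v) (b := m) hc
    (B := fun s => y v + B * (s - v)) (B' := fun _ => B) (by simp) (by fun_prop)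
    (fun x _ => by
      have : HasDerivAt (fun s => y v + B * (s - v)) (B * 1) x :=
        (((hasDerivAt_id x).sub_const v).const_mul B).const_add _
      simpa using this.hasDerivWithinAt)
    (fun x hx r hr => by
      refine Eventually.frequently ?_
      obtain ⟨q, hq, hqr⟩ := exists_between hr
      filter_upwards [h x hx q hq, self_mem_nhdsWithin] with s h1 hs
      have hs' : 0 < s - x := sub_pos.2 hs
      rw [slope_def_field, div_lt_iff₀ hs']
      nlinarith)
  exact this (right_mem_Icc.2 hv)

/-- The squared distance of a trajectory to a point that depends in a Lipschitz way on another
trajectory. -/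
theorem norm_sub_sq {E F : Type*} [NormedAddCommGroup E] [InnerProductSpace ℝ E]
    [NormedAddCommGroup F] [NormedSpace ℝ F] {v p : ℝ → E} {x : ℝ → F} {v' : E} {x' : F} {K : ℝ}
    (hv : HasDerivWithinAt v v' (Ici t) t) (hx : HasDerivWithinAt x x' (Ici t) t)
    (hp : ∀ s, ‖p s - p t‖ ≤ K * ‖x s - x t‖) :
    DiniLE (fun s => ‖v s - p s‖ ^ 2)
      (2 * inner ℝ (v t - p t) v' + 2 * K * ‖v t - p t‖ * ‖x'‖) t := by
  intro r hr
  set e := v t - p t with he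
  have h1 := hasDerivWithinAt_iff_tendsto_slope' (by simp) |>.1 hv.Ioi_of_Ici
  have h2 := hasDerivWithinAt_iff_tendsto_slope' (by simp) |>.1 hx.Ioi_of_Ici
  have h3 : Tendsto (fun s : ℝ => s - t) (𝓝[>] t) (𝓝 0) := by
    have : Tendsto (fun s : ℝ => s - t) (𝓝 t) (𝓝 (t - t)) :=
      (continuous_id.sub continuous_const).tendsto t
    rw [sub_self] at this
    exact this.mono_left nhdsWithin_le_nhds
  -- This bounds the difference quotient of `‖e + (Δv - Δp)‖²`: the cross term with `Δv` is kept
  -- exactly, the one with `Δp` is estimated by `K‖Δx‖`, and the quadratic term carries an extra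
  -- factor `s - t`, so it disappears in the limit.
  have h4 : Tendsto (fun s => 2 * inner ℝ e (slope v t s) + 2 * K * ‖e‖ * ‖slope x t s‖ +
      (s - t) * (‖slope v t s‖ + K * ‖slope x t s‖) ^ 2) (𝓝[>] t)
      (𝓝 (2 * inner ℝ e v' + 2 * K * ‖e‖ * ‖x'‖ + 0 * (‖v'‖ + K * ‖x'‖) ^ 2)) :=
    ((((tendsto_const_nhds (x := e)).inner h1).const_mul 2).add (h2.norm.const_mul _)).add
      (h3.mul ((h1.norm.add (h2.norm.const_mul K)).pow 2))
  rw [zero_mul, add_zero] at h4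
  filter_upwards [h4.eventually_lt_const hr, self_mem_nhdsWithin] with s h5 hs
  have hs' : 0 < s - t := sub_pos.2 hs
  have hv1 : v s - v t = (s - t) • slope v t s := by
    rw [← vsub_eq_sub (v s), sub_smul_slope]
  have hx1 : x s - x t = (s - t) • slope x t s := by
    rw [← vsub_eq_sub (x s), sub_smul_slope]
  have hx2 : ‖p s - p t‖ ≤ (s - t) * (K * ‖slope x t s‖) := by
    refine (hp s).trans_eq ?_
    rw [hx1, norm_smul, Real.norm_of_nonneg hs'.le]; ring
  have hdec : v s - p s = e + ((v s - v t) - (p s - p t)) := by rw [he]; abel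
  have h6 : ‖v s - v t - (p s - p t)‖ ≤ (s - t) * (‖slope v t s‖ + K * ‖slope x t s‖) := by
    refine (norm_sub_le _ _).trans ?_
    rw [hv1, norm_smul, Real.norm_of_nonneg hs'.le]
    linarith
  have h7 : -inner ℝ e (p s - p t) ≤ ‖e‖ * ((s - t) * (K * ‖slope x t s‖)) :=
    (neg_le_abs _).trans ((abs_real_inner_le_norm _ _).trans (by gcongr))
  have h8 := pow_le_pow_left₀ (norm_nonneg _) h6 2
  rw [hdec, norm_add_sq_real, inner_sub_right]
  have h9 : inner ℝ e (v s - v t) = (s - t) * inner ℝ e (slope v t s) := by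
    rw [hv1, real_inner_smul_right]
  have h10 := mul_lt_mul_of_pos_left h5 hs'
  rw [h9]
  nlinarith

end DiniLE

end EventTriggered

/-! ### Peano's existence theorem by Euler's method. -/

namespace EventTriggered

section Peano

variable {E : Type*} [NormedAddCommGroup E] [NormedSpace ℝ E]

/-- The grid points of Euler's method with step `h`. -/
def euler (f : E → E) (x₀ : E) (h : ℝ) : ℕ → E
  | 0 => x₀
  | k + 1 => euler f x₀ h k + h • f (euler f x₀ h k)

/-- Discrete Gronwall: each step multiplies `1 + ‖x‖` by at most `1 + hC ≤ exp(Ch)`. -/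
theorem norm_euler_le {f : E → E} {C : ℝ} (hC : ∀ x, ‖f x‖ ≤ C * (1 + ‖x‖)) (x₀ : E) {h : ℝ}
    (hh : 0 ≤ h) (k : ℕ) :
    1 + ‖euler f x₀ h k‖ ≤ Real.exp (C * (h * k)) * (1 + ‖x₀‖) := by
  induction k with
  | zero => simp [euler]
  | succ k ih =>
    have h1 : ‖euler f x₀ h (k + 1)‖ ≤ ‖euler f x₀ h k‖ + h * (C * (1 + ‖euler f x₀ h k‖)) := by
      refine (norm_add_le _ _).trans ?_
      rw [norm_smul, Real.norm_of_nonneg hh]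
      gcongr
      exact hC _
    have h2 : 1 + h * C ≤ Real.exp (C * h) := by
      have := Real.add_one_le_exp (C * h); linarith
    calc 1 + ‖euler f x₀ h (k + 1)‖ ≤ (1 + h * C) * (1 + ‖euler f x₀ h k‖) := by linarith
      _ ≤ Real.exp (C * h) * (Real.exp (C * (h * k)) * (1 + ‖x₀‖)) := by gcongr
      _ = Real.exp (C * (h * (k + 1 : ℕ))) * (1 + ‖x₀‖) := by
        rw [← mul_assoc, ← Real.exp_add]; push_cast; ring_nf

/-- Telescoping of the increments. With `v = 0` it bounds the speed of the approximations; with `v`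
the field at the left grid point it gives the differential equation in the limit. -/
theorem euler_sub_le {f : E → E} {x₀ : E} {h : ℝ} (hh : 0 ≤ h) {v : E} {η : ℝ} (a : ℕ) {n : ℕ}
    (H : ∀ k < n, ‖f (euler f x₀ h (a + k)) - v‖ ≤ η) :
    ‖euler f x₀ h (a + n) - euler f x₀ h a - (h * n) • v‖ ≤ h * n * η := by
  induction n with
  | zero => simp
  | succ n ih =>
    have h1 := ih fun k hk => H k (hk.trans n.lt_succ_self)
    have h2 := H n n.lt_succ_self
    have : euler f x₀ h (a + (n + 1)) - euler f x₀ h a - (h * (n + 1 : ℕ)) • v =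
        (euler f x₀ h (a + n) - euler f x₀ h a - (h * n) • v) +
          h • (f (euler f x₀ h (a + n)) - v) := by
      rw [← add_assoc, euler]; push_cast; module
    rw [this]
    refine (norm_add_le _ _).trans ?_
    rw [norm_smul, Real.norm_of_nonneg hh]
    push_cast
    nlinarith [mul_le_mul_of_nonneg_left h2 hh]

/-- Euler approximations, as step functions of time. -/
def eulerStep (f : E → E) (x₀ : E) (n : ℕ) (t : ℝ) : E :=
  euler f x₀ (1 / ((n : ℝ) + 1)) ⌊t * ((n : ℝ) + 1)⌋₊

theorem tendsto_grid {t : ℝ} (ht : 0 ≤ t) :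
    Tendsto (fun n : ℕ => 1 / ((n : ℝ) + 1) * (⌊t * ((n : ℝ) + 1)⌋₊ : ℝ)) atTop (𝓝 t) := by
  have h1 := (tendsto_nat_floor_mul_div_atTop ht).comp
    (tendsto_atTop_add_const_right atTop (1 : ℝ) tendsto_natCast_atTop_atTop)
  refine h1.congr fun n => ?_
  simp only [Function.comp_apply]
  ring

theorem grid_le {t : ℝ} (ht : 0 ≤ t) (n : ℕ) :
    1 / ((n : ℝ) + 1) * (⌊t * ((n : ℝ) + 1)⌋₊ : ℝ) ≤ t := by
  have h1 : (0 : ℝ) < (n : ℝ) + 1 := by positivity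
  rw [one_div, inv_mul_le_iff₀ h1, mul_comm]
  exact Nat.floor_le (by positivity)

variable [ProperSpace E]

/-- Peano's theorem for vector fields of linear growth. -/
theorem exists_solution_of_linear_growth {f : E → E} (hf : Continuous f) {C : ℝ} (hC0 : 0 ≤ C)
    (hC : ∀ x, ‖f x‖ ≤ C * (1 + ‖x‖)) (x₀ : E) :
    ∃ y : ℝ → E, y 0 = x₀ ∧ ∀ t, 0 ≤ t → HasDerivWithinAt y (f (y t)) (Ici 0) t := by
  -- Limits along a free ultrafilter: bounded sequences in a proper space converge along it for
  -- every time simultaneously, which replaces the Arzelà–Ascoli extraction of a subsequence.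
  set U : Ultrafilter ℕ := hyperfilter ℕ
  have hU : (U : Filter ℕ) ≤ atTop := by
    rw [← Nat.cofinite_eq_atTop]; exact hyperfilter_le_cofinite
  set R : ℝ → ℝ := fun B => Real.exp (C * B) * (1 + ‖x₀‖) with hR
  have hgrid : ∀ B, ∀ (n k : ℕ), 1 / ((n : ℝ) + 1) * k ≤ B →
      1 + ‖euler f x₀ (1 / ((n : ℝ) + 1)) k‖ ≤ R B := by
    intro B n k hk
    refine (norm_euler_le hC x₀ (by positivity) k).trans ?_
    simp only [hR]; gcongr
  have hlim : ∀ t, ∃ a, 0 ≤ t → ‖a‖ ≤ R t ∧ Tendsto (fun n => eulerStep f x₀ n t) U (𝓝 a) := by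
    intro t
    by_cases ht : 0 ≤ t
    · have hmem : ∀ n, eulerStep f x₀ n t ∈ Metric.closedBall (0 : E) (R t) := fun n => by
        have := hgrid t n _ (grid_le ht n)
        rw [mem_closedBall_zero_iff]
        unfold eulerStep
        linarith
      obtain ⟨a, ha, h⟩ := (isCompact_closedBall (0 : E) (R t)).ultrafilter_le_nhds'
        (U.map fun n => eulerStep f x₀ n t)
        (by rw [Ultrafilter.mem_map]; exact Filter.univ_mem' hmem)
      exact ⟨a, fun _ => ⟨mem_closedBall_zero_iff.1 ha, h⟩⟩
    · exact ⟨0, fun h => absurd h ht⟩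
  choose y hy using hlim
  have hRmono : Monotone R := fun a b hab => by simp only [hR]; gcongr
  have hdiff : ∀ s t, 0 ≤ s → s ≤ t → Tendsto (fun n : ℕ => 1 / ((n : ℝ) + 1) *
      ((⌊t * ((n : ℝ) + 1)⌋₊ - ⌊s * ((n : ℝ) + 1)⌋₊ : ℕ) : ℝ)) U (𝓝 (t - s)) := by
    intro s t hs hst
    refine ((tendsto_grid (hs.trans hst)).sub (tendsto_grid hs)).mono_left hU |>.congr fun n => ?_
    rw [Nat.cast_sub (Nat.floor_le_floor (by gcongr))]
    ring
  have hfl : ∀ s t, s ≤ t → ∀ n : ℕ, ⌊s * ((n : ℝ) + 1)⌋₊ +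
      (⌊t * ((n : ℝ) + 1)⌋₊ - ⌊s * ((n : ℝ) + 1)⌋₊) = ⌊t * ((n : ℝ) + 1)⌋₊ := fun s t hst n =>
    Nat.add_sub_of_le (Nat.floor_le_floor (by gcongr))
  -- the grid values between two times
  have hpt : ∀ t, 0 ≤ t → ∀ (n k : ℕ), k ≤ ⌊t * ((n : ℝ) + 1)⌋₊ →
      1 + ‖euler f x₀ (1 / ((n : ℝ) + 1)) k‖ ≤ R t := fun t ht n k hk =>
    hgrid t n k ((by gcongr : _ ≤ 1 / ((n : ℝ) + 1) * (⌊t * ((n : ℝ) + 1)⌋₊ : ℝ)).trans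
      (grid_le ht n))
  have hstep : ∀ t, 0 ≤ t → ∀ (n a k : ℕ), a + k ≤ ⌊t * ((n : ℝ) + 1)⌋₊ →
      ‖euler f x₀ (1 / ((n : ℝ) + 1)) (a + k) - euler f x₀ (1 / ((n : ℝ) + 1)) a‖ ≤
        1 / ((n : ℝ) + 1) * k * (C * R t) := by
    intro t ht n a k hk
    have := euler_sub_le (f := f) (x₀ := x₀) (h := 1 / ((n : ℝ) + 1)) (by positivity) (v := 0)
      (η := C * R t) a (n := k) (fun j hj => by
        rw [sub_zero]
        exact (hC _).trans (by gcongr; exact hpt t ht n _ (by omega)))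
    simpa using this
  have hlip : ∀ s t, 0 ≤ s → s ≤ t → ‖y t - y s‖ ≤ (t - s) * (C * R t) := by
    intro s t hs hst
    have ht := hs.trans hst
    refine le_of_tendsto_of_tendsto (((hy t ht).2.sub (hy s hs).2).norm)
      ((hdiff s t hs hst).mul_const _) (Eventually.of_forall fun n => ?_)
    have h := hstep t ht n ⌊s * ((n : ℝ) + 1)⌋₊ _ (hfl s t hst n).le
    rw [hfl s t hst n] at h
    exact h
  -- Uniform continuity of the field on the ball containing all grid values makes the first-order
  -- expansion uniform in the step size, so it passes to the limit. Its base point is the left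
  -- endpoint; the second conjunct allows the base point to be moved.
  have hmain : ∀ B, 0 ≤ B → ∀ η > 0, ∃ δ > 0, ∀ s t, 0 ≤ s → s ≤ t → t ≤ B → t - s < δ →
      ‖y t - y s - (t - s) • f (y s)‖ ≤ (t - s) * η ∧ ‖f (y t) - f (y s)‖ ≤ η := by
    intro B hB η hη
    have huc := (isCompact_closedBall (0 : E) (R B)).uniformContinuousOn_of_continuous
      hf.continuousOn
    obtain ⟨ρ, hρ, huc⟩ := Metric.uniformContinuousOn_iff.1 huc η hη
    have hRB : 0 ≤ R B := by positivity
    refine ⟨ρ / (C * R B + 1), by positivity, fun s t hs hst htB hts => ?_⟩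
    have ht := hs.trans hst
    have hsmall : (t - s) * (C * R B) < ρ := by
      rw [lt_div_iff₀ (by positivity)] at hts
      nlinarith [sub_nonneg.2 hst]
    constructor
    · refine le_of_tendsto_of_tendsto ((((hy t ht).2.sub (hy s hs).2).sub
        ((hdiff s t hs hst).smul ((hf.tendsto _).comp (hy s hs).2))).norm)
        ((hdiff s t hs hst).mul_const η) ?_
      filter_upwards [((hdiff s t hs hst).mul_const (C * R B)).eventually_lt_const hsmall]
        with n hn
      have h := euler_sub_le (f := f) (x₀ := x₀) (h := 1 / ((n : ℝ) + 1)) (by positivity)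
        (v := f (eulerStep f x₀ n s)) (η := η) ⌊s * ((n : ℝ) + 1)⌋₊
        (n := ⌊t * ((n : ℝ) + 1)⌋₊ - ⌊s * ((n : ℝ) + 1)⌋₊) (fun k hk => by
          have hle : ⌊s * ((n : ℝ) + 1)⌋₊ + k ≤ ⌊t * ((n : ℝ) + 1)⌋₊ := by omega
          have hle' : ⌊t * ((n : ℝ) + 1)⌋₊ ≤ ⌊B * ((n : ℝ) + 1)⌋₊ :=
            Nat.floor_le_floor (by gcongr)
          rw [← dist_eq_norm]
          refine (huc _ ?_ _ ?_ ?_).le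
          · have := hpt B hB n _ (hle.trans hle')
            rw [mem_closedBall_zero_iff]; linarith
          · have := hpt B hB n ⌊s * ((n : ℝ) + 1)⌋₊ (by omega)
            rw [mem_closedBall_zero_iff]; unfold eulerStep; linarith
          · rw [dist_eq_norm]
            refine (hstep B hB n _ k (hle.trans hle')).trans_lt (lt_of_le_of_lt ?_ hn)
            gcongr)
      rw [hfl s t hst n] at h
      exact h
    · rw [← dist_eq_norm]
      refine (huc _ ?_ _ ?_ ?_).le
      · exact mem_closedBall_zero_iff.2 ((hy t ht).1.trans (hRmono htB))
      · exact mem_closedBall_zero_iff.2 ((hy s hs).1.trans (hRmono (hst.trans htB)))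
      · rw [dist_eq_norm]
        refine ((hlip s t hs hst).trans ?_).trans_lt hsmall
        have := hRmono htB
        have := sub_nonneg.2 hst
        gcongr
  refine ⟨y, ?_, fun t ht => ?_⟩
  · refine tendsto_nhds_unique (hy 0 le_rfl).2 (tendsto_const_nhds.congr fun n => ?_)
    simp [eulerStep, euler]
  · rw [hasDerivWithinAt_iff_isLittleO, Asymptotics.isLittleO_iff]
    intro c hc
    obtain ⟨δ, hδ, H⟩ := hmain (t + 1) (by linarith) (c / 2) (by positivity)
    have hball : Metric.ball t (min δ 1) ∈ 𝓝[Ici 0] t :=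
      mem_nhdsWithin_of_mem_nhds (Metric.ball_mem_nhds t (by positivity))
    filter_upwards [hball, self_mem_nhdsWithin] with s hs hs0
    rw [Metric.mem_ball, Real.dist_eq, lt_min_iff] at hs
    obtain ⟨hs1, hs2⟩ := hs
    rw [abs_lt] at hs1 hs2
    rcases le_total t s with hts | hts
    · rw [Real.norm_of_nonneg (sub_nonneg.2 hts)]
      have := (H t s ht hts (by linarith) (by linarith)).1
      nlinarith [sub_nonneg.2 hts]
    -- For times before `t` the expansion is based at `s`; replacing `f (y s)` by `f (y t)` uses up
    -- the other half of `c`.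
    · rw [Real.norm_of_nonpos (sub_nonpos.2 hts)]
      obtain ⟨h1, h2⟩ := H s t hs0 hts (by linarith) (by linarith)
      have h3 : y s - y t - (s - t) • f (y t) =
          -(y t - y s - (t - s) • f (y s)) + (t - s) • (f (y t) - f (y s)) := by module
      rw [h3]
      refine (norm_add_le _ _).trans ?_
      rw [norm_neg, norm_smul, Real.norm_of_nonneg (sub_nonneg.2 hts)]
      nlinarith [sub_nonneg.2 hts]

/-- Peano's theorem, local version. -/
theorem exists_local_solution {f : E → E} (hf : Continuous f) (x₀ : E) :
    ∃ δ > 0, ∃ y : ℝ → E, y 0 = x₀ ∧ ContinuousOn y (Ici 0) ∧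
      ∀ t, 0 ≤ t → t < δ → HasDerivWithinAt y (f (y t)) (Ici 0) t := by
  -- A cutoff equal to `1` on the unit ball around `x₀` and to `0` outside radius `2`. The truncated
  -- field is bounded, and its solution solves the original equation until it leaves the unit ball.
  set χ : E → ℝ := fun x => max 0 (min 1 (2 - ‖x - x₀‖)) with hχ
  have hχc : Continuous χ := by fun_prop
  obtain ⟨M, hM⟩ := (isCompact_closedBall x₀ 2).exists_bound_of_continuousOn hf.continuousOn
  have hM0 : 0 ≤ M := (norm_nonneg _).trans (hM x₀ (by simp))
  have hbd : ∀ x, ‖χ x • f x‖ ≤ M * (1 + ‖x‖) := by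
    intro x
    have h1 : 0 ≤ χ x := le_max_left _ _
    have h2 : χ x ≤ 1 := max_le zero_le_one (min_le_left _ _)
    rw [norm_smul, Real.norm_of_nonneg h1]
    have h3 : M ≤ M * (1 + ‖x‖) := by nlinarith [norm_nonneg x]
    refine le_trans ?_ h3
    by_cases hx : ‖x - x₀‖ ≤ 2
    · have := hM x (by rwa [mem_closedBall_iff_norm])
      nlinarith [norm_nonneg (f x)]
    · have : χ x = 0 := max_eq_left ((min_le_right _ _).trans (by linarith))
      rw [this, zero_mul]; exact hM0
  obtain ⟨y, hy0, hy⟩ := exists_solution_of_linear_growth (hχc.smul hf) hM0 hbd x₀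
  have hyc : ContinuousOn y (Ici 0) := fun t ht => (hy t ht).continuousWithinAt
  have h1 : ∀ᶠ t in 𝓝[Ici 0] (0 : ℝ), ‖y t - x₀‖ < 1 := by
    have := (((hyc 0 self_mem_Ici).sub continuousWithinAt_const).norm (f := fun t => y t - x₀))
    refine this.eventually_lt_const ?_
    simp [hy0]
  obtain ⟨δ, hδ, h2⟩ := Metric.eventually_nhds_iff.1 (eventually_nhdsWithin_iff.1 h1)
  refine ⟨δ, hδ, y, hy0, hyc, fun t ht htδ => ?_⟩
  have h3 := hy t ht
  have h4 : χ (y t) = 1 := by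
    have := h2 (by rw [Real.dist_eq, sub_zero, abs_of_nonneg ht]; exact htδ) ht
    simp only [hχ]
    rw [min_eq_left (by linarith), max_eq_right zero_le_one]
  rwa [Pi.smul_apply', h4, one_smul] at h3

end Peano

end EventTriggered

/-! ### Abstract Lyapunov and Barbalat arguments. -/

namespace EventTriggered

section Lyapunov

variable {E : Type*} [MetricSpace E]

/-- On a small sphere around `e` the function `V` has a positive minimum, while near `e` it is
smaller. By the intermediate value theorem an escaping curve would meet the sphere, where `V` would
exceed its initial value. -/
theorem exists_dist_lt_of_lyapunov [ProperSpace E] {V : E → ℝ} (hV : Continuous V) {e : E}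
    (hVe : V e = 0) {r : ℝ} (hr : 0 < r) (hpos : ∀ s ∈ Metric.closedBall e r, s ≠ e → 0 < V s)
    {ε : ℝ} (hε : 0 < ε) :
    ∃ δ > 0, ∀ (y : ℝ → E) (T : EReal), ContinuousOn y {t : ℝ | 0 ≤ t ∧ (t : EReal) < T} →
      (∀ t : ℝ, 0 ≤ t → (t : EReal) < T → V (y t) ≤ V (y 0)) → dist (y 0) e < δ →
      ∀ t : ℝ, 0 ≤ t → (t : EReal) < T → dist (y t) e < ε := by
  set ρ := min ε r
  have hρ : 0 < ρ := lt_min hε hr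
  obtain ⟨c, hc, hmin⟩ := (isCompact_sphere e ρ).exists_forall_le' hV.continuousOn (a := 0)
    (fun s hs => hpos s (Metric.mem_closedBall.2 ((Metric.mem_sphere.1 hs).trans_le
      (min_le_right _ _))) fun h => hρ.ne (by rw [← Metric.mem_sphere.1 hs, h, dist_self]))
  have h1 : ∀ᶠ s in 𝓝 e, V s < c := (hV.tendsto e).eventually_lt_const (by rwa [hVe])
  obtain ⟨δ, hδ, h2⟩ := Metric.eventually_nhds_iff.1 h1
  refine ⟨min δ ρ, lt_min hδ hρ, fun y T hy hVy h0 t ht htT => ?_⟩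
  by_contra! hcon
  have hsub : Icc 0 t ⊆ {t : ℝ | 0 ≤ t ∧ (t : EReal) < T} := fun s hs =>
    ⟨hs.1, (EReal.coe_le_coe_iff.2 hs.2).trans_lt htT⟩
  have hcont : ContinuousOn (fun s => dist (y s) e) (Icc 0 t) :=
    (continuous_id.dist continuous_const).comp_continuousOn (hy.mono hsub)
  obtain ⟨s, hs, hse⟩ := intermediate_value_Icc ht hcont
    (show ρ ∈ Icc (dist (y 0) e) (dist (y t) e) from
      ⟨(h0.trans_le (min_le_right _ _)).le, (min_le_left _ _).trans hcon⟩)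
  have h3 := hmin (y s) (Metric.mem_sphere.2 hse)
  have h4 := hVy s hs.1 (hsub hs).2
  have h5 := h2 (h0.trans_le (min_le_left _ _))
  linarith

/-- A version of Barbalat's lemma: a Lyapunov function that is bounded below forces its
dissipation rate to vanish along a bounded Lipschitz trajectory. -/
theorem tendsto_zero_of_diniLE {y : ℝ → E} {K : ℝ} (hK0 : 0 ≤ K)
    (hK : ∀ s t, 0 ≤ s → s ≤ t → dist (y t) (y s) ≤ K * (t - s)) {S : Set E} (hS : IsCompact S)
    (hy : ∀ t, 0 ≤ t → y t ∈ S) {G : E → ℝ} (hG : Continuous G) (hG0 : ∀ s, 0 ≤ G s)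
    {v : ℝ → ℝ} (hv : ContinuousOn v (Ici 0)) {m : ℝ} (hm : ∀ t, 0 ≤ t → m ≤ v t)
    (hd : ∀ t, 0 ≤ t → DiniLE v (-G (y t)) t) :
    Tendsto (fun t => G (y t)) atTop (𝓝 0) := by
  rw [Metric.tendsto_atTop]
  intro ε hε
  obtain ⟨ρ, hρ, huc⟩ := Metric.uniformContinuousOn_iff.1
    (hS.uniformContinuousOn_of_continuous hG.continuousOn) (ε / 2) (by positivity)
  -- Within time `δ` the trajectory moves by less than `ρ`. So if `G` is at least `ε` at time `t`,
  -- it is at least `ε / 2` throughout the next `δ` units of time, and `v` drops by `δ * (ε / 2)`.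
  set δ := ρ / (K + 1)
  have hδ : 0 < δ := by positivity
  have hKδ : K * δ < ρ := by
    have : (K + 1) * δ = ρ := by simp only [δ]; field_simp
    nlinarith
  -- After the time `T₀` chosen below, `v` is within `δ * (ε / 2)` of its infimum, so no such drop
  -- can occur any more.
  set I := sInf (v '' Ici 0)
  have hbdd : BddBelow (v '' Ici 0) := ⟨m, by rintro _ ⟨t, ht, rfl⟩; exact hm t ht⟩
  obtain ⟨_, ⟨T₀, hT₀, rfl⟩, hI⟩ := exists_lt_of_csInf_lt ((nonempty_Ici (a := (0 : ℝ))).image v)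
    (show I < I + δ * (ε / 2) by linarith [mul_pos hδ (half_pos hε)])
  refine ⟨T₀, fun t ht => ?_⟩
  rw [Real.dist_eq, sub_zero, abs_of_nonneg (hG0 _)]
  by_contra! hcon
  have ht0 : 0 ≤ t := le_trans hT₀ ht
  have h1 : v (t + δ) ≤ v t + -(ε / 2) * (t + δ - t) := by
    refine DiniLE.le_of_const (by linarith) (hv.mono fun s hs => ht0.trans hs.1) fun s hs => ?_
    refine (hd s (ht0.trans hs.1)).mono ?_
    have := huc (y s) (hy s (ht0.trans hs.1)) (y t) (hy t ht0)
      ((hK t s ht0 hs.1).trans_lt (lt_of_le_of_lt (by gcongr; linarith [hs.2]) hKδ))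
    rw [Real.dist_eq] at this
    have := abs_lt.1 this
    linarith
  have h2 : v t ≤ v T₀ + 0 * (t - T₀) := by
    refine DiniLE.le_of_const ht (hv.mono fun s hs => le_trans hT₀ hs.1) fun s hs => ?_
    exact (hd s (le_trans hT₀ hs.1)).mono (neg_nonpos.2 (hG0 _))
  have h3 : I ≤ v (t + δ) := csInf_le hbdd ⟨t + δ, by rw [mem_Ici]; linarith, rfl⟩
  nlinarith

/-- On the compact set `S \ U` the function `G` is bounded below by a positive constant, so the
trajectory cannot be there once `G` is small. -/
theorem eventually_mem_of_tendsto_zero {y : ℝ → E} {S U : Set E} (hS : IsCompact S)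
    (hy : ∀ t, 0 ≤ t → y t ∈ S) (hU : IsOpen U) {G : E → ℝ} (hG : Continuous G)
    (hG0 : ∀ s, 0 ≤ G s) (hSU : ∀ s ∈ S, G s = 0 → s ∈ U)
    (h : Tendsto (fun t => G (y t)) atTop (𝓝 0)) : ∀ᶠ t in atTop, y t ∈ U := by
  obtain ⟨c, hc, hmin⟩ := (hS.diff hU).exists_forall_le' hG.continuousOn (a := 0)
    (fun s hs => (hG0 s).lt_of_ne fun h => hs.2 (hSU s hs.1 h.symm))
  filter_upwards [h.eventually_lt_const hc, eventually_ge_atTop 0] with t h1 h2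
  by_contra h3
  exact absurd (hmin (y t) ⟨hy t h2, h3⟩) (not_le.2 h1)

end Lyapunov

/-! ### The Laplacian of a weight-balanced digraph. -/

section Laplacian

variable {N d : ℕ} {n m : Fin N → ℕ} {P : Problem N d n m}

/-- The action of the Laplacian of the communication graph. -/
def Problem.lap (P : Problem N d n m) (v : Fin N → Vec d) (i : Fin N) : Vec d :=
  ∑ j, P.a i j • (v i - v j)

/-- Balance makes row and column sums of the weights equal. This is why the sums of the `w_i` and of
the `z_i` are conserved whichever samples are in use. -/
theorem Problem.sum_lap (hnet : P.NetworkAssumption) (v : Fin N → Vec d) :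
    ∑ i, P.lap v i = 0 := by
  simp only [Problem.lap, smul_sub, Finset.sum_sub_distrib, ← Finset.sum_smul]
  rw [Finset.sum_comm (f := fun i j => P.a i j • v j)]
  simp only [← Finset.sum_smul, hnet.balanced, sub_self]

/-- The weights need not be symmetric, but balance lets `‖v j‖²` be traded for `‖v i‖²` under the
weighted double sum, which completes the square. -/
theorem Problem.inner_lap (hnet : P.NetworkAssumption) (v : Fin N → Vec d) :
    ∑ i, inner ℝ (v i) (P.lap v i) = 1 / 2 * ∑ i, ∑ j, P.a i j * ‖v i - v j‖ ^ 2 := by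
  have h1 : ∑ i, ∑ j, P.a i j * ‖v j‖ ^ 2 = ∑ i, ∑ j, P.a i j * ‖v i‖ ^ 2 := by
    rw [Finset.sum_comm]
    simp only [← Finset.sum_mul, hnet.balanced]
  simp only [Problem.lap, inner_sum, real_inner_smul_right, inner_sub_right,
    real_inner_self_eq_norm_sq, norm_sub_sq_real, mul_add, mul_sub, Finset.sum_add_distrib,
    Finset.sum_sub_distrib, h1]
  have h2 : ∑ i, ∑ j, P.a i j * (2 * inner ℝ (v i) (v j)) =
      2 * ∑ i, ∑ j, P.a i j * inner ℝ (v i) (v j) := by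
    simp only [Finset.mul_sum]
    exact Finset.sum_congr rfl fun i _ => Finset.sum_congr rfl fun j _ => by ring
  rw [h2]; ring

theorem Problem.NetworkAssumption.weight_nonneg (hnet : P.NetworkAssumption) (i j : Fin N) :
    0 ≤ P.a i j := by
  by_cases h : P.graph.Adj i j
  · exact (hnet.weight_pos i j h).le
  · exact (hnet.weight_zero i j h).ge

/-- If the Dirichlet form vanishes, `v` is constant along edges, hence constant by strong
connectivity, hence zero because its sum is zero. -/
theorem Problem.inner_lap_pos (hnet : P.NetworkAssumption) {v : Fin N → Vec d}
    (h0 : ∑ i, v i = 0) (hv : v ≠ 0) : 0 < ∑ i, inner ℝ (v i) (P.lap v i) := by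
  rw [P.inner_lap hnet]
  have hnn : ∀ i j, 0 ≤ P.a i j * ‖v i - v j‖ ^ 2 := fun i j =>
    mul_nonneg (hnet.weight_nonneg i j) (sq_nonneg _)
  have hnn' : ∀ i ∈ Finset.univ, 0 ≤ ∑ j, P.a i j * ‖v i - v j‖ ^ 2 :=
    fun i _ => Finset.sum_nonneg fun j _ => hnn i j
  refine mul_pos one_half_pos ((Finset.sum_nonneg hnn').lt_of_ne fun h => hv ?_)
  have hadj : ∀ i j, P.graph.Adj i j → v i = v j := by
    intro i j hij
    have h1 := (Finset.sum_eq_zero_iff_of_nonneg hnn').1 h.symm i (Finset.mem_univ i)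
    have h2 := (Finset.sum_eq_zero_iff_of_nonneg fun j _ => hnn i j).1 h1 j (Finset.mem_univ j)
    rcases mul_eq_zero.1 h2 with h3 | h3
    · exact absurd h3 (hnet.weight_pos i j hij).ne'
    · exact sub_eq_zero.1 (norm_eq_zero.1 (pow_eq_zero_iff two_ne_zero |>.1 h3))
  have heq : ∀ i j, v i = v j := by
    intro i j
    induction hnet.strongly_connected i j with
    | refl => rfl
    | tail _ hbc ih => exact ih.trans (hadj _ _ hbc)
  funext i
  have h3 : ∑ j, v j = (N : ℝ) • v i := by
    rw [Finset.sum_congr rfl fun j _ => heq j i]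
    simp [Nat.cast_smul_eq_nsmul]
  rw [h0] at h3
  exact (smul_eq_zero.1 h3.symm).resolve_left (by
    have := i.pos
    positivity)

/-- The form is positive on the compact unit sphere of the zero-sum subspace, so it has a positive
lower bound there; homogeneity does the rest. -/
theorem Problem.exists_laplacian_coercive (hnet : P.NetworkAssumption) :
    ∃ μ > 0, ∀ v : Stack (fun _ : Fin N => d), ∑ i, v i = 0 →
      μ * ‖v‖ ^ 2 ≤ ∑ i, inner ℝ (v i) (P.lap v i) := by
  have : ProperSpace (Stack (fun _ : Fin N => d)) := FiniteDimensional.proper ℝ _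
  have hcont : Continuous fun v : Stack (fun _ : Fin N => d) =>
      ∑ i, inner ℝ (v i) (P.lap v i) := by
    unfold Problem.lap
    fun_prop
  have hcl : IsClosed {v : Stack (fun _ : Fin N => d) | ∑ i, v i = 0} :=
    isClosed_eq (by fun_prop) continuous_const
  obtain ⟨μ, hμ, h⟩ := ((isCompact_sphere (0 : Stack (fun _ : Fin N => d)) 1).inter_right
    hcl).exists_forall_le' hcont.continuousOn (a := 0) (fun v hv => by
      refine P.inner_lap_pos hnet hv.2 fun h => ?_
      have h1 : v = 0 := PiLp.ext fun i => congrFun h i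
      have h2 := mem_sphere_zero_iff_norm.1 hv.1
      simp [h1] at h2)
  refine ⟨μ, hμ, fun v hv => ?_⟩
  by_cases hv0 : v = 0
  · simp [hv0]
  have hn : 0 < ‖v‖ := norm_pos_iff.2 hv0
  have h1 := h (‖v‖⁻¹ • v) ⟨by simp [norm_smul, hn.ne'], by
    simp [← Finset.smul_sum, hv]⟩
  have h2 : ∀ i, P.lap (‖v‖⁻¹ • v.ofLp) i = ‖v‖⁻¹ • P.lap v i := fun i => by
    simp only [Problem.lap, Pi.smul_apply, ← smul_sub, Finset.smul_sum]
    exact Finset.sum_congr rfl fun j _ => smul_comm _ _ _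
  simp only [WithLp.ofLp_smul, h2, Pi.smul_apply, real_inner_smul_left, real_inner_smul_right,
    ← Finset.mul_sum] at h1
  rw [← mul_assoc, ← mul_inv, inv_mul_eq_div, le_div_iff₀ (by positivity)] at h1
  rwa [sq]

end Laplacian

end EventTriggered

/-! ### Converse Lyapunov function for the robot dynamics with slowly varying input. -/

namespace EventTriggered

namespace DiniLE

variable {f g : ℝ → ℝ} {a b t : ℝ}

/-- A majorant that touches `f` at `t` passes its Dini bound on to `f`. -/
theorem of_le (hg : DiniLE g b t) (hfg : ∀ s, t ≤ s → f s ≤ g s) (ht : g t ≤ f t) :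
    DiniLE f b t := by
  intro r hr
  filter_upwards [hg r hr, self_mem_nhdsWithin] with s h1 hs
  have := hfg s (le_of_lt hs)
  linarith

theorem norm_sub {E : Type*} [NormedAddCommGroup E] [NormedSpace ℝ E] {u : ℝ → E} {u' : E}
    (hu : HasDerivWithinAt u u' (Ici t) t) : DiniLE (fun s => ‖u s - u t‖) ‖u'‖ t := by
  intro r hr
  have h1 := (hasDerivWithinAt_iff_tendsto_slope' (by simp) |>.1 hu.Ioi_of_Ici).norm
  filter_upwards [h1.eventually_lt_const hr, self_mem_nhdsWithin] with s h2 hs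
  have hs' : 0 < s - t := sub_pos.2 hs
  have hu1 : u s - u t = (s - t) • slope u t s := by
    rw [← vsub_eq_sub (u s), sub_smul_slope]
  rw [hu1, norm_smul, Real.norm_of_nonneg hs'.le, sub_self, norm_zero, zero_add]
  nlinarith

end DiniLE

section ConverseLyapunov

variable {X U : Type*} [NormedAddCommGroup X] [NormedSpace ℝ X] [NormedAddCommGroup U]
  {r : X → U → X} {β : ℝ}

/-- Gronwall: `y₂` solves the equation with input `u₁` up to a defect `β‖u₁ - u₂‖`. For equal inputs
and initial values this is uniqueness, used below as the semigroup property. -/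
theorem norm_sub_le_of_frozen (hβ : 0 < β)
    (hr : ∀ x u x' u', ‖r x u - r x' u'‖ ≤ β * ‖x - x'‖ + β * ‖u - u'‖) {u₁ u₂ : U}
    {y₁ y₂ : ℝ → X} (h₁ : ∀ t, 0 ≤ t → HasDerivWithinAt y₁ (r (y₁ t) u₁) (Ici 0) t)
    (h₂ : ∀ t, 0 ≤ t → HasDerivWithinAt y₂ (r (y₂ t) u₂) (Ici 0) t) {s : ℝ} (hs : 0 ≤ s) :
    ‖y₁ s - y₂ s‖ ≤ Real.exp (β * s) * (‖y₁ 0 - y₂ 0‖ + ‖u₁ - u₂‖) := by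
  have := dist_le_of_approx_trajectories_ODE (v := fun _ x => r x u₁) (K := β.toNNReal)
    (f := y₁) (g := y₂) (f' := fun t => r (y₁ t) u₁) (g' := fun t => r (y₂ t) u₂) (a := 0) (b := s)
    (εf := 0) (εg := β * ‖u₁ - u₂‖) (δ := ‖y₁ 0 - y₂ 0‖)
    (fun t => LipschitzWith.of_dist_le_mul fun x x' => by
      have := hr x u₁ x' u₁
      rw [sub_self, norm_zero, mul_zero, add_zero] at this
      rwa [dist_eq_norm, dist_eq_norm, Real.coe_toNNReal _ hβ.le])
    (fun t ht => (h₁ t ht.1).continuousWithinAt.mono Icc_subset_Ici_self)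
    (fun t ht => (h₁ t ht.1).mono (Ici_subset_Ici.2 ht.1))
    (fun t _ => by simp)
    (fun t ht => (h₂ t ht.1).continuousWithinAt.mono Icc_subset_Ici_self)
    (fun t ht => (h₂ t ht.1).mono (Ici_subset_Ici.2 ht.1))
    (fun t _ => by
      have := hr (y₂ t) u₂ (y₂ t) u₁
      rw [sub_self, norm_zero, mul_zero, zero_add, norm_sub_rev u₂] at this
      rwa [dist_eq_norm])
    (by rw [dist_eq_norm]) s (right_mem_Icc.2 hs)
  rw [dist_eq_norm, Real.coe_toNNReal _ hβ.le, gronwallBound_of_K_ne_0 hβ.ne', zero_add, sub_zero,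
    mul_div_cancel_left₀ _ hβ.ne'] at this
  nlinarith [norm_nonneg (u₁ - u₂)]

variable [NormedSpace ℝ U] [ProperSpace X] {h : U → X}

/-- A converse Lyapunov theorem for a family of uniformly exponentially stable equilibria. -/
theorem exists_converse_lyapunov (hβ : 0 < β)
    (hr : ∀ x u x' u', ‖r x u - r x' u'‖ ≤ β * ‖x - x'‖ + β * ‖u - u'‖)
    (heq : ∀ u, r (h u) u = 0) {β_h : ℝ} (hβh : 0 < β_h)
    (hh : ∀ u u', ‖h u - h u'‖ ≤ β_h * ‖u - u'‖) {δ₁ δ₂ : ℝ} (hδ₁ : 0 < δ₁) (hδ₂ : 0 < δ₂)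
    (hstab : ∀ (u : U) (y : ℝ → X), (∀ t, 0 ≤ t → HasDerivWithinAt y (r (y t) u) (Ici 0) t) →
      ∀ t, 0 ≤ t → ‖y t - h u‖ ≤ δ₁ * ‖y 0 - h u‖ * Real.exp (-δ₂ * t)) :
    ∃ V : X → U → ℝ, ∃ γ > 0, ∃ L, 0 ≤ L ∧ (∀ x u, ‖x - h u‖ ≤ V x u) ∧
      (∀ x u, V x u ≤ δ₁ * ‖x - h u‖) ∧
      (∀ x u x' u', V x u ≤ V x' u' + L * (‖x - x'‖ + ‖u - u'‖)) ∧
      ∀ (x : ℝ → X) (u : ℝ → U) (u' : U) (t : ℝ),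
        HasDerivWithinAt x (r (x t) (u t)) (Ici t) t → HasDerivWithinAt u u' (Ici t) t →
        DiniLE (fun s => V (x s) (u s)) (-γ * V (x t) (u t) + L * ‖u'‖) t := by
  have hex : ∀ x u, ∃ y : ℝ → X, y 0 = x ∧
      ∀ t, 0 ≤ t → HasDerivWithinAt y (r (y t) u) (Ici 0) t := by
    intro x u
    have hlip : ∀ x x', ‖r x u - r x' u‖ ≤ β * ‖x - x'‖ := fun x x' => by
      simpa using hr x u x' u
    refine exists_solution_of_linear_growth (f := fun x => r x u)
      (LipschitzWith.of_dist_le_mul (K := β.toNNReal) fun x x' => by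
        rw [dist_eq_norm, dist_eq_norm, Real.coe_toNNReal _ hβ.le]; exact hlip x x').continuous
      (C := β * (1 + ‖h u‖)) (by positivity) (fun x => ?_) x
    have h1 := hlip x (h u)
    rw [heq, sub_zero] at h1
    have h2 := norm_sub_le x (h u)
    nlinarith [norm_nonneg x, norm_nonneg (h u), mul_nonneg (norm_nonneg x) (norm_nonneg (h u))]
  choose Y hY0 hY using hex
  -- Giving away half of the decay rate leaves a factor `exp(-γ s)` in the weighted distance below,
  -- so that large `s` become harmless.
  set γ := δ₂ / 2 with hγ
  have hγ0 : 0 < γ := by positivity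
  set e : X → U → ℝ → ℝ := fun x u s => Real.exp (γ * s) * ‖Y x u s - h u‖ with he
  have hbound : ∀ x u s, 0 ≤ s → e x u s ≤ δ₁ * Real.exp (-γ * s) * ‖x - h u‖ := by
    intro x u s hs
    have h1 := hstab u (Y x u) (hY x u) s hs
    rw [hY0] at h1
    calc e x u s ≤ Real.exp (γ * s) * (δ₁ * ‖x - h u‖ * Real.exp (-δ₂ * s)) := by
          simp only [he]; gcongr
      _ = δ₁ * (Real.exp (γ * s) * Real.exp (-δ₂ * s)) * ‖x - h u‖ := by ring
      _ = _ := by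
        rw [← Real.exp_add]; congr 3; rw [hγ]; ring
  have hbound' : ∀ x u s, 0 ≤ s → e x u s ≤ δ₁ * ‖x - h u‖ := by
    intro x u s hs
    refine (hbound x u s hs).trans ?_
    have : Real.exp (-γ * s) ≤ 1 := Real.exp_le_one_iff.2 (by nlinarith)
    gcongr
    nlinarith
  -- Supremum of the exponentially weighted distance along the flow with frozen input: moving the
  -- starting point along the flow by time `ε` shifts the weight and gains the factor `exp(-γ ε)`.
  set V : X → U → ℝ := fun x u => ⨆ s : Ici (0 : ℝ), e x u s with hV
  have hbdd : ∀ x u, BddAbove (range fun s : Ici (0 : ℝ) => e x u s) := fun x u =>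
    ⟨_, by rintro _ ⟨s, rfl⟩; exact hbound' x u s s.2⟩
  have hle : ∀ x u s, 0 ≤ s → e x u s ≤ V x u := fun x u s hs => le_ciSup (hbdd x u) ⟨s, hs⟩
  have hVle : ∀ x u B, (∀ s, 0 ≤ s → e x u s ≤ B) → V x u ≤ B := fun x u B H =>
    ciSup_le fun s => H s s.2
  have hlow : ∀ x u, ‖x - h u‖ ≤ V x u := fun x u => by
    have := hle x u 0 le_rfl
    simpa [he, hY0] using this
  -- Beyond `S` the weighted distance is at most its value at time zero. The Lipschitz estimate for
  -- `V` therefore needs Gronwall only on `[0, S]`, where the factor is bounded.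
  obtain ⟨S, hS0, hS⟩ : ∃ S : ℝ, 0 ≤ S ∧ ∀ s, S ≤ s → δ₁ * Real.exp (-γ * s) ≤ 1 := by
    have : Tendsto (fun s => δ₁ * Real.exp (-γ * s)) atTop (𝓝 (δ₁ * 0)) := by
      refine Tendsto.const_mul _ (Real.tendsto_exp_atBot.comp ?_)
      exact tendsto_id.const_mul_atTop_of_neg (by linarith)
    rw [mul_zero] at this
    obtain ⟨S, hS⟩ := eventually_atTop.1 (this.eventually_lt_const one_pos)
    exact ⟨max S 0, le_max_right _ _, fun s hs => (hS s ((le_max_left _ _).trans hs)).le⟩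
  set L := Real.exp (γ * S) * (Real.exp (β * S) + β_h) with hL
  have hL0 : 0 ≤ L := by positivity
  have hL1 : 1 + β_h ≤ L := by
    have h1 : 1 ≤ Real.exp (γ * S) := Real.one_le_exp (by positivity)
    have h2 : 1 ≤ Real.exp (β * S) := Real.one_le_exp (by positivity)
    rw [hL]; nlinarith
  have hlip : ∀ x u x' u', V x u ≤ V x' u' + L * (‖x - x'‖ + ‖u - u'‖) := by
    intro x u x' u'
    refine hVle _ _ _ fun s hs => ?_
    have hhu := hh u' u
    rw [norm_sub_rev u' u] at hhu
    rcases le_total s S with hsS | hsS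
    · have h1 := norm_sub_le_of_frozen hβ hr (hY x u) (hY x' u') hs
      rw [hY0, hY0] at h1
      have h2 : ‖Y x u s - h u‖ ≤
          ‖Y x' u' s - h u'‖ + (Real.exp (β * S) + β_h) * (‖x - x'‖ + ‖u - u'‖) := by
        have h3 : Y x u s - h u = (Y x u s - Y x' u' s) + (Y x' u' s - h u') + (h u' - h u) := by
          abel
        have h4 : Real.exp (β * s) ≤ Real.exp (β * S) := by gcongr
        rw [h3]
        refine (norm_add₃_le).trans ?_
        nlinarith [norm_nonneg (x - x'), norm_nonneg (u - u'),
          mul_le_mul_of_nonneg_right h4 (add_nonneg (norm_nonneg (x - x')) (norm_nonneg (u - u')))]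
      calc e x u s ≤ Real.exp (γ * s) * (‖Y x' u' s - h u'‖ +
            (Real.exp (β * S) + β_h) * (‖x - x'‖ + ‖u - u'‖)) := by simp only [he]; gcongr
        _ = e x' u' s + Real.exp (γ * s) * ((Real.exp (β * S) + β_h) * (‖x - x'‖ + ‖u - u'‖)) :=
          mul_add _ _ _
        _ ≤ V x' u' + Real.exp (γ * S) * ((Real.exp (β * S) + β_h) * (‖x - x'‖ + ‖u - u'‖)) := by
          gcongr
          exact hle x' u' s hs
        _ = _ := by rw [hL]; ring
    · have h1 : e x u s ≤ ‖x - h u‖ := by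
        have := mul_le_mul_of_nonneg_right (hS s hsS) (norm_nonneg (x - h u))
        linarith [hbound x u s hs]
      have h2 : ‖x - h u‖ ≤ ‖x' - h u'‖ + ‖x - x'‖ + ‖h u' - h u‖ := by
        have : x - h u = (x' - h u') + (x - x') + (h u' - h u) := by abel
        rw [this]; exact norm_add₃_le
      have h3 := hlow x' u'
      nlinarith [norm_nonneg (x - x'), norm_nonneg (u - u'),
        mul_nonneg hβh.le (norm_nonneg (x - x')), mul_le_mul_of_nonneg_right hL1
          (add_nonneg (norm_nonneg (x - x')) (norm_nonneg (u - u')))]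
  refine ⟨V, γ, hγ0, L, hL0, hlow, fun x u => hVle _ _ _ (hbound' x u), hlip, ?_⟩
  intro x u u' t hx hu
  have hdecay : ∀ x u ε, 0 ≤ ε → V (Y x u ε) u ≤ Real.exp (-γ * ε) * V x u := by
    intro x u ε hε
    refine hVle _ _ _ fun s hs => ?_
    have h1 : Y (Y x u ε) u s = Y x u (s + ε) := by
      have h2 := norm_sub_le_of_frozen hβ hr (u₁ := u) (u₂ := u) (hY (Y x u ε) u)
        (y₂ := fun s => Y x u (s + ε)) (fun t ht => by
          have := (hY x u (t + ε) (by linarith)).scomp t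
            (h := fun s => s + ε) (h' := 1) (s := Ici 0)
            ((hasDerivAt_id t).add_const ε).hasDerivWithinAt
            (fun s hs => by rw [mem_Ici] at hs ⊢; linarith)
          simpa [Function.comp_def] using this) hs
      rw [hY0, zero_add, sub_self, sub_self, norm_zero, norm_zero, add_zero, mul_zero] at h2
      exact sub_eq_zero.1 (norm_le_zero_iff.1 h2)
    have h3 := hle x u (s + ε) (by linarith)
    calc e (Y x u ε) u s = Real.exp (-γ * ε) * e x u (s + ε) := by
          simp only [he, h1]
          rw [← mul_assoc, ← Real.exp_add]; congr 2; ring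
      _ ≤ _ := by gcongr
  -- The frozen trajectory through `x t` is tangent to `x` at `t`. Comparing `V` along the true path
  -- with `V` along `Z` costs, to first order, only `L` times the speed of the input.
  set Z : ℝ → X := fun s => Y (x t) (u t) (s - t) with hZ
  have hZ' : HasDerivWithinAt Z (r (x t) (u t)) (Ici t) t := by
    have := (hY (x t) (u t) (t - t) (by simp)).scomp t
      (h := fun s => s - t) (h' := 1) (s := Ici t)
      ((hasDerivAt_id t).sub_const t).hasDerivWithinAt
      (fun s hs => by rw [mem_Ici] at hs ⊢; linarith)
    simpa [Function.comp_def, hZ, hY0] using this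
  have hZt : Z t = x t := by simp [hZ, hY0]
  have h1 : DiniLE (fun s => Real.exp (-γ * (s - t)) * V (x t) (u t)) (-γ * V (x t) (u t)) t := by
    have : HasDerivAt (fun s => Real.exp (-γ * (s - t)) * V (x t) (u t))
        (Real.exp (-γ * (t - t)) * (-γ * 1) * V (x t) (u t)) t :=
      ((((hasDerivAt_id t).sub_const t).const_mul (-γ)).exp).mul_const _
    simpa using this.hasDerivWithinAt.diniLE
  have h2 := DiniLE.norm_sub (hx.sub hZ')
  have h3 := DiniLE.norm_sub hu
  have h4 := h1.add ((h2.add h3).const_mul hL0)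
  rw [sub_self, norm_zero, zero_add] at h4
  refine h4.of_le (fun s hs => ?_) (by simp)
  have h5 := hlip (x s) (u s) (Z s) (u t)
  have h6 := hdecay (x t) (u t) (s - t) (sub_nonneg.2 hs)
  simp only [Pi.sub_apply, hZt, sub_self, sub_zero]
  exact h5.trans (by gcongr)

end ConverseLyapunov

end EventTriggered

/-! ### Stacked vectors and the gradients of the two costs. -/

namespace EventTriggered

section Stack

variable {N d : ℕ} {n m : Fin N → ℕ}

theorem Stack.norm_le_of_forall_norm_le {k : Fin N → ℕ} {v : Stack k} {c : ℝ}
    (h : ∀ i, ‖v i‖ ≤ c) : ‖v‖ ≤ N * c := by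
  rcases Nat.eq_zero_or_pos N with rfl | hN
  · have : v = 0 := PiLp.ext fun i => i.elim0
    simp [this]
  have hc : 0 ≤ c := (norm_nonneg _).trans (h ⟨0, hN⟩)
  have h1 : ‖v‖ ^ 2 ≤ (N * c) ^ 2 := by
    rw [PiLp.norm_sq_eq_of_L2]
    calc ∑ i, ‖v i‖ ^ 2 ≤ ∑ _i : Fin N, c ^ 2 :=
          Finset.sum_le_sum fun i _ => pow_le_pow_left₀ (norm_nonneg _) (h i) 2
      _ = N * c ^ 2 := by simp
      _ ≤ (N * c) ^ 2 := by
        have : (1 : ℝ) ≤ N := by exact_mod_cast hN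
        nlinarith [sq_nonneg c, mul_nonneg (sub_nonneg.2 this) (mul_nonneg (Nat.cast_nonneg' N :
          (0 : ℝ) ≤ N) (sq_nonneg c))]
  exact le_of_sq_le_sq h1 (by positivity)

theorem Stack.hasDerivWithinAt {k : Fin N → ℕ} {v : ℝ → Stack k} {v' : Stack k} {s : Set ℝ}
    {t : ℝ} (h : ∀ i, HasDerivWithinAt (fun r => v r i) (v' i) s t) :
    HasDerivWithinAt v v' s t := by
  refine (hasFDerivWithinAt_piLp (𝕜 := ℝ) 2 (f := v)
    (f' := ContinuousLinearMap.toSpanSingleton ℝ v')).2 fun i => ?_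
  exact HasFDerivWithinAt.congr_fderiv (h i).hasFDerivWithinAt (ContinuousLinearMap.ext fun c => by simp)

end Stack

section Problem

variable {N d : ℕ} {n m : Fin N → ℕ} (P : Problem N d n m)

namespace Problem

/-- The average of the gradients `∇₂ ℓ_j(x_j, σ(x))`. -/
def meanGrad₂ (x : Stack n) : Vec d := (1 / (N : ℝ)) • ∑ j, P.grad₂ j (x j) (P.σ x)

/-- The stacked directions `d = col(d_1, …, d_N)`. -/
def dirStack (x : Stack n) (u : Stack m) (w z : Stack fun _ : Fin N => d) : Stack m :=
  WithLp.toLp 2 fun i => P.dir i (x i) (u i) (w i) (z i)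

/-- The stacked vector field `r`. -/
def rStack (x : Stack n) (u : Stack m) : Stack n := WithLp.toLp 2 fun i => P.r i (x i) (u i)

/-- The Laplacian as a linear map. -/
def lapStack : Stack (fun _ : Fin N => d) →ₗ[ℝ] Stack (fun _ : Fin N => d) where
  toFun v := WithLp.toLp 2 (P.lap v)
  map_add' v v' := PiLp.ext fun i => by
    simp only [Problem.lap, PiLp.add_apply, ← Finset.sum_add_distrib, ← smul_add]
    exact Finset.sum_congr rfl fun j _ => by congr 1; abel
  map_smul' c v := PiLp.ext fun i => by
    simp only [Problem.lap, PiLp.smul_apply, ← smul_sub, Finset.smul_sum, RingHom.id_apply]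
    exact Finset.sum_congr rfl fun j _ => smul_comm _ _ _

theorem lapStack_apply (v : Stack fun _ : Fin N => d) (i : Fin N) :
    P.lapStack v i = P.lap v i := rfl

theorem exists_norm_lapStack_le : ∃ C, 0 ≤ C ∧ ∀ v, ‖P.lapStack v‖ ≤ C * ‖v‖ :=
  ⟨_, norm_nonneg _, fun v => (LinearMap.toContinuousLinearMap P.lapStack).le_opNorm v⟩

theorem lapStack_const (c : Vec d) : P.lapStack (WithLp.toLp 2 fun _ => c) = 0 :=
  PiLp.ext fun i => by simp [lapStack_apply, Problem.lap]

variable {P}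

theorem hasFDerivAt_ℓ (hcost : P.CostAssumption) (i : Fin N) (p : Vec (n i) × Vec d) :
    HasFDerivAt (fun p : Vec (n i) × Vec d => P.ℓ i p.1 p.2)
      ((innerSL ℝ (P.grad₁ i p.1 p.2)).comp (ContinuousLinearMap.fst ℝ _ _) +
        (innerSL ℝ (P.grad₂ i p.1 p.2)).comp (ContinuousLinearMap.snd ℝ _ _)) p := by
  have h := (hcost.ℓ_differentiable i p).hasFDerivAt
  set D := fderiv ℝ (fun p : Vec (n i) × Vec d => P.ℓ i p.1 p.2) p
  have h1 : HasFDerivAt (fun s => P.ℓ i s p.2) (D.comp (ContinuousLinearMap.inl ℝ _ _)) p.1 :=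
    HasFDerivAt.comp (g := fun p : Vec (n i) × Vec d => P.ℓ i p.1 p.2)
      (f := fun s => (s, p.2)) p.1 h (hasFDerivAt_prodMk_left p.1 p.2)
  have h2 : HasFDerivAt (fun s => P.ℓ i p.1 s) (D.comp (ContinuousLinearMap.inr ℝ _ _)) p.2 :=
    HasFDerivAt.comp (g := fun p : Vec (n i) × Vec d => P.ℓ i p.1 p.2)
      (f := fun s => (p.1, s)) p.2 h (hasFDerivAt_prodMk_right p.1 p.2)
  have e1 := h1.differentiableAt.hasGradientAt.hasFDerivAt.unique h1
  have e2 := h2.differentiableAt.hasGradientAt.hasFDerivAt.unique h2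
  refine h.congr_fderiv (ContinuousLinearMap.ext fun v => ?_)
  have e3 := congrArg (fun L => L v.1) e1
  have e4 := congrArg (fun L => L v.2) e2
  simp only [InnerProductSpace.toDual_apply_apply, ContinuousLinearMap.comp_apply,
    ContinuousLinearMap.inl_apply, ContinuousLinearMap.inr_apply] at e3 e4
  simp only [add_apply, ContinuousLinearMap.comp_apply,
    ContinuousLinearMap.coe_fst', ContinuousLinearMap.coe_snd', innerSL_apply_apply, grad₁, grad₂,
    e3, e4, ← map_add]
  simp

theorem hasFDerivAt_apply {k : Fin N → ℕ} (i : Fin N) (x : Stack k) :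
    HasFDerivAt (fun y : Stack k => y i) (PiLp.proj (𝕜 := ℝ) 2 (fun i => Vec (k i)) i) x :=
  (PiLp.proj (𝕜 := ℝ) 2 (fun i => Vec (k i)) i).hasFDerivAt

theorem hasFDerivAt_σ (hcost : P.CostAssumption) (x : Stack n) :
    HasFDerivAt P.σ ((1 / (N : ℝ)) • ∑ i, (fderiv ℝ (P.φ i) (x i)).comp
      (PiLp.proj (𝕜 := ℝ) 2 (fun i => Vec (n i)) i)) x := by
  have h : HasFDerivAt (fun x : Stack n => ∑ i, P.φ i (x i)) (∑ i, (fderiv ℝ (P.φ i) (x i)).comp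
      (PiLp.proj (𝕜 := ℝ) 2 (fun i => Vec (n i)) i)) x := by
    refine HasFDerivAt.fun_sum fun i _ => ?_
    exact HasFDerivAt.comp (g := P.φ i) (f := fun y : Stack n => y i) x
      (((hcost.φ_smooth i).differentiable one_ne_zero) (x i)).hasFDerivAt (hasFDerivAt_apply i x)
  exact h.const_smul (1 / (N : ℝ))

/-- Each robot influences every local cost through `σ`; interchanging the two sums collects these
contributions into the average of the `∇₂ ℓ_j`. This average is what `z_i + ∇₂ ℓ_i` has to estimate.
-/
theorem hasGradientAt_cost (hcost : P.CostAssumption) (x : Stack n) :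
    HasGradientAt P.cost (WithLp.toLp 2 fun i =>
      P.grad₁ i (x i) (P.σ x) + P.gradφ i (x i) (P.meanGrad₂ x)) x := by
  have h : HasFDerivAt P.cost (∑ i, ((innerSL ℝ (P.grad₁ i (x i) (P.σ x))).comp
      (ContinuousLinearMap.fst ℝ _ _) + (innerSL ℝ (P.grad₂ i (x i) (P.σ x))).comp
      (ContinuousLinearMap.snd ℝ _ _)).comp
      ((PiLp.proj (𝕜 := ℝ) 2 (fun i => Vec (n i)) i).prod ((1 / (N : ℝ)) •
        ∑ i, (fderiv ℝ (P.φ i) (x i)).comp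
          (PiLp.proj (𝕜 := ℝ) 2 (fun i => Vec (n i)) i)))) x := by
    unfold Problem.cost
    refine HasFDerivAt.fun_sum fun i _ => ?_
    exact HasFDerivAt.comp (g := fun p : Vec (n i) × Vec d => P.ℓ i p.1 p.2)
      (f := fun y : Stack n => (y i, P.σ y)) x (hasFDerivAt_ℓ hcost i (x i, P.σ x))
      ((hasFDerivAt_apply i x).prodMk (hasFDerivAt_σ hcost x))
  rw [hasGradientAt_iff_hasFDerivAt]
  refine h.congr_fderiv (ContinuousLinearMap.ext fun v => ?_)
  rw [InnerProductSpace.toDual_apply_apply, PiLp.inner_apply]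
  simp only [inner_add_left, gradφ,
    ContinuousLinearMap.adjoint_inner_left, meanGrad₂, Finset.sum_add_distrib,
    sum_apply, ContinuousLinearMap.comp_apply, add_apply,
    ContinuousLinearMap.prod_apply, ContinuousLinearMap.coe_fst', ContinuousLinearMap.coe_snd',
    innerSL_apply_apply, smul_apply, PiLp.proj_apply]
  congr 1
  rw [← inner_sum, ← sum_inner, real_inner_smul_left, real_inner_smul_right]

theorem hasFDerivAt_hStack (hss : P.SteadyStateAssumption) (u : Stack m) (i : Fin N) :
    HasFDerivAt (fun v => P.hStack v i) ((fderiv ℝ (P.h i) (u i)).comp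
      (PiLp.proj (𝕜 := ℝ) 2 (fun i => Vec (m i)) i)) u :=
  HasFDerivAt.comp (g := P.h i) (f := fun y : Stack m => y i) u
    (((hss.h_smooth i).differentiable one_ne_zero) (u i)).hasFDerivAt (hasFDerivAt_apply i u)

theorem gradient_reducedCost_apply (hss : P.SteadyStateAssumption) (hcost : P.CostAssumption)
    (u : Stack m) (i : Fin N) :
    gradient P.reducedCost u i = P.gradH i (u i) (gradient P.cost (P.hStack u) i) := by
  have h1 : DifferentiableAt ℝ P.hStack u :=
    (differentiableAt_piLp 2).2 fun i => (hasFDerivAt_hStack hss u i).differentiableAt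
  have h2 := (hasGradientAt_cost hcost (P.hStack u)).differentiableAt.hasGradientAt.hasFDerivAt
  have h3 := h2.comp u h1.hasFDerivAt
  have h4 : HasGradientAt P.reducedCost
      (WithLp.toLp 2 fun i => P.gradH i (u i) (gradient P.cost (P.hStack u) i)) u := by
    rw [hasGradientAt_iff_hasFDerivAt]
    refine h3.congr_fderiv (ContinuousLinearMap.ext fun v => ?_)
    rw [ContinuousLinearMap.comp_apply, InnerProductSpace.toDual_apply_apply,
      InnerProductSpace.toDual_apply_apply, PiLp.inner_apply, PiLp.inner_apply]
    simp only [gradH, ContinuousLinearMap.adjoint_inner_left]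
    refine Finset.sum_congr rfl fun i _ => ?_
    congr 1
    have h5 := (hasFDerivAt_hStack hss u i).unique
      ((hasFDerivAt_apply i (P.hStack u)).comp u h1.hasFDerivAt)
    simpa using (congrArg (fun L => L v) h5).symm
  rw [h4.gradient]

theorem norm_gradH_le {β : ℝ} (hβ : 0 ≤ β)
    (h : ∀ i u u', ‖P.h i u - P.h i u'‖ ≤ β * ‖u - u'‖) (i : Fin N) (u : Vec (m i)) :
    ‖P.gradH i u‖ ≤ β := by
  rw [gradH, LinearIsometryEquiv.norm_map]
  have : LipschitzWith β.toNNReal (P.h i) := LipschitzWith.of_dist_le_mul fun v v' => by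
    rw [dist_eq_norm, dist_eq_norm, Real.coe_toNNReal _ hβ]; exact h i v v'
  simpa [hβ] using norm_fderiv_le_of_lipschitz ℝ this (x₀ := u)

end Problem

end Problem

end EventTriggered

/-! ### Tracking errors and Lipschitz estimates. -/

namespace EventTriggered

variable {N d : ℕ} {n m : Fin N → ℕ} {P : Problem N d n m}

namespace Problem

theorem norm_gradφ_le {β : NNReal} (h : ∀ i, LipschitzWith β (P.φ i)) (i : Fin N)
    (x : Vec (n i)) : ‖P.gradφ i x‖ ≤ β := by
  rw [gradφ, LinearIsometryEquiv.norm_map]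
  exact norm_fderiv_le_of_lipschitz ℝ (h i)

/-- So the tracking error of `w` is the deviation of the transmitted signal `q_i` from the true
aggregate. -/
theorem πw_sub (x : Stack n) (w : Stack fun _ : Fin N => d) (i : Fin N) :
    (w - P.πw x) i = w i + P.φ i (x i) - P.σ x := by
  rw [PiLp.sub_apply]; simp only [πw]; abel

theorem πz_sub (x : Stack n) (z : Stack fun _ : Fin N => d) (i : Fin N) :
    (z - P.πz x) i = z i + P.grad₂ i (x i) (P.σ x) - P.meanGrad₂ x := by
  rw [PiLp.sub_apply]; simp only [πz, meanGrad₂]; abel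

/-- Together with conservation of the sum of `w` this keeps the consensus error in the zero-sum
subspace, where the Laplacian is coercive. -/
theorem sum_πw (hN : 0 < N) (x : Stack n) : ∑ i, P.πw x i = 0 := by
  have hN' : (N : ℝ) ≠ 0 := by positivity
  simp only [πw, Finset.sum_add_distrib, Finset.sum_neg_distrib, Finset.sum_const,
    Finset.card_univ, Fintype.card_fin, σ]
  rw [← Nat.cast_smul_eq_nsmul ℝ, smul_smul, mul_one_div_cancel hN', one_smul, neg_add_cancel]

theorem sum_πz (hN : 0 < N) (x : Stack n) : ∑ i, P.πz x i = 0 := by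
  have hN' : (N : ℝ) ≠ 0 := by positivity
  simp only [πz, Finset.sum_add_distrib, Finset.sum_neg_distrib, Finset.sum_const,
    Finset.card_univ, Fintype.card_fin]
  rw [← Nat.cast_smul_eq_nsmul ℝ, smul_smul, mul_one_div_cancel hN', one_smul, neg_add_cancel]

theorem norm_avg_sub_le (hN : 0 < N) {a b : Fin N → Vec d} {c : ℝ} (h : ∀ i, ‖a i - b i‖ ≤ c) :
    ‖(1 / (N : ℝ)) • ∑ i, a i - (1 / (N : ℝ)) • ∑ i, b i‖ ≤ c := by
  have hN' : (0 : ℝ) < N := by exact_mod_cast hN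
  rw [← smul_sub, ← Finset.sum_sub_distrib, norm_smul, Real.norm_of_nonneg (by positivity),
    one_div, inv_mul_le_iff₀ hN']
  refine (norm_sum_le_of_le _ fun i _ => h i).trans ?_
  simp

theorem exists_σ_lipschitz (hN : 0 < N) (hcost : P.CostAssumption) :
    ∃ C, 0 ≤ C ∧ ∀ x x', ‖P.σ x - P.σ x'‖ ≤ C * ‖x - x'‖ := by
  obtain ⟨β, hβ⟩ := hcost.φ_lipschitz
  refine ⟨β, β.2, fun x x' => norm_avg_sub_le hN fun i => ((hβ i).norm_sub_le _ _).trans ?_⟩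
  gcongr
  exact PiLp.norm_apply_le (x - x') i

theorem exists_grad₂_lipschitz (hcost : P.CostAssumption) :
    ∃ C, 0 ≤ C ∧ ∀ i x y x' y',
      ‖P.grad₂ i x y - P.grad₂ i x' y'‖ ≤ C * (‖x - x'‖ + ‖y - y'‖) := by
  obtain ⟨β, hβ⟩ := hcost.grad₂_lipschitz
  refine ⟨β, β.2, fun i x y x' y' => ((hβ i).norm_sub_le (x, y) (x', y')).trans ?_⟩
  gcongr
  rw [Prod.mk_sub_mk, Prod.norm_mk]
  exact max_le_add_of_nonneg (norm_nonneg _) (norm_nonneg _)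

theorem exists_grad₁_lipschitz (hcost : P.CostAssumption) :
    ∃ C, 0 ≤ C ∧ ∀ i x y x' y',
      ‖P.grad₁ i x y - P.grad₁ i x' y'‖ ≤ C * (‖x - x'‖ + ‖y - y'‖) := by
  obtain ⟨β, hβ⟩ := hcost.grad₁_lipschitz
  refine ⟨β, β.2, fun i x y x' y' => ((hβ i).norm_sub_le (x, y) (x', y')).trans ?_⟩
  gcongr
  rw [Prod.mk_sub_mk, Prod.norm_mk]
  exact max_le_add_of_nonneg (norm_nonneg _) (norm_nonneg _)

theorem exists_πw_lipschitz (hN : 0 < N) (hcost : P.CostAssumption) :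
    ∃ C, 0 ≤ C ∧ ∀ x x', ‖P.πw x - P.πw x'‖ ≤ C * ‖x - x'‖ := by
  obtain ⟨β, hβ⟩ := hcost.φ_lipschitz
  obtain ⟨C, hC0, hC⟩ := exists_σ_lipschitz hN hcost
  refine ⟨N * (β + C), by positivity, fun x x' => ?_⟩
  rw [mul_assoc]
  refine Stack.norm_le_of_forall_norm_le fun i => ?_
  have h1 : (P.πw x - P.πw x') i = (P.φ i (x' i) - P.φ i (x i)) + (P.σ x - P.σ x') := by
    rw [PiLp.sub_apply]; simp only [πw]; abel
  have h2 := PiLp.norm_apply_le (x - x') i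
  rw [PiLp.sub_apply] at h2
  have h3 := (hβ i).norm_sub_le (x' i) (x i)
  rw [norm_sub_rev (x' i)] at h3
  rw [h1]
  refine (norm_add_le _ _).trans ?_
  have h4 := mul_le_mul_of_nonneg_left h2 β.2
  have h5 := hC x x'
  rw [add_mul]
  exact add_le_add (h3.trans h4) h5

theorem exists_grad₂_σ_lipschitz (hN : 0 < N) (hcost : P.CostAssumption) :
    ∃ C, 0 ≤ C ∧ ∀ i (x x' : Stack n),
      ‖P.grad₂ i (x i) (P.σ x) - P.grad₂ i (x' i) (P.σ x')‖ ≤ C * ‖x - x'‖ := by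
  obtain ⟨C₁, hC₁0, hC₁⟩ := exists_grad₂_lipschitz hcost
  obtain ⟨C, hC0, hC⟩ := exists_σ_lipschitz hN hcost
  refine ⟨C₁ * (1 + C), by positivity, fun i x x' => (hC₁ i _ _ _ _).trans ?_⟩
  have h2 := PiLp.norm_apply_le (x - x') i
  rw [PiLp.sub_apply] at h2
  rw [mul_assoc]
  gcongr
  linarith [hC x x']

theorem exists_πz_lipschitz (hN : 0 < N) (hcost : P.CostAssumption) :
    ∃ C, 0 ≤ C ∧ ∀ x x', ‖P.πz x - P.πz x'‖ ≤ C * ‖x - x'‖ := by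
  obtain ⟨C, hC0, hC⟩ := exists_grad₂_σ_lipschitz hN hcost
  refine ⟨N * (C + C), by positivity, fun x x' => ?_⟩
  rw [mul_assoc]
  refine Stack.norm_le_of_forall_norm_le fun i => ?_
  have h1 : (P.πz x - P.πz x') i =
      (P.grad₂ i (x' i) (P.σ x') - P.grad₂ i (x i) (P.σ x)) + (P.meanGrad₂ x - P.meanGrad₂ x') := by
    rw [PiLp.sub_apply]; simp only [πz, meanGrad₂]; abel
  have h2 := hC i x' x
  rw [norm_sub_rev x' x] at h2
  have h3 : ‖P.meanGrad₂ x - P.meanGrad₂ x'‖ ≤ C * ‖x - x'‖ :=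
    norm_avg_sub_le hN fun i => hC i x x'
  rw [h1, add_mul]
  exact (norm_add_le _ _).trans (add_le_add h2 h3)

theorem exists_rStack_le (hss : P.SteadyStateAssumption) :
    ∃ C, 0 ≤ C ∧ ∀ x u, ‖P.rStack x u‖ ≤ C * ‖x - P.hStack u‖ := by
  obtain ⟨β, hβ0, hβ⟩ := hss.r_lipschitz
  refine ⟨N * β, by positivity, fun x u => ?_⟩
  rw [mul_assoc]
  refine Stack.norm_le_of_forall_norm_le fun i => ?_
  have h1 := hβ i (x i) (u i) (P.h i (u i)) (u i)
  rw [hss.equilibrium, sub_zero, sub_self, norm_zero, mul_zero, add_zero] at h1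
  refine h1.trans ?_
  gcongr
  exact PiLp.norm_apply_le (x - P.hStack u) i

/-- The control direction differs from the gradient of the reduced cost by at most the tracking
errors. -/
theorem exists_dirStack_sub_gradient_le (hss : P.SteadyStateAssumption)
    (hcost : P.CostAssumption) :
    ∃ C, 0 ≤ C ∧ ∀ x u w z, ‖P.dirStack x u w z - gradient P.reducedCost u‖ ≤
      C * (‖x - P.hStack u‖ + ‖w - P.πw x‖ + ‖z - P.πz x‖) := by
  obtain ⟨βh, hβh0, hβh⟩ := hss.h_lipschitz
  obtain ⟨βφ, hβφ⟩ := hcost.φ_lipschitz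
  obtain ⟨C₁, hC₁0, hC₁⟩ := exists_grad₁_lipschitz hcost
  obtain ⟨C₂, hC₂0, hC₂⟩ := exists_grad₂_lipschitz hcost
  obtain ⟨βc, hβc⟩ := hcost.cost_lipschitz
  have hβφ0 : (0 : ℝ) ≤ βφ := βφ.2
  have hβc0 : (0 : ℝ) ≤ βc := βc.2
  refine ⟨N * (βh * (C₁ + βφ * C₂ + βφ + βc)), by positivity, fun x u w z => ?_⟩
  rw [mul_assoc (N : ℝ)]
  refine Stack.norm_le_of_forall_norm_le fun i => ?_
  have hw := PiLp.norm_apply_le (w - P.πw x) i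
  have hz := PiLp.norm_apply_le (z - P.πz x) i
  rw [πw_sub] at hw
  rw [πz_sub] at hz
  set q := w i + P.φ i (x i) with hq
  have hF : gradient P.cost x i =
      P.grad₁ i (x i) (P.σ x) + P.gradφ i (x i) (P.meanGrad₂ x) := by
    rw [(hasGradientAt_cost hcost x).gradient]
  have hc := (PiLp.norm_apply_le (gradient P.cost x - gradient P.cost (P.hStack u)) i).trans
    (hβc.norm_sub_le x (P.hStack u))
  rw [PiLp.sub_apply] at hc
  -- Both sides carry the same factor `∇h_i(u_i)`, so it factors out. What remains are the errors
  -- from using `q_i` for `σ`, from using `s_i` for the mean gradient, and from evaluating the cost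
  -- gradient at `x` instead of `h(u)`.
  have e1 : (P.dirStack x u w z - gradient P.reducedCost u) i = P.gradH i (u i)
      ((P.grad₁ i (x i) q - P.grad₁ i (x i) (P.σ x)) + P.gradφ i (x i)
        ((P.grad₂ i (x i) q - P.grad₂ i (x i) (P.σ x)) +
          (z i + P.grad₂ i (x i) (P.σ x) - P.meanGrad₂ x)) +
        (gradient P.cost x i - gradient P.cost (P.hStack u) i)) := by
    rw [PiLp.sub_apply, gradient_reducedCost_apply hss hcost, hF]
    simp only [dirStack, dir, ← hq, map_add, map_sub]
    abel
  have h1 : ‖P.grad₁ i (x i) q - P.grad₁ i (x i) (P.σ x)‖ ≤ C₁ * ‖w - P.πw x‖ := by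
    refine (hC₁ i _ _ _ _).trans ?_
    rw [sub_self, norm_zero, zero_add]; gcongr
  have h2 : ‖P.grad₂ i (x i) q - P.grad₂ i (x i) (P.σ x)‖ ≤ C₂ * ‖w - P.πw x‖ := by
    refine (hC₂ i _ _ _ _).trans ?_
    rw [sub_self, norm_zero, zero_add]; gcongr
  have h3 : ‖P.gradφ i (x i) ((P.grad₂ i (x i) q - P.grad₂ i (x i) (P.σ x)) +
      (z i + P.grad₂ i (x i) (P.σ x) - P.meanGrad₂ x))‖ ≤
      βφ * (C₂ * ‖w - P.πw x‖ + ‖z - P.πz x‖) := by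
    refine (ContinuousLinearMap.le_opNorm _ _).trans ?_
    exact mul_le_mul (norm_gradφ_le hβφ i _) ((norm_add_le _ _).trans (add_le_add h2 hz))
      (norm_nonneg _) hβφ0
  rw [e1, mul_assoc]
  refine (ContinuousLinearMap.le_opNorm _ _).trans ?_
  refine mul_le_mul (norm_gradH_le hβh0.le hβh i _) ((norm_add₃_le).trans
    (add_le_add (add_le_add h1 h3) hc |>.trans ?_)) (norm_nonneg _) hβh0.le
  set X := ‖x - P.hStack u‖
  set A := ‖w - P.πw x‖
  set B := ‖z - P.πz x‖
  have hX : 0 ≤ X := norm_nonneg _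
  have hA : 0 ≤ A := norm_nonneg _
  have hB : 0 ≤ B := norm_nonneg _
  have p1 := mul_nonneg hC₁0 hX
  have p2 := mul_nonneg hC₁0 hB
  have p3 := mul_nonneg (mul_nonneg hβφ0 hC₂0) hX
  have p4 := mul_nonneg (mul_nonneg hβφ0 hC₂0) hB
  have p5 := mul_nonneg hβφ0 hX
  have p6 := mul_nonneg hβφ0 hA
  have p7 := mul_nonneg hβc0 hA
  have p8 := mul_nonneg hβc0 hB
  nlinarith

end Problem

end EventTriggered

/-! ### Solutions of the closed loop in stacked form. -/

namespace EventTriggered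

variable {N d : ℕ} {n m : Fin N → ℕ} {P : Problem N d n m} {c : Run N d n m} {p : Params}
  {T : EReal}

theorem Vec.hasDerivWithinAt {k : ℕ} {v : ℝ → Vec k} {v' : Vec k} {s : Set ℝ}
    {t : ℝ} (h : ∀ i, HasDerivWithinAt (fun r => v r i) (v' i) s t) :
    HasDerivWithinAt v v' s t := by
  refine (hasFDerivWithinAt_piLp (𝕜 := ℝ) 2 (f := v)
    (f' := ContinuousLinearMap.toSpanSingleton ℝ v')).2 fun i => ?_
  exact HasDerivWithinAt.hasFDerivWithinAt (h i) |>.congr_fderiv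
    (ContinuousLinearMap.ext fun c => by simp)

namespace Run

/-- The samples of the signals `w_i + φ_i(x_i)` in use at time `t`. -/
def sampledW (c : Run N d n m) (P : Problem N d n m) (t : ℝ) : Stack fun _ : Fin N => d :=
  WithLp.toLp 2 fun i => c.sigW P i (c.last i t)

/-- The samples of the signals `z_i + ∇₂ ℓ_i(x_i, w_i + φ_i(x_i))` in use at time `t`. -/
def sampledZ (c : Run N d n m) (P : Problem N d n m) (t : ℝ) : Stack fun _ : Fin N => d :=
  WithLp.toLp 2 fun i => c.sigZ P i (c.last i t)

/-- The stacked direction `d` at time `t`. -/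
def dirStackAt (c : Run N d n m) (P : Problem N d n m) (t : ℝ) : Stack m :=
  P.dirStack (c.x t) (c.u t) (c.w t) (c.z t)

theorem norm_sigW_sub_le (i : Fin N) (s t : ℝ) :
    ‖c.sigW P i t - c.sigW P i s‖ ≤ c.errNorm P i s t := by
  unfold errNorm
  exact WithLp.norm_fst_le _ (WithLp.toLp 2 (c.sigW P i t - c.sigW P i s,
    c.sigZ P i t - c.sigZ P i s))

theorem norm_sigZ_sub_le (i : Fin N) (s t : ℝ) :
    ‖c.sigZ P i t - c.sigZ P i s‖ ≤ c.errNorm P i s t := by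
  unfold errNorm
  exact WithLp.norm_snd_le _ (WithLp.toLp 2 (c.sigW P i t - c.sigW P i s,
    c.sigZ P i t - c.sigZ P i s))

theorem last_eq_of_isGreatest {i : Fin N} {t : ℝ} {k : ℕ} (hmono : Monotone (c.τ i)) {s : ℝ}
    (hs : c.τ i k = (s : EReal)) (hst : s ≤ t) (ht : (t : EReal) < c.τ i (k + 1)) :
    c.last i t = s := by
  refine IsGreatest.csSup_eq ⟨⟨hst, k, hs⟩, ?_⟩
  rintro r ⟨hr, j, hj⟩
  have hjk : j ≤ k := by
    by_contra! h
    have h1 := hmono (Nat.succ_le_of_lt h)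
    rw [Nat.succ_eq_add_one, hj] at h1
    exact absurd (ht.trans_le h1) (not_lt.2 (EReal.coe_le_coe_iff.2 hr))
  have := hmono hjk
  rw [hj, hs] at this
  exact EReal.coe_le_coe_iff.1 this

namespace IsSolution

theorem monotone_τ (hc : c.IsSolution P p T) (i : Fin N) : Monotone (c.τ i) :=
  monotone_nat_of_le_succ fun k => by
    rcases lt_or_eq_of_le (le_top (a := c.τ i k)) with h | h
    · exact (hc.τ_lt i k h).le
    · rw [hc.τ_top i k h]; exact le_top

theorem τ_nonneg (hc : c.IsSolution P p T) (i : Fin N) (k : ℕ) : 0 ≤ c.τ i k := by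
  rw [← hc.τ_zero i]; exact hc.monotone_τ i (Nat.zero_le k)

theorem coe_toReal_τ (hc : c.IsSolution P p T) {i : Fin N} {k : ℕ} (h : c.τ i k < ⊤) :
    ((c.τ i k).toReal : EReal) = c.τ i k :=
  EReal.coe_toReal h.ne (fun h' => by
    have := hc.τ_nonneg i k
    rw [h'] at this
    exact absurd this (by simp))

theorem exists_sample (hc : c.IsSolution P p T) (i : Fin N) {t : ℝ} (ht0 : 0 ≤ t)
    (htT : (t : EReal) < T) :
    ∃ k, c.τ i k = (c.last i t : EReal) ∧ c.last i t ≤ t ∧ 0 ≤ c.last i t ∧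
      (t : EReal) < c.τ i (k + 1) := by
  classical
  have hex := hc.locally_finite i t htT
  -- The first triggering index beyond `t` is not zero, because the zeroth triggering time is `0`;
  -- its predecessor is the sample in use.
  obtain ⟨k, hk⟩ : ∃ k, Nat.find hex = k + 1 := Nat.exists_eq_succ_of_ne_zero fun h => by
    have := Nat.find_spec hex
    rw [h, hc.τ_zero] at this
    exact absurd this (not_lt.2 (EReal.coe_nonneg.2 ht0))
  have h1 : (t : EReal) < c.τ i (k + 1) := hk ▸ Nat.find_spec hex
  have h2 : c.τ i k ≤ t := not_lt.1 (Nat.find_min hex (by omega))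
  have h3 := hc.coe_toReal_τ (i := i) (k := k) (h2.trans_lt (EReal.coe_lt_top t))
  have h4 : (c.τ i k).toReal ≤ t := by rw [← h3] at h2; exact EReal.coe_le_coe_iff.1 h2
  have h5 := last_eq_of_isGreatest (hc.monotone_τ i) h3.symm h4 h1
  refine ⟨k, by rw [h5, h3], h5 ▸ h4, ?_, h1⟩
  rw [h5]
  exact EReal.toReal_nonneg (hc.τ_nonneg i k)

theorem errNorm_le (hc : c.IsSolution P p T) (i : Fin N) {t : ℝ} (ht0 : 0 ≤ t)
    (htT : (t : EReal) < T) : c.errNorm P i (c.last i t) t ≤ c.threshold P p i t := by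
  obtain ⟨k, hk, hle, -, hlt⟩ := hc.exists_sample i ht0 htT
  have := hc.not_exceeded i k t (by rw [hk]; exact EReal.coe_le_coe_iff.2 hle) hlt htT
  rwa [hk, EReal.toReal_coe] at this

theorem threshold_le (hl : 0 ≤ p.lam) (i : Fin N) (t : ℝ) :
    c.threshold P p i t ≤ p.lam * ‖c.dirStackAt P t‖ + ‖c.ξ t‖ := by
  unfold threshold
  have h1 := PiLp.norm_apply_le (c.dirStackAt P t) i
  have h2 := PiLp.norm_apply_le (c.ξ t) i
  exact add_le_add (mul_le_mul_of_nonneg_left h1 hl) h2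

theorem hasDeriv_x (hc : c.IsSolution P p T) {t : ℝ} (ht0 : 0 ≤ t) (htT : (t : EReal) < T) :
    HasDerivWithinAt c.x (P.rStack (c.x t) (c.u t)) (Ici t) t :=
  Stack.hasDerivWithinAt fun i => hc.ode_x t ht0 htT i

theorem hasDeriv_u (hc : c.IsSolution P p T) {t : ℝ} (ht0 : 0 ≤ t) (htT : (t : EReal) < T) :
    HasDerivWithinAt c.u (-(p.α₁ • c.dirStackAt P t)) (Ici t) t :=
  Stack.hasDerivWithinAt fun i => hc.ode_u t ht0 htT i

theorem hasDeriv_ξ (hc : c.IsSolution P p T) {t : ℝ} (ht0 : 0 ≤ t) (htT : (t : EReal) < T) :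
    HasDerivWithinAt c.ξ (-(p.ν • c.ξ t)) (Ici t) t :=
  Vec.hasDerivWithinAt fun i => hc.ode_ξ t ht0 htT i

theorem hasDeriv_w (hc : c.IsSolution P p T) {t : ℝ} (ht0 : 0 ≤ t) (htT : (t : EReal) < T) :
    HasDerivWithinAt c.w (-((1 / p.α₂) • P.lapStack (c.sampledW P t))) (Ici t) t :=
  Stack.hasDerivWithinAt fun i => hc.ode_w t ht0 htT i

theorem hasDeriv_z (hc : c.IsSolution P p T) {t : ℝ} (ht0 : 0 ≤ t) (htT : (t : EReal) < T) :
    HasDerivWithinAt c.z (-((1 / p.α₂) • P.lapStack (c.sampledZ P t))) (Ici t) t :=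
  Stack.hasDerivWithinAt fun i => hc.ode_z t ht0 htT i

theorem Icc_subset {t : ℝ} (htT : (t : EReal) < T) :
    Icc 0 t ⊆ {t : ℝ | 0 ≤ t ∧ (t : EReal) < T} := fun _ hs =>
  ⟨hs.1, (EReal.coe_le_coe_iff.2 hs.2).trans_lt htT⟩

theorem sum_eq_zero_of_lap (hnet : P.NetworkAssumption) {v : ℝ → Stack fun _ : Fin N => d}
    {a : ℝ} {q : ℝ → Stack fun _ : Fin N => d} {t : ℝ} (ht : 0 ≤ t)
    (hcont : ContinuousOn v (Icc 0 t))
    (hv : ∀ s ∈ Ico 0 t, HasDerivWithinAt v (-(a • P.lapStack (q s))) (Ici s) s)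
    (h0 : ∑ i, v 0 i = 0) : ∑ i, v t i = 0 := by
  rw [← h0]
  refine constant_of_has_deriv_right_zero (f := fun s => ∑ i, v s i) (a := 0) (b := t) ?_ ?_ t
    (right_mem_Icc.2 ht)
  · exact (by fun_prop : Continuous fun y : Stack fun _ : Fin N => d => ∑ i, y i).comp_continuousOn
      hcont
  · intro s hs
    have h1 : HasDerivWithinAt (fun s => ∑ i, v s i)
        (∑ i, (-(a • P.lapStack (q s))) i) (Ici s) s :=
      HasDerivWithinAt.fun_sum fun i _ =>
        ((Problem.hasFDerivAt_apply i (v s)).comp_hasDerivWithinAt s (hv s hs))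
    have h2 : ∑ i, (-(a • P.lapStack (q s))) i = 0 := by
      simp only [PiLp.neg_apply, PiLp.smul_apply, Finset.sum_neg_distrib, ← Finset.smul_sum,
        Problem.lapStack_apply, P.sum_lap hnet, smul_zero, neg_zero]
    rwa [h2] at h1

theorem cont_w (hc : c.IsSolution P p T) :
    ContinuousOn c.w {t : ℝ | 0 ≤ t ∧ (t : EReal) < T} :=
  (by fun_prop : Continuous fun s : State N d n m => s.2.2.1).comp_continuousOn hc.cont

theorem cont_z (hc : c.IsSolution P p T) :
    ContinuousOn c.z {t : ℝ | 0 ≤ t ∧ (t : EReal) < T} :=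
  (by fun_prop : Continuous fun s : State N d n m => s.2.2.2.1).comp_continuousOn hc.cont

theorem sum_w (hnet : P.NetworkAssumption) (hc : c.IsSolution P p T) (h0 : ∑ i, c.w 0 i = 0)
    {t : ℝ} (ht0 : 0 ≤ t) (htT : (t : EReal) < T) : ∑ i, c.w t i = 0 :=
  sum_eq_zero_of_lap hnet ht0 (hc.cont_w.mono (Icc_subset htT)) (fun _ hs =>
    hc.hasDeriv_w hs.1 ((EReal.coe_lt_coe_iff.2 hs.2).trans htT)) h0

theorem sum_z (hnet : P.NetworkAssumption) (hc : c.IsSolution P p T) (h0 : ∑ i, c.z 0 i = 0)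
    {t : ℝ} (ht0 : 0 ≤ t) (htT : (t : EReal) < T) : ∑ i, c.z t i = 0 :=
  sum_eq_zero_of_lap hnet ht0 (hc.cont_z.mono (Icc_subset htT)) (fun _ hs =>
    hc.hasDeriv_z hs.1 ((EReal.coe_lt_coe_iff.2 hs.2).trans htT)) h0

/-- The Laplacian of the samples of `w + φ(x)`, in terms of the tracking error. -/
theorem exists_lap_sampledW (hl : 0 ≤ p.lam) (hc : c.IsSolution P p T) {t : ℝ} (ht0 : 0 ≤ t)
    (htT : (t : EReal) < T) :
    ∃ e : Stack fun _ : Fin N => d,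
      ‖e‖ ≤ N * (p.lam * ‖c.dirStackAt P t‖ + ‖c.ξ t‖) ∧
      P.lapStack (c.sampledW P t) = P.lapStack (c.w t - P.πw (c.x t)) - P.lapStack e := by
  refine ⟨WithLp.toLp 2 fun i => c.sigW P i t - c.sigW P i (c.last i t), ?_, ?_⟩
  · exact Stack.norm_le_of_forall_norm_le fun i => (norm_sigW_sub_le i _ _).trans
      ((hc.errNorm_le i ht0 htT).trans (threshold_le hl i t))
  -- The transmitted signals differ from `w - π^w(x)` by the vector with all entries `σ(x)`, which
  -- the Laplacian annihilates.
  · rw [← sub_zero (P.lapStack (c.w t - _) - _), ← neg_zero, ← P.lapStack_const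
      (P.σ (c.x t)), ← map_neg, ← map_sub, ← map_sub]
    congr 1
    refine PiLp.ext fun i => ?_
    rw [PiLp.sub_apply, PiLp.sub_apply, P.πw_sub, PiLp.neg_apply]
    simp only [sampledW, sigW]
    abel

/-- The transmitted signal evaluates `∇₂ ℓ_i` at `q_i`, whereas `π^z` uses `σ(x)`. This mismatch
adds a multiple of the error of `w` to the sampling error, which makes the two consensus loops a
cascade. -/
theorem exists_lap_sampledZ (hcost : P.CostAssumption) :
    ∃ C, 0 ≤ C ∧ ∀ (c : Run N d n m) (p : Params) (T : EReal), 0 ≤ p.lam →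
      c.IsSolution P p T → ∀ t : ℝ, 0 ≤ t → (t : EReal) < T →
      ∃ e : Stack fun _ : Fin N => d,
        ‖e‖ ≤ N * (p.lam * ‖c.dirStackAt P t‖ + ‖c.ξ t‖) + C * ‖c.w t - P.πw (c.x t)‖ ∧
        P.lapStack (c.sampledZ P t) = P.lapStack (c.z t - P.πz (c.x t)) - P.lapStack e := by
  obtain ⟨C, hC0, hC⟩ := Problem.exists_grad₂_lipschitz hcost
  refine ⟨N * C, by positivity, fun c p T hl hc t ht0 htT => ?_⟩
  refine ⟨WithLp.toLp 2 fun i => (c.sigZ P i t - c.sigZ P i (c.last i t)) -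
    (P.grad₂ i (c.x t i) (c.sigW P i t) - P.grad₂ i (c.x t i) (P.σ (c.x t))), ?_, ?_⟩
  · rw [mul_assoc, ← mul_add]
    refine Stack.norm_le_of_forall_norm_le fun i => (norm_sub_le _ _).trans (add_le_add ?_ ?_)
    · exact (norm_sigZ_sub_le i _ _).trans ((hc.errNorm_le i ht0 htT).trans (threshold_le hl i t))
    · refine (hC i _ _ _ _).trans ?_
      rw [sub_self, norm_zero, zero_add]
      have := PiLp.norm_apply_le (c.w t - P.πw (c.x t)) i
      rw [P.πw_sub] at this
      gcongr
      exact this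
  · rw [← sub_zero (P.lapStack (c.z t - _) - _), ← neg_zero, ← P.lapStack_const
      (P.meanGrad₂ (c.x t)), ← map_neg, ← map_sub, ← map_sub]
    congr 1
    refine PiLp.ext fun i => ?_
    rw [PiLp.sub_apply, PiLp.sub_apply, P.πz_sub, PiLp.neg_apply]
    simp only [sampledZ, sigZ]
    abel

end IsSolution

end Run

end EventTriggered

/-! ### Dissipation of the separate errors and the choice of weights. -/

namespace EventTriggered

variable {N d : ℕ} {n m : Fin N → ℕ} {P : Problem N d n m}

namespace Problem

theorem inner_lapStack (v : Stack fun _ : Fin N => d) :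
    inner ℝ v (P.lapStack v) = ∑ i, inner ℝ (v i) (P.lap v i) := PiLp.inner_apply _ _

theorem sum_sub_eq_zero {v v' : Stack fun _ : Fin N => d} (h : ∑ i, v i = 0)
    (h' : ∑ i, v' i = 0) : ∑ i, (v - v') i = 0 := by
  simp only [PiLp.sub_apply, Finset.sum_sub_distrib, h, h', sub_zero]

end Problem

open Problem

/-- Dissipation of a consensus error driven by a perturbed Laplacian. -/
theorem diniLE_consensus {μ CL : ℝ} (hCL0 : 0 ≤ CL)
    (hμ : ∀ v : Stack (fun _ : Fin N => d), ∑ i, v i = 0 →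
      μ * ‖v‖ ^ 2 ≤ ∑ i, inner ℝ (v i) (P.lap v i))
    (hCL : ∀ v : Stack (fun _ : Fin N => d), ‖P.lapStack v‖ ≤ CL * ‖v‖)
    {π : Stack n → Stack fun _ : Fin N => d} {Cπ : ℝ} (hCπ0 : 0 ≤ Cπ)
    (hπ : ∀ x x', ‖π x - π x'‖ ≤ Cπ * ‖x - x'‖) {x : ℝ → Stack n} {x' : Stack n}
    {v : ℝ → Stack fun _ : Fin N => d} {e : Stack fun _ : Fin N => d} {a t E X : ℝ} (ha : 0 < a)
    (hsum : ∑ i, (v t - π (x t)) i = 0) (hx : HasDerivWithinAt x x' (Ici t) t)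
    (hv : HasDerivWithinAt v (-((1 / a) • (P.lapStack (v t - π (x t)) - P.lapStack e))) (Ici t) t)
    (he : ‖e‖ ≤ E) (hX : ‖x'‖ ≤ X) :
    DiniLE (fun s => a * ‖v s - π (x s)‖ ^ 2)
      (-2 * μ * ‖v t - π (x t)‖ ^ 2 + 2 * CL * ‖v t - π (x t)‖ * E +
        a * (2 * Cπ * ‖v t - π (x t)‖ * X)) t := by
  have h := (DiniLE.norm_sub_sq hv hx (p := fun s => π (x s)) fun s => hπ _ _).const_mul ha.le
  refine h.mono ?_
  set y := v t - π (x t)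
  have h1 := hμ y hsum
  rw [← P.inner_lapStack] at h1
  have h2 : inner ℝ y (P.lapStack e) ≤ ‖y‖ * (CL * E) :=
    (real_inner_le_norm _ _).trans (by gcongr; exact (hCL e).trans (by gcongr))
  have h3 : inner ℝ y (-((1 / a) • (P.lapStack y - P.lapStack e))) =
      -(1 / a) * (inner ℝ y (P.lapStack y) - inner ℝ y (P.lapStack e)) := by
    rw [inner_neg_right, real_inner_smul_right, inner_sub_right]; ring
  -- The weight `a` cancels the gain `1 / a` of the Laplacian: the dissipation rate no longer
  -- depends on `a`, while the drift of `π` keeps a small factor.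
  have h4 : a * (2 * (-(1 / a) * (inner ℝ y (P.lapStack y) - inner ℝ y (P.lapStack e))) +
      2 * Cπ * ‖y‖ * ‖x'‖) = -2 * (inner ℝ y (P.lapStack y) - inner ℝ y (P.lapStack e)) +
      a * (2 * Cπ * ‖y‖ * ‖x'‖) := by
    field_simp
  rw [h3, h4]
  have h5 : a * (2 * Cπ * ‖y‖ * ‖x'‖) ≤ a * (2 * Cπ * ‖y‖ * X) := by gcongr
  linarith

/-- A Lyapunov function for the tracking errors `x_i - h_i(u_i)`. -/
theorem exists_diniLE_x (hN : 0 < N) (hss : P.SteadyStateAssumption) :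
    ∃ V : Stack n → Stack m → ℝ, ∃ γ > 0, ∃ M, 0 ≤ M ∧ ∃ K, 0 ≤ K ∧
      Continuous (fun q : Stack n × Stack m => V q.1 q.2) ∧
      (∀ x u, ‖x - P.hStack u‖ ^ 2 ≤ V x u) ∧ (∀ x u, V x u ≤ K * ‖x - P.hStack u‖ ^ 2) ∧
      ∀ (x : ℝ → Stack n) (u : ℝ → Stack m) (v : Stack m) (a t : ℝ), 0 ≤ a →
        HasDerivWithinAt x (P.rStack (x t) (u t)) (Ici t) t →
        HasDerivWithinAt u (-(a • v)) (Ici t) t →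
        DiniLE (fun s => V (x s) (u s)) (-γ * ‖x t - P.hStack (u t)‖ ^ 2 + M * a ^ 2 * ‖v‖ ^ 2)
          t := by
  obtain ⟨βh, hβh0, hβh⟩ := hss.h_lipschitz
  obtain ⟨βr, hβr0, hβr⟩ := hss.r_lipschitz
  choose δ₁ hδ₁ δ₂ hδ₂ hstab using hss.exp_stable
  have hV := fun i => exists_converse_lyapunov hβr0 (hβr i) (hss.equilibrium i) hβh0 (hβh i)
    (hδ₁ i) (hδ₂ i) (hstab i)
  choose V γ hγ L hL0 hlow hup hlip hd using hV
  have hne : (Finset.univ : Finset (Fin N)).Nonempty := ⟨⟨0, hN⟩, Finset.mem_univ _⟩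
  obtain ⟨i₀, -, hi₀⟩ := Finset.exists_min_image Finset.univ γ hne
  obtain ⟨i₁, -, hi₁⟩ := Finset.exists_max_image Finset.univ L hne
  obtain ⟨i₂, -, hi₂⟩ := Finset.exists_max_image Finset.univ δ₁ hne
  have hV0 : ∀ i x u, 0 ≤ V i x u := fun i x u => (norm_nonneg _).trans (hlow i x u)
  have hVc : ∀ i, Continuous fun q : Vec (n i) × Vec (m i) => V i q.1 q.2 := by
    intro i
    refine (LipschitzWith.of_le_add_mul (2 * L i).toNNReal fun q q' => ?_).continuous
    refine (hlip i q.1 q.2 q'.1 q'.2).trans ?_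
    rw [Real.coe_toNNReal _ (by linarith [hL0 i]), Prod.dist_eq, dist_eq_norm, dist_eq_norm]
    have h1 := le_max_left ‖q.1 - q'.1‖ ‖q.2 - q'.2‖
    have h2 := le_max_right ‖q.1 - q'.1‖ ‖q.2 - q'.2‖
    nlinarith [hL0 i]
  -- Sum of the squared individual functions, with the worst constants over the robots. Squaring
  -- gives decay `2γ V_i²`; Young's inequality spends half of it on the input speed, whence the
  -- constant `L² / γ`.
  refine ⟨fun x u => ∑ i, V i (x i) (u i) ^ 2, γ i₀, hγ i₀, L i₁ ^ 2 / γ i₀,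
    div_nonneg (sq_nonneg _) (hγ i₀).le, δ₁ i₂ ^ 2, sq_nonneg _, ?_, ?_, ?_, ?_⟩
  · refine continuous_finsetSum _ fun i _ => ((hVc i).comp (g := fun q : Vec (n i) × Vec (m i) =>
      V i q.1 q.2) (f := fun q : Stack n × Stack m => (q.1 i, q.2 i)) ?_).pow 2
    fun_prop
  · intro x u
    rw [PiLp.norm_sq_eq_of_L2]
    exact Finset.sum_le_sum fun i _ => pow_le_pow_left₀ (norm_nonneg _) (hlow i (x i) (u i)) 2
  · intro x u
    rw [PiLp.norm_sq_eq_of_L2, Finset.mul_sum]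
    refine Finset.sum_le_sum fun i _ => ?_
    rw [← mul_pow]
    refine pow_le_pow_left₀ (hV0 _ _ _) ((hup i (x i) (u i)).trans ?_) 2
    exact mul_le_mul_of_nonneg_right (hi₂ i (Finset.mem_univ i)) (norm_nonneg _)
  · intro x u v a t ha hx hu
    have hxi : ∀ i, HasDerivWithinAt (fun s => x s i) (P.r i (x t i) (u t i)) (Ici t) t :=
      fun i => (hasFDerivAt_apply i (x t)).comp_hasDerivWithinAt t hx
    have hui : ∀ i, HasDerivWithinAt (fun s => u s i) (-(a • v i)) (Ici t) t :=
      fun i => (hasFDerivAt_apply i (u t)).comp_hasDerivWithinAt t hu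
    have hdi : ∀ i ∈ Finset.univ, DiniLE (fun s => V i (x s i) (u s i) ^ 2)
        (-γ i₀ * ‖(x t - P.hStack (u t)) i‖ ^ 2 + L i₁ ^ 2 / γ i₀ * a ^ 2 * ‖v i‖ ^ 2) t := by
      intro i _
      have h1 := hd i (fun s => x s i) (fun s => u s i) (-(a • v i)) t (hxi i) (hui i)
      have hcont : ContinuousWithinAt (fun s => V i (x s i) (u s i)) (Ioi t) t :=
        ((hVc i).continuousAt (x := (x t i, u t i))).comp_continuousWithinAt
          (f := fun s => (x s i, u s i))
          ((hxi i).continuousWithinAt.prodMk (hui i).continuousWithinAt |>.mono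
            Ioi_subset_Ici_self)
      refine (h1.sq hcont fun s => hV0 _ _ _).mono ?_
      rw [norm_neg, norm_smul, Real.norm_of_nonneg ha]
      have h2 : ‖(x t - P.hStack (u t)) i‖ ≤ V i (x t i) (u t i) := hlow i _ _
      set W := V i (x t i) (u t i)
      set D := ‖v i‖
      have hW : 0 ≤ W := hV0 _ _ _
      have hD : 0 ≤ D := norm_nonneg _
      have h3 : γ i₀ ≤ γ i := hi₀ i (Finset.mem_univ i)
      have h4 : L i ≤ L i₁ := hi₁ i (Finset.mem_univ i)
      have h5 : ‖(x t - P.hStack (u t)) i‖ ^ 2 ≤ W ^ 2 :=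
        pow_le_pow_left₀ (norm_nonneg _) h2 2
      have h6 : 2 * (W * (L i₁ * (a * D))) ≤
          γ i₀ * W ^ 2 + L i₁ ^ 2 / γ i₀ * a ^ 2 * D ^ 2 := by
        have hg := hγ i₀
        have : γ i₀ * W ^ 2 + L i₁ ^ 2 / γ i₀ * a ^ 2 * D ^ 2 - 2 * (W * (L i₁ * (a * D))) =
            (γ i₀ * W - L i₁ * (a * D)) ^ 2 / γ i₀ := by
          field_simp; ring
        have h7 := div_nonneg (sq_nonneg (γ i₀ * W - L i₁ * (a * D))) hg.le
        linarith
      have h8 : W * (L i * (a * D)) ≤ W * (L i₁ * (a * D)) := by gcongr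
      have h9 : γ i₀ * W ^ 2 ≤ γ i * W ^ 2 := by gcongr
      have h10 := mul_le_mul_of_nonneg_left h5 (hγ i₀).le
      nlinarith
    refine (DiniLE.sum Finset.univ hdi).mono (le_of_eq ?_)
    rw [Finset.sum_add_distrib, ← Finset.mul_sum, ← Finset.mul_sum, ← PiLp.norm_sq_eq_of_L2,
      ← PiLp.norm_sq_eq_of_L2]

theorem exists_pos_mul_sq_le (Q : ℝ) {q : ℝ} (hq : 0 < q) :
    ∃ b > 0, ∀ a ∈ Ioo 0 b, Q * a ^ 2 ≤ q := by
  refine ⟨min 1 (q / (|Q| + 1)), by positivity, fun a ha => ?_⟩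
  have h1 : a < 1 := ha.2.trans_le (min_le_left _ _)
  have h2 := ha.2.trans_le (min_le_right _ _)
  rw [lt_div_iff₀ (by positivity)] at h2
  have h3 : Q ≤ |Q| := le_abs_self Q
  have h4 := ha.1
  have h5 : a ^ 2 ≤ a := by nlinarith
  nlinarith [mul_le_mul_of_nonneg_right h3 (sq_nonneg a),
    mul_le_mul_of_nonneg_left h5 (abs_nonneg Q)]

/-- Young's inequality. The share `μ / 4` is chosen because at most four such cross terms occur in
one consensus estimate, so half of the dissipation `2μ` remains. -/
theorem mul_mul_le_sq_add {C μ A Y : ℝ} (hμ : 0 < μ) :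
    C * A * Y ≤ μ / 4 * A ^ 2 + C ^ 2 / μ * Y ^ 2 := by
  have : μ / 4 * A ^ 2 + C ^ 2 / μ * Y ^ 2 - C * A * Y = (μ / 2 * A - C * Y) ^ 2 / μ := by
    field_simp; ring
  have := div_nonneg (sq_nonneg (μ / 2 * A - C * Y)) hμ.le
  linarith

/-- The choice of weights in the composite Lyapunov function. -/
theorem exists_weights {C₀ γ M μ C : ℝ} (hC₀ : 0 ≤ C₀) (hγ : 0 < γ) (hμ : 0 < μ) :
    ∃ K₁ > 0, ∃ K₂ > 0, ∃ K₃ > 0, ∃ K₄ > 0, ∃ a₁ > 0, ∃ a₂ > 0, ∃ l > 0,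
      ∀ α₁ ∈ Ioo 0 a₁, ∀ α₂ ∈ Ioo 0 a₂, ∀ lam ∈ Ioo 0 l, ∀ ν, 1 < ν → ∀ X A B D Ξ : ℝ,
        (-(1 / 2) * D ^ 2 + C₀ * (X ^ 2 + A ^ 2 + B ^ 2)) +
          K₁ * (-γ * X ^ 2 + M * α₁ ^ 2 * D ^ 2) +
          K₂ * (-2 * μ * A ^ 2 + C * A * (lam * D + Ξ) + α₂ * (C * A * X)) +
          K₃ * (-2 * μ * B ^ 2 + C * B * (lam * D + Ξ + A) + α₂ * (C * B * X)) +
          K₄ * (-2 * ν * Ξ ^ 2) ≤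
        -(D ^ 2 / 4 + X ^ 2 + A ^ 2 + B ^ 2 + Ξ ^ 2) := by
  set Q := C ^ 2 / μ with hQ
  have hQ0 : 0 ≤ Q := by positivity
  -- In each weight `C₀` pays for the gradient error and one unit stays as dissipation; the second
  -- unit in `K₁` pays for the drift terms with `α₂²`. The weight `K₃` is fixed before `K₂`, which
  -- must also absorb `K₃ * Q * A²` from the cascade. The weight of `Ξ²` is chosen last, so that `ν
  -- > 1` suffices. The terms in `D²` with `α₁` and `lam` take one eighth each, leaving `D² / 4`.
  set K₁ := (C₀ + 2) / γ with hK₁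
  set K₃ := (C₀ + 1) / μ with hK₃
  have hK₃0 : 0 < K₃ := by positivity
  set K₂ := (C₀ + 1 + K₃ * Q) / μ with hK₂
  have hK₂0 : 0 < K₂ := by positivity
  obtain ⟨a₁, ha₁, h₁⟩ := exists_pos_mul_sq_le (K₁ * M) (show (0 : ℝ) < 1 / 8 by norm_num)
  obtain ⟨a₂, ha₂, h₂⟩ := exists_pos_mul_sq_le ((K₂ + K₃) * Q) (show (0 : ℝ) < 1 by norm_num)
  obtain ⟨l, hl, h₃⟩ := exists_pos_mul_sq_le ((K₂ + K₃) * Q) (show (0 : ℝ) < 1 / 8 by norm_num)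
  refine ⟨K₁, by positivity, K₂, hK₂0, K₃, hK₃0, (K₂ + K₃) * Q + 1, by positivity, a₁, ha₁, a₂,
    ha₂, l, hl, fun α₁ hα₁ α₂ hα₂ lam hlam ν hν X A B D Ξ => ?_⟩
  have e₁ : K₁ * γ = C₀ + 2 := by rw [hK₁]; field_simp
  have e₂ : K₂ * μ = C₀ + 1 + K₃ * Q := by rw [hK₂]; field_simp
  have e₃ : K₃ * μ = C₀ + 1 := by rw [hK₃]; field_simp
  have hA : -2 * μ * A ^ 2 + C * A * (lam * D + Ξ) + α₂ * (C * A * X) ≤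
      -μ * A ^ 2 + Q * (lam ^ 2 * D ^ 2 + Ξ ^ 2 + α₂ ^ 2 * X ^ 2) := by
    have i₁ := mul_mul_le_sq_add (C := C) (A := A) (Y := lam * D) hμ
    have i₂ := mul_mul_le_sq_add (C := C) (A := A) (Y := Ξ) hμ
    have i₃ := mul_mul_le_sq_add (C := C) (A := A) (Y := α₂ * X) hμ
    nlinarith [mul_nonneg hμ.le (sq_nonneg A)]
  have hB : -2 * μ * B ^ 2 + C * B * (lam * D + Ξ + A) + α₂ * (C * B * X) ≤
      -μ * B ^ 2 + Q * (lam ^ 2 * D ^ 2 + Ξ ^ 2 + A ^ 2 + α₂ ^ 2 * X ^ 2) := by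
    have i₁ := mul_mul_le_sq_add (C := C) (A := B) (Y := lam * D) hμ
    have i₂ := mul_mul_le_sq_add (C := C) (A := B) (Y := Ξ) hμ
    have i₃ := mul_mul_le_sq_add (C := C) (A := B) (Y := α₂ * X) hμ
    have i₄ := mul_mul_le_sq_add (C := C) (A := B) (Y := A) hμ
    nlinarith [mul_nonneg hμ.le (sq_nonneg B)]
  have hA' := mul_le_mul_of_nonneg_left hA hK₂0.le
  have hB' := mul_le_mul_of_nonneg_left hB hK₃0.le
  have j₁ := mul_le_mul_of_nonneg_right (h₁ α₁ hα₁) (sq_nonneg D)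
  have j₂ := mul_le_mul_of_nonneg_right (h₂ α₂ hα₂) (sq_nonneg X)
  have j₃ := mul_le_mul_of_nonneg_right (h₃ lam hlam) (sq_nonneg D)
  have j₄ : ((K₂ + K₃) * Q + 1) * (1 * Ξ ^ 2) ≤ ((K₂ + K₃) * Q + 1) * (ν * Ξ ^ 2) := by
    gcongr
  have e₁' : K₁ * (-γ * X ^ 2 + M * α₁ ^ 2 * D ^ 2) =
      -(C₀ + 2) * X ^ 2 + K₁ * M * α₁ ^ 2 * D ^ 2 := by rw [← e₁]; ring
  have e₂' : K₂ * (-μ * A ^ 2 + Q * (lam ^ 2 * D ^ 2 + Ξ ^ 2 + α₂ ^ 2 * X ^ 2)) =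
      -(C₀ + 1 + K₃ * Q) * A ^ 2 + K₂ * Q * (lam ^ 2 * D ^ 2 + Ξ ^ 2 + α₂ ^ 2 * X ^ 2) := by
    rw [← e₂]; ring
  have e₃' : K₃ * (-μ * B ^ 2 + Q * (lam ^ 2 * D ^ 2 + Ξ ^ 2 + A ^ 2 + α₂ ^ 2 * X ^ 2)) =
      -(C₀ + 1) * B ^ 2 + K₃ * Q * (lam ^ 2 * D ^ 2 + Ξ ^ 2 + A ^ 2 + α₂ ^ 2 * X ^ 2) := by
    rw [← e₃]; ring
  rw [e₂'] at hA'
  rw [e₃'] at hB'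
  rw [e₁']
  have k₁ : 0 ≤ ((K₂ + K₃) * Q + 1) * (Ξ ^ 2) := by positivity
  linarith

end EventTriggered

/-! ### The composite Lyapunov function and the speed of solutions. -/

namespace EventTriggered

variable {N d : ℕ} {n m : Fin N → ℕ} {P : Problem N d n m} {c : Run N d n m} {p : Params}
  {T : EReal}

open Problem

/-- The squared tracking error of a state. -/
def Problem.trackErr (P : Problem N d n m) (s : State N d n m) : ℝ :=
  ‖s.1 - P.hStack s.2.1‖ ^ 2 + ‖s.2.2.1 - P.πw s.1‖ ^ 2 + ‖s.2.2.2.1 - P.πz s.1‖ ^ 2 +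
    ‖s.2.2.2.2‖ ^ 2

/-- The squared distance to stationarity. -/
def Problem.dissip (P : Problem N d n m) (s : State N d n m) : ℝ :=
  ‖gradient P.reducedCost s.2.1‖ ^ 2 + P.trackErr s

theorem Problem.trackErr_nonneg (s : State N d n m) : 0 ≤ P.trackErr s := by
  unfold Problem.trackErr; positivity

theorem Problem.dissip_nonneg (s : State N d n m) : 0 ≤ P.dissip s :=
  add_nonneg (sq_nonneg _) (trackErr_nonneg s)

theorem Problem.continuous_hStack (hss : P.SteadyStateAssumption) : Continuous P.hStack :=
  (PiLp.continuous_toLp 2 _).comp (continuous_pi fun i => (hss.h_smooth i).continuous.comp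
    (by fun_prop : Continuous fun u : Stack m => u i))

theorem continuous_of_norm_sub_le {E F : Type*} [NormedAddCommGroup E] [NormedAddCommGroup F]
    {f : E → F} {C : ℝ} (hC : 0 ≤ C) (h : ∀ x y, ‖f x - f y‖ ≤ C * ‖x - y‖) : Continuous f :=
  (LipschitzWith.of_dist_le_mul (K := C.toNNReal) fun x y => by
    rw [dist_eq_norm, dist_eq_norm, Real.coe_toNNReal _ hC]; exact h x y).continuous

theorem Problem.continuous_πw (hN : 0 < N) (hcost : P.CostAssumption) : Continuous P.πw :=
  have ⟨_, h0, h⟩ := exists_πw_lipschitz hN hcost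
  continuous_of_norm_sub_le h0 h

theorem Problem.continuous_πz (hN : 0 < N) (hcost : P.CostAssumption) : Continuous P.πz :=
  have ⟨_, h0, h⟩ := exists_πz_lipschitz hN hcost
  continuous_of_norm_sub_le h0 h

theorem Problem.continuous_gradient (hcost : P.CostAssumption) :
    Continuous (gradient P.reducedCost) :=
  have ⟨_, h⟩ := hcost.reduced_lipschitz
  h.continuous

theorem Problem.continuous_trackErr (hN : 0 < N) (hss : P.SteadyStateAssumption)
    (hcost : P.CostAssumption) : Continuous P.trackErr := by
  have h1 := continuous_hStack hss
  have h2 := continuous_πw hN hcost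
  have h3 := continuous_πz hN hcost
  unfold Problem.trackErr
  fun_prop

theorem Problem.continuous_dissip (hN : 0 < N) (hss : P.SteadyStateAssumption)
    (hcost : P.CostAssumption) : Continuous P.dissip := by
  have h1 := continuous_trackErr hN hss hcost
  have h2 := continuous_gradient hcost
  unfold Problem.dissip
  fun_prop

/-- `W` complements the reduced cost to a Lyapunov function of the closed loop. -/
structure IsLyapunov (P : Problem N d n m) (p : Params) (W : State N d n m → ℝ) : Prop where
  cont : Continuous W
  lower : ∃ κ > 0, ∀ s, κ * P.trackErr s ≤ W s
  upper : ∃ K, 0 ≤ K ∧ ∀ s, W s ≤ K * P.trackErr s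
  decay : ∃ κ > 0, ∀ (c : Run N d n m) (T : EReal), c.IsSolution P p T →
    ∑ i, c.w 0 i = 0 → ∑ i, c.z 0 i = 0 → ∀ t : ℝ, 0 ≤ t → (t : EReal) < T →
    DiniLE (fun s => 1 / p.α₁ * P.reducedCost (c.u s) + W (c.state s))
      (-(κ * P.dissip (c.state t))) t

/-- Polarization of `⟨d, ∇f⟩`, with the term in `‖∇f‖²` discarded. The part `‖d‖²` is the one to
keep, since the triggering threshold involves `λ‖d‖`. -/
theorem diniLE_reducedCost (hcost : P.CostAssumption) (hc : c.IsSolution P p T)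
    (hα : 0 < p.α₁) {t : ℝ} (ht0 : 0 ≤ t) (htT : (t : EReal) < T) :
    DiniLE (fun s => 1 / p.α₁ * P.reducedCost (c.u s))
      (-(1 / 2) * ‖c.dirStackAt P t‖ ^ 2 +
        1 / 2 * ‖c.dirStackAt P t - gradient P.reducedCost (c.u t)‖ ^ 2) t := by
  have h1 := (hcost.reduced_differentiable (c.u t)).hasGradientAt.hasFDerivAt
  have h2 := (h1.comp_hasDerivWithinAt t (hc.hasDeriv_u ht0 htT)).diniLE.const_mul
    (c := 1 / p.α₁) (by positivity)
  refine h2.mono ?_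
  set D := c.dirStackAt P t
  set g := gradient P.reducedCost (c.u t)
  rw [InnerProductSpace.toDual_apply_apply, inner_neg_right, real_inner_smul_right,
    norm_sub_sq_real, real_inner_comm g D]
  have : 1 / p.α₁ * -(p.α₁ * inner ℝ D g) = -inner ℝ D g := by field_simp
  rw [real_inner_comm] at this
  rw [real_inner_comm, real_inner_comm, this]
  nlinarith [sq_nonneg ‖g‖]

theorem diniLE_ξ (hc : c.IsSolution P p T) {t : ℝ} (ht0 : 0 ≤ t) (htT : (t : EReal) < T) :
    DiniLE (fun s => ‖c.ξ s‖ ^ 2) (-2 * p.ν * ‖c.ξ t‖ ^ 2) t := by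
  have h := (hc.hasDeriv_ξ ht0 htT).norm_sq.diniLE
  refine h.mono (le_of_eq ?_)
  rw [inner_neg_right, real_inner_smul_right, real_inner_self_eq_norm_sq]
  ring

theorem consensus_rate_le {μ CL Cw Cr C A X Y a k : ℝ} (h₁ : 2 * CL * k ≤ C)
    (h₂ : 2 * Cw * Cr ≤ C) (ha : 0 ≤ a) (hX : 0 ≤ X) (hA : 0 ≤ A) (hY : 0 ≤ Y) :
    -2 * μ * A ^ 2 + 2 * CL * A * (k * Y) + a * (2 * Cw * A * (Cr * X)) ≤
      -2 * μ * A ^ 2 + C * A * Y + a * (C * A * X) := by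
  have q₁ := mul_le_mul_of_nonneg_right h₁ (mul_nonneg hA hY)
  have q₂ := mul_le_mul_of_nonneg_right h₂ (mul_nonneg ha (mul_nonneg hA hX))
  linarith

theorem consensus_rate_le' {μ CL Cw Cr Cs C A B X Y a k : ℝ} (h₁ : 2 * CL * k ≤ C)
    (h₂ : 2 * Cw * Cr ≤ C) (h₃ : 2 * CL * Cs ≤ C) (ha : 0 ≤ a) (hX : 0 ≤ X) (hB : 0 ≤ B)
    (hY : 0 ≤ Y) (hA : 0 ≤ A) :
    -2 * μ * B ^ 2 + 2 * CL * B * (k * Y + Cs * A) + a * (2 * Cw * B * (Cr * X)) ≤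
      -2 * μ * B ^ 2 + C * B * (Y + A) + a * (C * B * X) := by
  have q₁ := consensus_rate_le (μ := μ) h₁ h₂ ha hX hB hY
  have q₂ := mul_le_mul_of_nonneg_right h₃ (mul_nonneg hB hA)
  linarith

theorem sq_le_of_le_mul_add {δ k X A B : ℝ} (hδ0 : 0 ≤ δ) (h : δ ≤ k * (X + A + B)) :
    δ ^ 2 ≤ 3 * k ^ 2 * (X ^ 2 + A ^ 2 + B ^ 2) := by
  have hS : (X + A + B) ^ 2 ≤ 3 * (X ^ 2 + A ^ 2 + B ^ 2) := by
    nlinarith [sq_nonneg (X - A), sq_nonneg (X - B), sq_nonneg (A - B)]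
  calc δ ^ 2 ≤ (k * (X + A + B)) ^ 2 := pow_le_pow_left₀ hδ0 h 2
    _ = k ^ 2 * (X + A + B) ^ 2 := by ring
    _ ≤ k ^ 2 * (3 * (X ^ 2 + A ^ 2 + B ^ 2)) := by gcongr
    _ = _ := by ring

/-- Trades the dissipation in `‖d‖²` for one in the squared gradient, which differs from it only by
the tracking errors contained in `S`. -/
theorem dissip_rate_le {Cd g D δ S Ξ : ℝ} (hg0 : 0 ≤ g) (hS : 0 ≤ S) (hg : g ≤ D + δ)
    (hδ : δ ^ 2 ≤ 3 * Cd ^ 2 * S) :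
    1 / (8 + 6 * Cd ^ 2) * (g ^ 2 + (S + Ξ ^ 2)) ≤ D ^ 2 / 4 + S + Ξ ^ 2 := by
  have hg2 : g ^ 2 ≤ 2 * D ^ 2 + 2 * δ ^ 2 := by
    have := pow_le_pow_left₀ hg0 hg 2
    nlinarith [sq_nonneg (D - δ)]
  rw [one_div, inv_mul_le_iff₀ (by positivity)]
  nlinarith [mul_nonneg (sq_nonneg Cd) (sq_nonneg D), mul_nonneg (sq_nonneg Cd) (sq_nonneg Ξ),
    sq_nonneg D, sq_nonneg Ξ]

theorem weighted_sum_le {k₁ k₂ k₃ k₄ X A B Ξ : ℝ} (h₁ : 0 ≤ k₁) (h₂ : 0 ≤ k₂) (h₃ : 0 ≤ k₃)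
    (h₄ : 0 ≤ k₄) (hX : 0 ≤ X) (hA : 0 ≤ A) (hB : 0 ≤ B) (hΞ : 0 ≤ Ξ) :
    k₁ * X + k₂ * A + k₃ * B + k₄ * Ξ ≤ (k₁ + k₂ + k₃ + k₄) * (X + A + B + Ξ) := by
  rw [mul_add, mul_add, mul_add]
  gcongr <;> linarith

theorem exists_isLyapunov (hN : 0 < N) (hnet : P.NetworkAssumption)
    (hss : P.SteadyStateAssumption) (hcost : P.CostAssumption) :
    ∃ α₁' > 0, ∃ α₂' > 0, ∃ lam' > 0, ∀ p : Params, p.α₁ ∈ Ioo 0 α₁' → p.α₂ ∈ Ioo 0 α₂' →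
      p.lam ∈ Ioo 0 lam' → 1 < p.ν → ∃ W, IsLyapunov P p W := by
  obtain ⟨V, γ, hγ, M, hM0, K, hK0, hVc, hVlow, hVup, hVd⟩ := exists_diniLE_x hN hss
  obtain ⟨μ, hμ, hcoer⟩ := Problem.exists_laplacian_coercive hnet
  obtain ⟨CL, hCL0, hCL⟩ := P.exists_norm_lapStack_le
  obtain ⟨Cr, hCr0, hCr⟩ := exists_rStack_le hss
  obtain ⟨Cw, hCw0, hCw⟩ := exists_πw_lipschitz hN hcost
  obtain ⟨Cz, hCz0, hCz⟩ := exists_πz_lipschitz hN hcost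
  obtain ⟨Cs, hCs0, hCs⟩ := Run.IsSolution.exists_lap_sampledZ hcost
  obtain ⟨Cd, hCd0, hCd⟩ := exists_dirStack_sub_gradient_le hss hcost
  -- One constant dominating every cross-term coefficient in the two consensus estimates.
  set C := 2 * CL * N + 2 * CL * Cs + 2 * Cw * Cr + 2 * Cz * Cr with hC
  have p₁ : 0 ≤ 2 * CL * N := by positivity
  have p₂ : 0 ≤ 2 * CL * Cs := by positivity
  have p₃ : 0 ≤ 2 * Cw * Cr := by positivity
  have p₄ : 0 ≤ 2 * Cz * Cr := by positivity
  have c₁ : 2 * CL * N ≤ C := by linarith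
  have c₂ : 2 * CL * Cs ≤ C := by linarith
  have c₃ : 2 * Cw * Cr ≤ C := by linarith
  have c₄ : 2 * Cz * Cr ≤ C := by linarith
  obtain ⟨K₁, hK₁, K₂, hK₂, K₃, hK₃, K₄, hK₄, a₁, ha₁, a₂, ha₂, l, hl, H⟩ :=
    -- Half the squared gradient error is at most `3 / 2 * Cd²` times the sum of the three squared
    -- errors.
    exists_weights (C₀ := 3 / 2 * Cd ^ 2) (M := M) (C := C) (by positivity) hγ hμ
  refine ⟨a₁, ha₁, a₂, ha₂, l, hl, fun p hα₁ hα₂ hlam hν => ?_⟩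
  have hα₂0 := hα₂.1
  refine ⟨fun s => K₁ * V s.1 s.2.1 + K₂ * (p.α₂ * ‖s.2.2.1 - P.πw s.1‖ ^ 2) +
    K₃ * (p.α₂ * ‖s.2.2.2.1 - P.πz s.1‖ ^ 2) + K₄ * ‖s.2.2.2.2‖ ^ 2, ?_, ?_, ?_, ?_⟩
  · have h1 := continuous_πw hN hcost
    have h2 := continuous_πz hN hcost
    have h3 : Continuous fun s : State N d n m => V s.1 s.2.1 :=
      hVc.comp (by fun_prop : Continuous fun s : State N d n m => (s.1, s.2.1))
    fun_prop
  · refine ⟨min (min K₁ (K₂ * p.α₂)) (min (K₃ * p.α₂) K₄), by positivity, fun s => ?_⟩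
    have i₁ := hVlow s.1 s.2.1
    unfold Problem.trackErr
    rw [mul_add, mul_add, mul_add, ← mul_assoc, ← mul_assoc]
    gcongr
    · exact (min_le_left _ _).trans (min_le_left _ _)
    · exact (min_le_left _ _).trans (min_le_right _ _)
    · exact (min_le_right _ _).trans (min_le_left _ _)
    · exact (min_le_right _ _).trans (min_le_right _ _)
  · refine ⟨K₁ * K + K₂ * p.α₂ + K₃ * p.α₂ + K₄, by positivity, fun s => ?_⟩
    have i₁ := mul_le_mul_of_nonneg_left (hVup s.1 s.2.1) hK₁.le
    unfold Problem.trackErr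
    have i₂ := weighted_sum_le (mul_nonneg hK₁.le hK0) (mul_nonneg hK₂.le hα₂0.le)
      (mul_nonneg hK₃.le hα₂0.le) hK₄.le (sq_nonneg ‖s.1 - P.hStack s.2.1‖)
      (sq_nonneg ‖s.2.2.1 - P.πw s.1‖) (sq_nonneg ‖s.2.2.2.1 - P.πz s.1‖)
      (sq_nonneg ‖s.2.2.2.2‖)
    refine le_trans ?_ i₂
    linarith only [i₁]
  · refine ⟨1 / (8 + 6 * Cd ^ 2), by positivity, fun c T hc hw hz t ht0 htT => ?_⟩
    obtain ⟨eW, heW, hlapW⟩ := Run.IsSolution.exists_lap_sampledW hlam.1.le hc ht0 htT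
    obtain ⟨eZ, heZ, hlapZ⟩ := hCs c p T hlam.1.le hc t ht0 htT
    have hx := hc.hasDeriv_x ht0 htT
    have hsw := sum_sub_eq_zero (hc.sum_w hnet hw ht0 htT) (P.sum_πw hN (c.x t))
    have hsz := sum_sub_eq_zero (hc.sum_z hnet hz ht0 htT) (P.sum_πz hN (c.x t))
    have hdw := hc.hasDeriv_w ht0 htT
    have hdz := hc.hasDeriv_z ht0 htT
    rw [hlapW] at hdw
    rw [hlapZ] at hdz
    have dw := diniLE_consensus hCL0 hcoer hCL hCw0 hCw hα₂0 hsw hx hdw heW (hCr _ _)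
    have dz := diniLE_consensus hCL0 hcoer hCL hCz0 hCz hα₂0 hsz hx hdz heZ (hCr _ _)
    have dx := hVd c.x c.u (c.dirStackAt P t) p.α₁ t hα₁.1.le hx (hc.hasDeriv_u ht0 htT)
    have df := diniLE_reducedCost hcost hc hα₁.1 ht0 htT
    have dξ := diniLE_ξ hc ht0 htT
    have htot := df.add ((((dx.const_mul hK₁.le).add (dw.const_mul hK₂.le)).add
      (dz.const_mul hK₃.le)).add (dξ.const_mul hK₄.le))
    refine htot.mono ?_
    have hD := hCd (c.x t) (c.u t) (c.w t) (c.z t)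
    change ‖c.dirStackAt P t - _‖ ≤ _ at hD
    have hG : ‖gradient P.reducedCost (c.u t)‖ ≤ ‖c.dirStackAt P t‖ +
        ‖c.dirStackAt P t - gradient P.reducedCost (c.u t)‖ := by
      have := norm_sub_le (c.dirStackAt P t) (c.dirStackAt P t - gradient P.reducedCost (c.u t))
      rwa [sub_sub_cancel] at this
    have hmain := H p.α₁ hα₁ p.α₂ hα₂ p.lam hlam p.ν hν ‖c.x t - P.hStack (c.u t)‖
      ‖c.w t - P.πw (c.x t)‖ ‖c.z t - P.πz (c.x t)‖ ‖c.dirStackAt P t‖ ‖c.ξ t‖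
    simp only [Problem.dissip, Problem.trackErr, Run.state]
    have hX := norm_nonneg (c.x t - P.hStack (c.u t))
    have hA := norm_nonneg (c.w t - P.πw (c.x t))
    have hB := norm_nonneg (c.z t - P.πz (c.x t))
    have hD0 := norm_nonneg (c.dirStackAt P t)
    have hΞ := norm_nonneg (c.ξ t)
    have hg0 := norm_nonneg (gradient P.reducedCost (c.u t))
    have hδ0 := norm_nonneg (c.dirStackAt P t - gradient P.reducedCost (c.u t))
    generalize ‖c.dirStackAt P t - gradient P.reducedCost (c.u t)‖ = δ at *
    generalize ‖gradient P.reducedCost (c.u t)‖ = g at *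
    generalize ‖c.x t - P.hStack (c.u t)‖ = X at *
    generalize ‖c.w t - P.πw (c.x t)‖ = A at *
    generalize ‖c.z t - P.πz (c.x t)‖ = B at *
    generalize ‖c.dirStackAt P t‖ = D at *
    generalize ‖c.ξ t‖ = Ξ at *
    have hl0 := hlam.1.le
    have hδ2 := sq_le_of_le_mul_add hδ0 hD
    have hY : 0 ≤ p.lam * D + Ξ := by positivity
    have tw := consensus_rate_le (μ := μ) c₁ c₃ hα₂0.le hX hA hY
    have tz := consensus_rate_le' (μ := μ) c₁ c₄ c₂ hα₂0.le hX hB hY hA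
    have tw' := mul_le_mul_of_nonneg_left tw hK₂.le
    have tz' := mul_le_mul_of_nonneg_left tz hK₃.le
    have hfin := dissip_rate_le (Ξ := Ξ) hg0
      (add_nonneg (add_nonneg (sq_nonneg X) (sq_nonneg A)) (sq_nonneg B)) hG hδ2
    linarith only [hmain, tw', tz', hfin, hδ2]

/-- The speed of a solution is bounded by a continuous function of its state. -/
theorem exists_speed_bound (hN : 0 < N) (hss : P.SteadyStateAssumption)
    (hcost : P.CostAssumption) (hα₁ : 0 ≤ p.α₁) (hα₂ : 0 < p.α₂) (hl : 0 ≤ p.lam) :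
    ∃ B : State N d n m → ℝ, Continuous B ∧ ∀ (c : Run N d n m) (T : EReal),
      c.IsSolution P p T → ∀ t : ℝ, 0 ≤ t → (t : EReal) < T →
      ∃ v, HasDerivWithinAt c.state v (Ici t) t ∧ ‖v‖ ≤ B (c.state t) := by
  obtain ⟨CL, hCL0, hCL⟩ := P.exists_norm_lapStack_le
  obtain ⟨Cr, hCr0, hCr⟩ := exists_rStack_le hss
  obtain ⟨Cs, hCs0, hCs⟩ := Run.IsSolution.exists_lap_sampledZ hcost
  obtain ⟨Cd, hCd0, hCd⟩ := exists_dirStack_sub_gradient_le hss hcost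
  set X : State N d n m → ℝ := fun s => ‖s.1 - P.hStack s.2.1‖ with hX
  set A : State N d n m → ℝ := fun s => ‖s.2.2.1 - P.πw s.1‖ with hA
  set Z : State N d n m → ℝ := fun s => ‖s.2.2.2.1 - P.πz s.1‖ with hZ
  set D : State N d n m → ℝ := fun s => ‖gradient P.reducedCost s.2.1‖ + Cd * (X s + A s + Z s)
    with hD
  set E : State N d n m → ℝ := fun s => N * (p.lam * D s + ‖s.2.2.2.2‖) with hE
  have hXc : Continuous X := by
    have h1 := continuous_hStack hss
    fun_prop
  have hAc : Continuous A := by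
    have h1 := continuous_πw hN hcost
    fun_prop
  have hZc : Continuous Z := by
    have h1 := continuous_πz hN hcost
    fun_prop
  have hDc : Continuous D := by
    have h1 := continuous_gradient hcost
    fun_prop
  have hEc : Continuous E := by fun_prop
  have hX0 : ∀ s, 0 ≤ X s := fun s => norm_nonneg _
  have hA0 : ∀ s, 0 ≤ A s := fun s => norm_nonneg _
  have hZ0 : ∀ s, 0 ≤ Z s := fun s => norm_nonneg _
  have hD0 : ∀ s, 0 ≤ D s := fun s => add_nonneg (norm_nonneg _)
    (mul_nonneg hCd0 (add_nonneg (add_nonneg (hX0 s) (hA0 s)) (hZ0 s)))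
  have hE0 : ∀ s, 0 ≤ E s := fun s => mul_nonneg (Nat.cast_nonneg N)
    (add_nonneg (mul_nonneg hl (hD0 s)) (norm_nonneg _))
  refine ⟨fun s => Cr * X s + p.α₁ * D s + (1 / p.α₂) * (CL * A s + CL * E s) +
    (1 / p.α₂) * (CL * Z s + CL * (E s + Cs * A s)) + |p.ν| * ‖s.2.2.2.2‖, by fun_prop,
    fun c T hc t ht0 htT => ?_⟩
  refine ⟨_, (hc.hasDeriv_x ht0 htT).prodMk ((hc.hasDeriv_u ht0 htT).prodMk
    ((hc.hasDeriv_w ht0 htT).prodMk ((hc.hasDeriv_z ht0 htT).prodMk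
    (hc.hasDeriv_ξ ht0 htT)))), ?_⟩
  -- The samples depend on the past, but the triggering rule ties them to the current signals; this
  -- is why the speed can be bounded by the current state alone.
  obtain ⟨eW, heW, hlapW⟩ := Run.IsSolution.exists_lap_sampledW hl hc ht0 htT
  obtain ⟨eZ, heZ, hlapZ⟩ := hCs c p T hl hc t ht0 htT
  set s := c.state t with hs
  have hDs : ‖c.dirStackAt P t‖ ≤ D s := by
    have h1 := hCd (c.x t) (c.u t) (c.w t) (c.z t)
    change ‖c.dirStackAt P t - _‖ ≤ _ at h1
    have h2 := norm_add_le (c.dirStackAt P t - gradient P.reducedCost (c.u t))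
      (gradient P.reducedCost (c.u t))
    rw [sub_add_cancel] at h2
    simp only [hD, hX, hA, hZ, hs, Run.state]
    linarith
  have hEs : N * (p.lam * ‖c.dirStackAt P t‖ + ‖c.ξ t‖) ≤ E s := by
    simp only [hE]
    gcongr
    exact le_rfl
  have b₁ : ‖P.rStack (c.x t) (c.u t)‖ ≤ Cr * X s := hCr _ _
  have b₂ : ‖-(p.α₁ • c.dirStackAt P t)‖ ≤ p.α₁ * D s := by
    rw [norm_neg, norm_smul, Real.norm_of_nonneg hα₁]; gcongr
  have b₃ : ‖-((1 / p.α₂) • P.lapStack (c.sampledW P t))‖ ≤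
      (1 / p.α₂) * (CL * A s + CL * E s) := by
    rw [norm_neg, norm_smul, Real.norm_of_nonneg (by positivity), hlapW]
    gcongr
    exact (norm_sub_le _ _).trans (add_le_add (hCL _)
      ((hCL _).trans (by gcongr; exact heW.trans hEs)))
  have b₄ : ‖-((1 / p.α₂) • P.lapStack (c.sampledZ P t))‖ ≤
      (1 / p.α₂) * (CL * Z s + CL * (E s + Cs * A s)) := by
    rw [norm_neg, norm_smul, Real.norm_of_nonneg (by positivity), hlapZ]
    gcongr
    exact (norm_sub_le _ _).trans (add_le_add (hCL _)
      ((hCL _).trans (by gcongr; exact heZ.trans (add_le_add_left hEs _))))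
  have b₅ : ‖-(p.ν • c.ξ t)‖ ≤ |p.ν| * ‖s.2.2.2.2‖ := by
    rw [norm_neg, norm_smul, Real.norm_eq_abs]; exact le_rfl
  have n₁ := (norm_nonneg _).trans b₁
  have n₂ := (norm_nonneg _).trans b₂
  have n₃ := (norm_nonneg _).trans b₃
  have n₄ := (norm_nonneg _).trans b₄
  have n₅ := (norm_nonneg _).trans b₅
  simp only [Prod.norm_mk, max_le_iff]
  refine ⟨?_, ?_, ?_, ?_, ?_⟩ <;> linarith

end EventTriggered

/-! ### Boundedness, convergence and local asymptotic stability. -/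

namespace EventTriggered

variable {N d : ℕ} {n m : Fin N → ℕ} {P : Problem N d n m} {c : Run N d n m} {p : Params}
  {T : EReal} {W : State N d n m → ℝ}

open Problem

instance {k : Fin N → ℕ} : ProperSpace (Stack k) := FiniteDimensional.proper ℝ _

theorem eq_eqPoint_of_trackErr_eq_zero {s : State N d n m} (h : P.trackErr s = 0) :
    s = P.eqPoint s.2.1 := by
  obtain ⟨x, u, w, z, ξ⟩ := s
  simp only [Problem.trackErr] at h
  have b₁ := sq_nonneg ‖x - P.hStack u‖
  have b₂ := sq_nonneg ‖w - P.πw x‖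
  have b₃ := sq_nonneg ‖z - P.πz x‖
  have b₄ := sq_nonneg ‖ξ‖
  have e₁ : ‖x - P.hStack u‖ ^ 2 = 0 := by linarith
  have e₂ : ‖w - P.πw x‖ ^ 2 = 0 := by linarith
  have e₃ : ‖z - P.πz x‖ ^ 2 = 0 := by linarith
  have e₄ : ‖ξ‖ ^ 2 = 0 := by linarith
  rw [sq_eq_zero_iff, norm_eq_zero] at e₁ e₂ e₃ e₄
  rw [sub_eq_zero] at e₁ e₂ e₃
  subst e₁ e₂ e₃ e₄
  rfl

theorem trackErr_eqPoint (u : Stack m) : P.trackErr (P.eqPoint u) = 0 := by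
  simp [Problem.trackErr, Problem.eqPoint]

theorem eq_eqPoint_of_dissip_eq_zero {s : State N d n m} (h : P.dissip s = 0) :
    gradient P.reducedCost s.2.1 = 0 ∧ s = P.eqPoint s.2.1 := by
  have h1 := sq_nonneg ‖gradient P.reducedCost s.2.1‖
  have h2 := P.trackErr_nonneg s
  unfold Problem.dissip at h
  have h3 : ‖gradient P.reducedCost s.2.1‖ ^ 2 = 0 := by linarith
  rw [sq_eq_zero_iff, norm_eq_zero] at h3
  exact ⟨h3, eq_eqPoint_of_trackErr_eq_zero (by linarith)⟩

theorem eqPoint_mem_configX {u : Stack m} (h : gradient P.reducedCost u = 0) :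
    P.eqPoint u ∈ P.configX := ⟨⟨rfl, h⟩, rfl, rfl, rfl⟩

theorem IsLyapunov.nonneg (hW : IsLyapunov P p W) (s : State N d n m) : 0 ≤ W s := by
  obtain ⟨κ, hκ, h⟩ := hW.lower
  exact (mul_nonneg hκ.le (P.trackErr_nonneg s)).trans (h s)

theorem IsLyapunov.eqPoint (hW : IsLyapunov P p W) (u : Stack m) : W (P.eqPoint u) = 0 := by
  obtain ⟨K, -, h⟩ := hW.upper
  refine le_antisymm ?_ (hW.nonneg _)
  simpa [trackErr_eqPoint] using h (P.eqPoint u)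

/-- The composite Lyapunov function. -/
def lyap (P : Problem N d n m) (p : Params) (W : State N d n m → ℝ) (s : State N d n m) : ℝ :=
  1 / p.α₁ * P.reducedCost s.2.1 + W s

theorem continuous_lyap (hcost : P.CostAssumption) (hW : IsLyapunov P p W) :
    Continuous (lyap P p W) := by
  have h1 := hcost.reduced_differentiable.continuous
  have h2 := hW.cont
  unfold lyap
  fun_prop

theorem lyap_le (hcost : P.CostAssumption) (hW : IsLyapunov P p W) (hc : c.IsSolution P p T)
    (hw : ∑ i, c.w 0 i = 0) (hz : ∑ i, c.z 0 i = 0) {t : ℝ} (ht0 : 0 ≤ t)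
    (htT : (t : EReal) < T) : lyap P p W (c.state t) ≤ lyap P p W (c.state 0) := by
  obtain ⟨κ, hκ, h⟩ := hW.decay
  have h1 := DiniLE.le_of_const (y := fun s => lyap P p W (c.state s)) (B := 0) ht0
    ((continuous_lyap hcost hW).comp_continuousOn
      (hc.cont.mono (Run.IsSolution.Icc_subset htT)))
    fun s hs => (h c T hc hw hz s hs.1 ((EReal.coe_lt_coe_iff.2 hs.2).trans htT)).mono
      (neg_nonpos.2 (mul_nonneg hκ.le (P.dissip_nonneg _)))
  simpa using h1

theorem tendsto_cocompact_reducedCost (hcost : P.CostAssumption) :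
    Tendsto P.reducedCost (cocompact (Stack m)) atTop := by
  rw [← Metric.cobounded_eq_cocompact]
  exact hcost.radially_unbounded

theorem exists_isMinOn_reducedCost (hcost : P.CostAssumption) :
    ∃ u, ∀ v, P.reducedCost u ≤ P.reducedCost v :=
  hcost.reduced_differentiable.continuous.exists_forall_le (tendsto_cocompact_reducedCost hcost)

theorem gradient_eq_zero_of_isLocalMin {f : Stack m → ℝ} {u : Stack m} (h : IsLocalMin f u) :
    gradient f u = 0 := by
  rw [gradient, h.fderiv_eq_zero, map_zero]

/-- Since `W` is nonnegative, the reduced cost is bounded above and radial unboundedness bounds `u`;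
since the reduced cost attains a minimum, `W` is bounded and with it all tracking errors. -/
theorem exists_compact_sublevel (hN : 0 < N) (hss : P.SteadyStateAssumption)
    (hcost : P.CostAssumption) (hα₁ : 0 < p.α₁) (hW : IsLyapunov P p W) (b : ℝ) :
    ∃ S : Set (State N d n m), IsCompact S ∧ ∀ s, lyap P p W s ≤ b → s ∈ S := by
  obtain ⟨κ, hκ, hlow⟩ := hW.lower
  obtain ⟨u₀, hu₀⟩ := exists_isMinOn_reducedCost hcost
  have h1 : ∀ᶠ u in Bornology.cobounded (Stack m), p.α₁ * b < P.reducedCost u :=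
    hcost.radially_unbounded.eventually_gt_atTop _
  have h2 : Bornology.IsBounded {u | ¬ p.α₁ * b < P.reducedCost u} := by
    rw [Bornology.isBounded_def]
    filter_upwards [h1] with u hu using fun h => h hu
  obtain ⟨R, hR⟩ := h2.exists_norm_le
  set q := (b - 1 / p.α₁ * P.reducedCost u₀) / κ with hq
  -- Recovers the state from `u`, `ξ` and the three tracking errors; the compact set is the image of
  -- a ball under this map.
  have hF : Continuous fun s : State N d n m =>
      ((s.1 + P.hStack s.2.1, s.2.1, s.2.2.1 + P.πw (s.1 + P.hStack s.2.1),
        s.2.2.2.1 + P.πz (s.1 + P.hStack s.2.1), s.2.2.2.2) : State N d n m) := by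
    have h1 := continuous_hStack hss
    have h2 := continuous_πw hN hcost
    have h3 := continuous_πz hN hcost
    fun_prop
  refine ⟨_, (isCompact_closedBall (0 : State N d n m) (max R (1 + q))).image hF, fun s hs => ?_⟩
  have hs' := hs
  unfold lyap at hs
  have hW0 := hW.nonneg s
  have hα : 0 < 1 / p.α₁ := by positivity
  have hu : ‖s.2.1‖ ≤ R := by
    refine hR _ (not_lt.2 ?_)
    have h3 : 1 / p.α₁ * P.reducedCost s.2.1 ≤ b := by linarith
    rw [one_div, inv_mul_le_iff₀ hα₁] at h3
    exact h3
  have ht : P.trackErr s ≤ q := by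
    rw [hq, le_div_iff₀ hκ]
    have h3 := hlow s
    have h4 := mul_le_mul_of_nonneg_left (hu₀ s.2.1) hα.le
    linarith
  have hle : ∀ a : ℝ, a ^ 2 ≤ q → a ≤ 1 + q := fun a ha => by nlinarith [sq_nonneg (a - 1 / 2)]
  unfold Problem.trackErr at ht
  have b₁ := sq_nonneg ‖s.1 - P.hStack s.2.1‖
  have b₂ := sq_nonneg ‖s.2.2.1 - P.πw s.1‖
  have b₃ := sq_nonneg ‖s.2.2.2.1 - P.πz s.1‖
  have b₄ := sq_nonneg ‖s.2.2.2.2‖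
  refine ⟨(s.1 - P.hStack s.2.1, s.2.1, s.2.2.1 - P.πw s.1, s.2.2.2.1 - P.πz s.1, s.2.2.2.2),
    ?_, by simp⟩
  rw [mem_closedBall_zero_iff]
  simp only [Prod.norm_mk, max_le_iff]
  refine ⟨?_, ?_, ?_, ?_, ?_⟩
  · exact (hle _ (by linarith)).trans (le_max_right _ _)
  · exact hu.trans (le_max_left _ _)
  · exact (hle _ (by linarith)).trans (le_max_right _ _)
  · exact (hle _ (by linarith)).trans (le_max_right _ _)
  · exact (hle _ (by linarith)).trans (le_max_right _ _)

theorem exists_compact_of_isSolution (hN : 0 < N) (hss : P.SteadyStateAssumption)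
    (hcost : P.CostAssumption) (hα₁ : 0 < p.α₁) (hW : IsLyapunov P p W)
    (hc : c.IsSolution P p T) (hw : ∑ i, c.w 0 i = 0) (hz : ∑ i, c.z 0 i = 0) :
    ∃ S : Set (State N d n m), IsCompact S ∧
      ∀ t : ℝ, 0 ≤ t → (t : EReal) < T → c.state t ∈ S :=
  have ⟨S, hS, h⟩ := exists_compact_sublevel hN hss hcost hα₁ hW (lyap P p W (c.state 0))
  ⟨S, hS, fun _ ht0 htT => h _ (lyap_le hcost hW hc hw hz ht0 htT)⟩

theorem exists_state_lipschitz (hN : 0 < N) (hss : P.SteadyStateAssumption)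
    (hcost : P.CostAssumption) (hα₁ : 0 ≤ p.α₁) (hα₂ : 0 < p.α₂) (hl : 0 ≤ p.lam)
    {S : Set (State N d n m)} (hS : IsCompact S) :
    ∃ K, 0 ≤ K ∧ ∀ (c : Run N d n m) (T : EReal), c.IsSolution P p T →
      (∀ t : ℝ, 0 ≤ t → (t : EReal) < T → c.state t ∈ S) →
      ∀ s t : ℝ, 0 ≤ s → s ≤ t → (t : EReal) < T →
        ‖c.state t - c.state s‖ ≤ K * (t - s) := by
  obtain ⟨B, hB, h⟩ := exists_speed_bound hN hss hcost hα₁ hα₂ hl (P := P) (p := p)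
  obtain ⟨K, hK⟩ := hS.exists_bound_of_continuousOn hB.continuousOn
  refine ⟨max K 0, le_max_right _ _, fun c T hc hcS s t hs hst htT => ?_⟩
  have hlt : ∀ r, r ≤ t → (r : EReal) < T := fun r hr => (EReal.coe_le_coe_iff.2 hr).trans_lt htT
  choose! v hv using fun r (hr : 0 ≤ r ∧ r ≤ t) => h c T hc r hr.1 (hlt r hr.2)
  refine norm_image_sub_le_of_norm_deriv_right_le_segment (f' := v) ?_ ?_ ?_ t
    (right_mem_Icc.2 hst)
  · exact hc.cont.mono fun r hr => ⟨hs.trans hr.1, hlt r hr.2⟩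
  · exact fun r hr => (hv r ⟨hs.trans hr.1, hr.2.le⟩).1
  · intro r hr
    have h0 := hs.trans hr.1
    refine ((hv r ⟨h0, hr.2.le⟩).2.trans (le_abs_self _)).trans
      (le_trans ?_ (le_max_left _ _))
    exact hK _ (hcS r h0 (hlt r hr.2.le))

/-- Barbalat's argument applies: the trajectory is Lipschitz in a compact set, and the Lyapunov
function is bounded below by the minimum of the reduced cost. -/
theorem tendsto_dissip (hN : 0 < N) (hss : P.SteadyStateAssumption)
    (hcost : P.CostAssumption) (hα₁ : 0 < p.α₁) (hα₂ : 0 < p.α₂) (hl : 0 ≤ p.lam)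
    (hW : IsLyapunov P p W) (hc : c.IsSolution P p ⊤) (hw : ∑ i, c.w 0 i = 0)
    (hz : ∑ i, c.z 0 i = 0) :
    Tendsto (fun t => P.dissip (c.state t)) atTop (𝓝 0) := by
  obtain ⟨S, hS, hcS⟩ := exists_compact_of_isSolution hN hss hcost hα₁ hW hc hw hz
  obtain ⟨K, hK0, hK⟩ := exists_state_lipschitz hN hss hcost hα₁.le hα₂ hl hS
  obtain ⟨κ, hκ, hd⟩ := hW.decay
  obtain ⟨u₀, hu₀⟩ := exists_isMinOn_reducedCost hcost
  have hα : 0 < 1 / p.α₁ := by positivity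
  have h1 := tendsto_zero_of_diniLE (y := c.state) hK0
    (fun s t hs hst => by
      rw [dist_eq_norm]
      exact hK c ⊤ hc hcS s t hs hst (EReal.coe_lt_top t)) hS
    (fun t ht => hcS t ht (EReal.coe_lt_top t))
    (G := fun s => κ * P.dissip s) ((P.continuous_dissip hN hss hcost).const_mul κ)
    (fun s => mul_nonneg hκ.le (P.dissip_nonneg s))
    (v := fun t => lyap P p W (c.state t))
    ((continuous_lyap hcost hW).comp_continuousOn
      (hc.cont.mono fun t ht => ⟨ht, EReal.coe_lt_top t⟩))
    (m := 1 / p.α₁ * P.reducedCost u₀)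
    (fun t _ => by
      have h2 := mul_le_mul_of_nonneg_left (hu₀ (c.u t)) hα.le
      have h3 := hW.nonneg (c.state t)
      change _ ≤ 1 / p.α₁ * P.reducedCost (c.u t) + W (c.state t)
      linarith)
    (fun t ht => hd c ⊤ hc hw hz t ht (EReal.coe_lt_top t))
  have h2 := h1.const_mul κ⁻¹
  simpa [hκ.ne'] using h2

theorem tendsto_infEDist_configX (hN : 0 < N) (hss : P.SteadyStateAssumption)
    (hcost : P.CostAssumption) (hα₁ : 0 < p.α₁) (hα₂ : 0 < p.α₂) (hl : 0 ≤ p.lam)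
    (hW : IsLyapunov P p W) (hc : c.IsSolution P p ⊤) (hw : ∑ i, c.w 0 i = 0)
    (hz : ∑ i, c.z 0 i = 0) :
    Tendsto (fun t => Metric.infEDist (c.state t) P.configX) atTop (𝓝 0) := by
  obtain ⟨S, hS, hcS⟩ := exists_compact_of_isSolution hN hss hcost hα₁ hW hc hw hz
  have hd := tendsto_dissip hN hss hcost hα₁ hα₂ hl hW hc hw hz
  rw [ENNReal.tendsto_nhds_zero]
  intro ε hε
  have hU : IsOpen {s : State N d n m | Metric.infEDist s P.configX < ε} :=
    isOpen_lt Metric.continuous_infEDist continuous_const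
  filter_upwards [eventually_mem_of_tendsto_zero hS (fun t ht => hcS t ht (EReal.coe_lt_top t)) hU
    (P.continuous_dissip hN hss hcost) P.dissip_nonneg (fun s _ h => by
      obtain ⟨h1, h2⟩ := eq_eqPoint_of_dissip_eq_zero h
      have h3 : s ∈ P.configX := by rw [h2]; exact eqPoint_mem_configX h1
      change Metric.infEDist s P.configX < ε
      rwa [Metric.infEDist_zero_of_mem h3]) hd] with t ht using le_of_lt ht

/-- A nearby point with the same value as `u` would itself be a local minimum, hence stationary,
contradicting isolation. -/
theorem exists_strict_min {f : Stack m → ℝ} {u : Stack m}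
    (hiso : ∀ᶠ v in 𝓝[≠] u, gradient f v ≠ 0) (hmin : IsLocalMin f u) :
    ∃ r > 0, ∀ v ∈ Metric.closedBall u r, v ≠ u → f u < f v ∧ gradient f v ≠ 0 := by
  have h1 : ∀ᶠ v in 𝓝 u, ∀ᶠ v' in 𝓝 v, f u ≤ f v' := eventually_eventually_nhds.2 hmin
  have h2 : ∀ᶠ v in 𝓝 u, v ≠ u → gradient f v ≠ 0 := eventually_nhdsWithin_iff.1 hiso
  obtain ⟨r, hr, h⟩ := Metric.nhds_basis_closedBall.eventually_iff.1 (h1.and h2)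
  refine ⟨r, hr, fun v hv hvu => ?_⟩
  obtain ⟨h3, h4⟩ := h hv
  refine ⟨(h3.self_of_nhds).lt_of_ne fun h5 => h4 hvu ?_, h4 hvu⟩
  exact gradient_eq_zero_of_isLocalMin (h3.mono fun v' hv' => h5 ▸ hv')

/-- At this point all transmitted signals agree across robots, so the consensus terms vanish, and
`d` equals the gradient of the reduced cost, which is zero. The constant run sampled once at time
`0` is therefore a solution. -/
theorem isEquilibrium_eqPoint (hss : P.SteadyStateAssumption)
    (hcost : P.CostAssumption) {u : Stack m} (hu : gradient P.reducedCost u = 0) :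
    IsEquilibrium P p (P.eqPoint u) := by
  set c : Run N d n m :=
    { x := fun _ => P.hStack u
      u := fun _ => u
      w := fun _ => P.πw (P.hStack u)
      z := fun _ => P.πz (P.hStack u)
      ξ := fun _ => 0
      τ := fun _ k => if k = 0 then 0 else ⊤ } with hc
  have hτ0 : ∀ i, c.τ i 0 = 0 := fun i => rfl
  have hτs : ∀ i k, c.τ i (k + 1) = ⊤ := fun i k => rfl
  have hσ : ∀ i t, c.sigW P i t = P.σ (P.hStack u) := fun i t => by
    have := P.πw_sub (P.hStack u) (P.πw (P.hStack u)) i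
    rw [sub_self] at this
    exact (sub_eq_zero.1 this.symm)
  have hg : ∀ i t, c.sigZ P i t = P.meanGrad₂ (P.hStack u) := fun i t => by
    have := P.πz_sub (P.hStack u) (P.πz (P.hStack u)) i
    rw [sub_self] at this
    unfold Run.sigZ
    rw [hσ]
    exact (sub_eq_zero.1 this.symm)
  have hd : ∀ t, c.dirStackAt P t = 0 := fun t => by
    obtain ⟨C, -, hC⟩ := exists_dirStack_sub_gradient_le hss hcost
    have := hC (P.hStack u) u (P.πw (P.hStack u)) (P.πz (P.hStack u))
    simp only [sub_self, norm_zero, add_zero, mul_zero, hu, sub_zero, norm_le_zero_iff] at this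
    exact this
  refine ⟨c, ?_, fun t _ => rfl, hτs⟩
  have hcont : ContinuousOn (fun _ : ℝ => P.eqPoint u) {t : ℝ | 0 ≤ t ∧ (t : EReal) < ⊤} :=
    continuousOn_const
  refine ⟨EReal.coe_lt_top 0, hcont, ?_, ?_, ?_, ?_, ?_, ?_, ?_, ?_, ?_, ?_, ?_, ?_⟩
  · intro t _ _ i
    change HasDerivWithinAt (fun _ => P.hStack u i) (P.r i (P.h i (u i)) (u i)) _ _
    rw [hss.equilibrium]
    exact hasDerivWithinAt_const _ _ _
  · intro t _ _ i
    have h1 : c.dirAt P i t = c.dirStackAt P t i := rfl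
    rw [h1, hd, PiLp.zero_apply, smul_zero, neg_zero]
    exact hasDerivWithinAt_const t (Ici t) (u i)
  · intro t _ _ i
    simp only [hσ, sub_self, smul_zero, Finset.sum_const_zero, neg_zero]
    exact hasDerivWithinAt_const _ _ _
  · intro t _ _ i
    simp only [hg, sub_self, smul_zero, Finset.sum_const_zero, neg_zero]
    exact hasDerivWithinAt_const _ _ _
  · intro t _ _ i
    have h1 : c.ξ t i = 0 := rfl
    rw [h1, mul_zero, neg_zero]
    exact hasDerivWithinAt_const _ _ _
  · exact hτ0
  · intro i k
    cases k with
    | zero => exact Or.inl (EReal.coe_lt_top 0)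
    | succ k => exact Or.inr (hτs i k)
  · intro i k h
    rw [hτs]; exact h
  · intro i k _
    exact hτs i k
  · intro i k t _ _ _
    have h1 : c.errNorm P i (c.τ i k).toReal t = 0 := by
      unfold Run.errNorm
      rw [hσ, hσ, hg, hg, sub_self, sub_self]
      exact norm_zero
    have h2 : c.dirAt P i t = 0 := by
      have h3 : c.dirAt P i t = c.dirStackAt P t i := rfl
      rw [h3, hd, PiLp.zero_apply]
    rw [h1]
    unfold Run.threshold
    rw [h2, norm_zero, mul_zero, zero_add]
    exact abs_nonneg _
  · intro i k h
    rw [hτs] at h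
    exact absurd h (lt_irrefl _)
  · intro i t ht
    exact ⟨1, ht⟩

/-- The composite function has a strict local minimum at the equilibrium: moving `u` raises the
cost, moving anything else raises `W`. Nearby solutions thus stay in a ball in which the equilibrium
is the only zero of `dissip`, and `dissip` tends to zero. -/
theorem locallyAsymptoticallyStable_eqPoint (hN : 0 < N) (hss : P.SteadyStateAssumption)
    (hcost : P.CostAssumption) (hα₁ : 0 < p.α₁) (hα₂ : 0 < p.α₂)
    (hl : 0 ≤ p.lam) (hW : IsLyapunov P p W) {u : Stack m} (hu : gradient P.reducedCost u = 0)
    (hiso : ∀ᶠ v in 𝓝[≠] u, gradient P.reducedCost v ≠ 0) (hmin : IsLocalMin P.reducedCost u) :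
    LocallyAsymptoticallyStable P p setS (P.eqPoint u) := by
  obtain ⟨r, hr, hstrict⟩ := exists_strict_min hiso hmin
  set e := P.eqPoint u with he
  have hα : 0 < 1 / p.α₁ := by positivity
  have hmem : ∀ s ∈ Metric.closedBall e r, s.2.1 ∈ Metric.closedBall u r := fun s hs => by
    rw [Metric.mem_closedBall] at hs ⊢
    exact ((le_max_left _ _).trans (le_max_right _ _)).trans hs
  have hV0 : lyap P p W e = 1 / p.α₁ * P.reducedCost u := by
    unfold lyap
    rw [hW.eqPoint, add_zero]
    rfl
  have hpos : ∀ s ∈ Metric.closedBall e r, s ≠ e → 0 < lyap P p W s - lyap P p W e := by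
    intro s hs hse
    rw [hV0]
    unfold lyap
    have hW0 := hW.nonneg s
    by_cases hsu : s.2.1 = u
    · obtain ⟨κ, hκ, hlow⟩ := hW.lower
      have h1 : 0 < P.trackErr s := (P.trackErr_nonneg s).lt_of_ne fun h => hse (by
        rw [eq_eqPoint_of_trackErr_eq_zero h.symm, hsu])
      have h2 := hlow s
      have h3 := mul_pos hκ h1
      rw [hsu]
      linarith
    · have h1 := mul_lt_mul_of_pos_left (hstrict _ (hmem s hs) hsu).1 hα
      linarith
  have hstay := fun ε hε => exists_dist_lt_of_lyapunov (ε := ε)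
    ((continuous_lyap hcost hW).sub continuous_const) (sub_self (lyap P p W e)) hr hpos hε
  have hdec : ∀ (c : Run N d n m) (T : EReal), c.IsSolution P p T → c.state 0 ∈ setS →
      ∀ t : ℝ, 0 ≤ t → (t : EReal) < T →
        lyap P p W (c.state t) - lyap P p W e ≤ lyap P p W (c.state 0) - lyap P p W e :=
    fun c T hc h0 t ht0 htT => by
      have h1 : ∑ i, c.w 0 i = 0 := h0.1
      have h2 : ∑ i, c.z 0 i = 0 := h0.2.1
      exact sub_le_sub_right (lyap_le hcost hW hc h1 h2 ht0 htT) _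
  refine ⟨isEquilibrium_eqPoint hss hcost hu, fun ε hε => ?_, ?_⟩
  · obtain ⟨δ, hδ, h⟩ := hstay ε hε
    exact ⟨δ, hδ, fun c T hc h0 h1 => h c.state T hc.cont (hdec c T hc h0) h1⟩
  · obtain ⟨δ, hδ, h⟩ := hstay r hr
    refine ⟨δ, hδ, fun c hc h0 h1 => ?_⟩
    have h2 := h c.state ⊤ hc.cont (hdec c ⊤ hc h0) h1
    have hd := tendsto_dissip hN hss hcost hα₁ hα₂ hl hW hc h0.1 h0.2.1
    rw [Metric.tendsto_nhds]
    intro ε hε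
    refine eventually_mem_of_tendsto_zero (isCompact_closedBall e r)
      (fun t ht => Metric.mem_closedBall.2 (h2 t ht (EReal.coe_lt_top t)).le)
      (Metric.isOpen_ball (x := e) (ε := ε)) (P.continuous_dissip hN hss hcost) P.dissip_nonneg
      (fun s hs h3 => ?_) hd
    obtain ⟨h4, h5⟩ := eq_eqPoint_of_dissip_eq_zero h3
    have h6 : s.2.1 = u := by
      by_contra h7
      exact (hstrict _ (hmem s hs) h7).2 h4
    rw [h5, h6]
    exact Metric.mem_ball_self hε

end EventTriggered

/-! ### The vector field with held samples. -/

namespace EventTriggered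

variable {N d : ℕ} {n m : Fin N → ℕ} {P : Problem N d n m} {c c' : Run N d n m} {p : Params}
  {T : EReal} {W : State N d n m → ℝ}

namespace Problem

/-- The signal `w_i + φ_i(x_i)` as a function of the state. -/
def sigWState (P : Problem N d n m) (i : Fin N) (s : State N d n m) : Vec d :=
  s.2.2.1 i + P.φ i (s.1 i)

/-- The signal `z_i + ∇₂ ℓ_i(x_i, w_i + φ_i(x_i))` as a function of the state. -/
def sigZState (P : Problem N d n m) (i : Fin N) (s : State N d n m) : Vec d :=
  s.2.2.2.1 i + P.grad₂ i (s.1 i) (P.sigWState i s)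

/-- The error of robot `i` with respect to samples `q`, `ζ`. -/
def errState (P : Problem N d n m) (i : Fin N) (q ζ : Stack fun _ : Fin N => d)
    (s : State N d n m) : ℝ :=
  ‖WithLp.toLp 2 (P.sigWState i s - q i, P.sigZState i s - ζ i)‖

/-- The triggering threshold as a function of the state. -/
def thrState (P : Problem N d n m) (p : Params) (i : Fin N) (s : State N d n m) : ℝ :=
  p.lam * ‖P.dir i (s.1 i) (s.2.1 i) (s.2.2.1 i) (s.2.2.2.1 i)‖ + |s.2.2.2.2 i|

/-- The vector field of the closed loop with samples `q`, `ζ`. -/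
def field (P : Problem N d n m) (p : Params) (q ζ : Stack fun _ : Fin N => d)
    (s : State N d n m) : State N d n m :=
  (P.rStack s.1 s.2.1, -(p.α₁ • P.dirStack s.1 s.2.1 s.2.2.1 s.2.2.2.1),
    -((1 / p.α₂) • P.lapStack q), -((1 / p.α₂) • P.lapStack ζ), -(p.ν • s.2.2.2.2))

theorem continuous_grad₂ (hcost : P.CostAssumption) (i : Fin N) :
    Continuous fun q : Vec (n i) × Vec d => P.grad₂ i q.1 q.2 :=
  have ⟨_, h⟩ := hcost.grad₂_lipschitz
  (h i).continuous

theorem continuous_grad₁ (hcost : P.CostAssumption) (i : Fin N) :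
    Continuous fun q : Vec (n i) × Vec d => P.grad₁ i q.1 q.2 :=
  have ⟨_, h⟩ := hcost.grad₁_lipschitz
  (h i).continuous

theorem continuous_sigWState (hcost : P.CostAssumption) (i : Fin N) :
    Continuous (P.sigWState i) := by
  have h := (hcost.φ_smooth i).continuous
  unfold sigWState
  fun_prop

theorem continuous_sigZState (hcost : P.CostAssumption) (i : Fin N) :
    Continuous (P.sigZState i) := by
  have h1 := continuous_sigWState hcost i
  have h2 : Continuous fun s : State N d n m => P.grad₂ i (s.1 i) (P.sigWState i s) :=
    (continuous_grad₂ hcost i).comp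
      (by fun_prop : Continuous fun s : State N d n m => (s.1 i, P.sigWState i s))
  unfold sigZState
  fun_prop

theorem continuous_errState (hcost : P.CostAssumption) (i : Fin N)
    (q ζ : Stack fun _ : Fin N => d) : Continuous (P.errState i q ζ) := by
  have h1 := continuous_sigWState hcost i
  have h2 := continuous_sigZState hcost i
  unfold errState
  fun_prop

theorem continuous_dir (hss : P.SteadyStateAssumption) (hcost : P.CostAssumption) (i : Fin N) :
    Continuous fun s : State N d n m =>
      P.dir i (s.1 i) (s.2.1 i) (s.2.2.1 i) (s.2.2.2.1 i) := by
  have hH : Continuous (P.gradH i) :=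
    (LinearIsometryEquiv.continuous _).comp ((hss.h_smooth i).continuous_fderiv one_ne_zero)
  have hφ : Continuous (P.gradφ i) :=
    (LinearIsometryEquiv.continuous _).comp ((hcost.φ_smooth i).continuous_fderiv one_ne_zero)
  have h1 := continuous_sigWState hcost i
  have hq : Continuous fun s : State N d n m => (s.1 i, P.sigWState i s) := by fun_prop
  have h2 := (continuous_grad₂ hcost i).comp hq
  have h3 := (continuous_grad₁ hcost i).comp hq
  have hz : Continuous fun s : State N d n m => s.2.2.2.1 i := by fun_prop
  have hx : Continuous fun s : State N d n m => s.1 i := by fun_prop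
  have hu : Continuous fun s : State N d n m => s.2.1 i := by fun_prop
  exact (hH.comp hu).clm_apply (h3.add ((hφ.comp hx).clm_apply (h2.add hz)))

theorem continuous_thrState (hss : P.SteadyStateAssumption) (hcost : P.CostAssumption)
    (i : Fin N) : Continuous (P.thrState p i) := by
  have h := continuous_dir hss hcost i
  unfold thrState
  fun_prop

/-- The Jacobians of `h_i` and `φ_i` are only assumed continuous, so the field need not be locally
Lipschitz; this is why existence rests on Peano's theorem. -/
theorem continuous_field (hss : P.SteadyStateAssumption) (hcost : P.CostAssumption)
    (q ζ : Stack fun _ : Fin N => d) : Continuous (P.field p q ζ) := by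
  obtain ⟨β, hβ0, hβ⟩ := hss.r_lipschitz
  have hr : ∀ i, Continuous fun y : Vec (n i) × Vec (m i) => P.r i y.1 y.2 := fun i =>
    continuous_of_norm_sub_le (C := 2 * β) (by positivity) fun y y' => by
      have h1 := norm_fst_le (y - y')
      have h2 := norm_snd_le (y - y')
      have h3 := hβ i y.1 y.2 y'.1 y'.2
      rw [Prod.fst_sub] at h1
      rw [Prod.snd_sub] at h2
      nlinarith
  have h1 : Continuous fun s : State N d n m => P.rStack s.1 s.2.1 :=
    (PiLp.continuous_toLp 2 _).comp (continuous_pi fun i => (hr i).comp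
      (by fun_prop : Continuous fun s : State N d n m => (s.1 i, s.2.1 i)))
  have h2 : Continuous fun s : State N d n m => P.dirStack s.1 s.2.1 s.2.2.1 s.2.2.2.1 :=
    (PiLp.continuous_toLp 2 _).comp (continuous_pi fun i => continuous_dir hss hcost i)
  unfold field
  fun_prop

theorem exists_sigState_lipschitz (hcost : P.CostAssumption) :
    ∃ C, 0 ≤ C ∧ ∀ i (s s' : State N d n m),
      ‖WithLp.toLp 2 (P.sigWState i s - P.sigWState i s', P.sigZState i s - P.sigZState i s')‖ ≤
        C * ‖s - s'‖ := by
  obtain ⟨β, hβ⟩ := hcost.φ_lipschitz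
  obtain ⟨C₂, hC₂0, hC₂⟩ := exists_grad₂_lipschitz hcost
  have hβ0 : (0 : ℝ) ≤ β := β.2
  refine ⟨(1 + β) + (1 + C₂ * (1 + (1 + β))), by positivity, fun i s s' => ?_⟩
  have hx : ‖s.1 i - s'.1 i‖ ≤ ‖s - s'‖ := (PiLp.norm_apply_le (s.1 - s'.1) i).trans
    (norm_fst_le (s - s'))
  have hw : ‖s.2.2.1 i - s'.2.2.1 i‖ ≤ ‖s - s'‖ :=
    (PiLp.norm_apply_le (s.2.2.1 - s'.2.2.1) i).trans
      ((norm_fst_le (s - s').2.2).trans ((norm_snd_le (s - s').2).trans (norm_snd_le (s - s'))))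
  have hz : ‖s.2.2.2.1 i - s'.2.2.2.1 i‖ ≤ ‖s - s'‖ :=
    (PiLp.norm_apply_le (s.2.2.2.1 - s'.2.2.2.1) i).trans
      ((norm_fst_le (s - s').2.2.2).trans ((norm_snd_le (s - s').2.2).trans
        ((norm_snd_le (s - s').2).trans (norm_snd_le (s - s')))))
  have h1 : ‖P.sigWState i s - P.sigWState i s'‖ ≤ (1 + β) * ‖s - s'‖ := by
    unfold sigWState
    rw [add_sub_add_comm, add_mul, one_mul]
    exact (norm_add_le _ _).trans (add_le_add hw (((hβ i).norm_sub_le _ _).trans (by gcongr)))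
  have h2 : ‖P.sigZState i s - P.sigZState i s'‖ ≤ (1 + C₂ * (1 + (1 + β))) * ‖s - s'‖ := by
    unfold sigZState
    rw [add_sub_add_comm, add_mul, one_mul]
    refine (norm_add_le _ _).trans (add_le_add hz ((hC₂ i _ _ _ _).trans ?_))
    rw [mul_assoc]
    gcongr
    linarith
  have h3 : ∀ y : WithLp 2 (Vec d × Vec d), ‖y‖ ≤ ‖y.fst‖ + ‖y.snd‖ := fun y => by
    refine le_of_sq_le_sq ?_ (by positivity)
    rw [WithLp.prod_norm_sq_eq_of_L2]
    nlinarith [norm_nonneg y.fst, norm_nonneg y.snd]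
  refine (h3 _).trans ?_
  rw [add_mul]
  exact add_le_add h1 h2

/-- The closed loop with held samples has a solution, for a short time, whose errors stay below
the thresholds. -/
theorem exists_held_solution (hss : P.SteadyStateAssumption) (hcost : P.CostAssumption)
    (t₀ : ℝ) (s₀ : State N d n m) (q ζ : Stack fun _ : Fin N => d)
    (h : ∀ i, P.errState i q ζ s₀ < P.thrState p i s₀) :
    ∃ δ > 0, ∃ y : ℝ → State N d n m, y t₀ = s₀ ∧ ContinuousOn y (Ici t₀) ∧
      (∀ t, t₀ ≤ t → t < t₀ + δ → HasDerivWithinAt y (P.field p q ζ (y t)) (Ici t) t) ∧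
      ∀ t, t₀ ≤ t → t < t₀ + δ → ∀ i, P.errState i q ζ (y t) ≤ P.thrState p i (y t) := by
  obtain ⟨δ, hδ, y, hy0, hyc, hy⟩ :=
    exists_local_solution (continuous_field (p := p) hss hcost q ζ) s₀
  -- Strict inequality is an open condition on the state, so no robot needs to trigger for a short
  -- time.
  have h1 : ∀ᶠ s in 𝓝 s₀, ∀ i, P.errState i q ζ s < P.thrState p i s :=
    eventually_all.2 fun i => (continuous_errState hcost i q ζ).continuousAt.eventually_lt
      (continuous_thrState hss hcost i).continuousAt (h i)
  have h2 : ∀ᶠ t in 𝓝[Ici 0] (0 : ℝ), ∀ i, P.errState i q ζ (y t) < P.thrState p i (y t) := by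
    have h3 := hyc 0 self_mem_Ici
    rw [ContinuousWithinAt, hy0] at h3
    exact h3.eventually h1
  obtain ⟨ρ, hρ, h3⟩ := Metric.eventually_nhds_iff.1 (eventually_nhdsWithin_iff.1 h2)
  refine ⟨min δ ρ, lt_min hδ hρ, fun t => y (t - t₀), by simp [hy0], ?_, ?_, ?_⟩
  · exact hyc.comp (by fun_prop) fun t ht => mem_Ici.2 (sub_nonneg.2 ht)
  · intro t ht htδ
    have h4 := (hy (t - t₀) (sub_nonneg.2 ht) (by linarith [min_le_left δ ρ])).scomp t
      (h := fun s => s - t₀) (h' := 1) (s := Ici t)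
      ((hasDerivAt_id t).sub_const t₀).hasDerivWithinAt
      (fun s hs => by rw [mem_Ici] at hs ⊢; linarith)
    simpa [Function.comp_def] using h4
  · intro t ht htδ i
    have h5 : 0 ≤ t - t₀ := sub_nonneg.2 ht
    refine (h3 ?_ h5 i).le
    rw [Real.dist_eq, sub_zero, abs_of_nonneg h5]
    linarith [min_le_right δ ρ]

end Problem

open Problem

namespace Run

theorem IsSolution.ode_state (hc : c.IsSolution P p T) {t : ℝ} (ht0 : 0 ≤ t)
    (htT : (t : EReal) < T) :
    HasDerivWithinAt c.state (P.field p (c.sampledW P t) (c.sampledZ P t) (c.state t))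
      (Ici t) t :=
  (hc.hasDeriv_x ht0 htT).prodMk ((hc.hasDeriv_u ht0 htT).prodMk
    ((hc.hasDeriv_w ht0 htT).prodMk ((hc.hasDeriv_z ht0 htT).prodMk (hc.hasDeriv_ξ ht0 htT))))

theorem isSolution_of_state (pos : 0 < T)
    (cont : ContinuousOn c.state {t : ℝ | 0 ≤ t ∧ (t : EReal) < T})
    (ode : ∀ t : ℝ, 0 ≤ t → (t : EReal) < T →
      HasDerivWithinAt c.state (P.field p (c.sampledW P t) (c.sampledZ P t) (c.state t)) (Ici t) t)
    (τ_zero : ∀ i, c.τ i 0 = 0) (τ_dom : ∀ i k, c.τ i k < T ∨ c.τ i k = ⊤)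
    (τ_lt : ∀ i k, c.τ i k < ⊤ → c.τ i k < c.τ i (k + 1))
    (τ_top : ∀ i k, c.τ i k = ⊤ → c.τ i (k + 1) = ⊤)
    (err : ∀ i (t : ℝ), 0 ≤ t → (t : EReal) < T →
      c.errNorm P i (c.last i t) t ≤ c.threshold P p i t)
    (reached : ∀ i k, c.τ i (k + 1) < ⊤ → c.threshold P p i (c.τ i (k + 1)).toReal ≤
      c.errNorm P i (c.τ i k).toReal (c.τ i (k + 1)).toReal)
    (locally_finite : ∀ i (t : ℝ), (t : EReal) < T → ∃ k, (t : EReal) < c.τ i k) :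
    c.IsSolution P p T := by
  have hx := fun t ht0 htT => (ContinuousLinearMap.fst ℝ (Stack n) _).hasFDerivAt
    |>.comp_hasDerivWithinAt t (ode t ht0 htT)
  have hr := fun t ht0 htT => (ContinuousLinearMap.snd ℝ (Stack n) _).hasFDerivAt
    |>.comp_hasDerivWithinAt t (ode t ht0 htT)
  have hu := fun t ht0 htT => (ContinuousLinearMap.fst ℝ (Stack m) _).hasFDerivAt
    |>.comp_hasDerivWithinAt t (hr t ht0 htT)
  have hr := fun t ht0 htT => (ContinuousLinearMap.snd ℝ (Stack m) _).hasFDerivAt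
    |>.comp_hasDerivWithinAt t (hr t ht0 htT)
  have hw := fun t ht0 htT => (ContinuousLinearMap.fst ℝ (Stack fun _ : Fin N => d) _).hasFDerivAt
    |>.comp_hasDerivWithinAt t (hr t ht0 htT)
  have hr := fun t ht0 htT => (ContinuousLinearMap.snd ℝ (Stack fun _ : Fin N => d) _).hasFDerivAt
    |>.comp_hasDerivWithinAt t (hr t ht0 htT)
  have hz := fun t ht0 htT => (ContinuousLinearMap.fst ℝ (Stack fun _ : Fin N => d) _).hasFDerivAt
    |>.comp_hasDerivWithinAt t (hr t ht0 htT)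
  have hξ := fun t ht0 htT => (ContinuousLinearMap.snd ℝ (Stack fun _ : Fin N => d) _).hasFDerivAt
    |>.comp_hasDerivWithinAt t (hr t ht0 htT)
  have hmono : ∀ i, Monotone (c.τ i) := fun i => monotone_nat_of_le_succ fun k => by
    rcases lt_or_eq_of_le (le_top (a := c.τ i k)) with h | h
    · exact (τ_lt i k h).le
    · rw [τ_top i k h]; exact le_top
  refine ⟨pos, cont, ?_, ?_, ?_, ?_, ?_, τ_zero, τ_dom, τ_lt, τ_top, ?_, reached, locally_finite⟩
  · exact fun t ht0 htT i => (hasFDerivAt_apply i _).comp_hasDerivWithinAt t (hx t ht0 htT)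
  · exact fun t ht0 htT i => (hasFDerivAt_apply i _).comp_hasDerivWithinAt t (hu t ht0 htT)
  · exact fun t ht0 htT i => (hasFDerivAt_apply i _).comp_hasDerivWithinAt t (hw t ht0 htT)
  · exact fun t ht0 htT i => (hasFDerivAt_apply i _).comp_hasDerivWithinAt t (hz t ht0 htT)
  · intro t ht0 htT i
    exact (EuclideanSpace.proj (𝕜 := ℝ) (ι := Fin N) i).hasFDerivAt.comp_hasDerivWithinAt t
      (hξ t ht0 htT)
  · intro i k t h1 h2 htT
    have h0 : 0 ≤ c.τ i k := by rw [← τ_zero i]; exact hmono i (Nat.zero_le k)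
    have h3 : ((c.τ i k).toReal : EReal) = c.τ i k :=
      EReal.coe_toReal (h1.trans_lt (EReal.coe_lt_top t)).ne fun h' => by
        rw [h'] at h0; exact absurd h0 (by simp)
    have h4 : (c.τ i k).toReal ≤ t := by rw [← h3] at h1; exact EReal.coe_le_coe_iff.1 h1
    rw [← last_eq_of_isGreatest (hmono i) h3.symm h4 h2]
    exact err i t ((EReal.toReal_nonneg h0).trans h4) htT

end Run

end EventTriggered

/-! ### Gluing of solutions, dwell times and left limits. -/

namespace EventTriggered

variable {N d : ℕ} {n m : Fin N → ℕ} {P : Problem N d n m} {c c' c'' : Run N d n m} {p : Params}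
  {T T' : EReal} {W : State N d n m → ℝ}

open Problem

namespace Run

/-- `c'` coincides with `c` on `[0, T)`, triggering times included. -/
def Agree (T : EReal) (c c' : Run N d n m) : Prop :=
  (∀ t : ℝ, 0 ≤ t → (t : EReal) < T → c'.state t = c.state t) ∧
    ∀ i k, min (c'.τ i k) T = min (c.τ i k) T

namespace Agree

theorem refl (T : EReal) (c : Run N d n m) : Agree T c c := ⟨fun _ _ _ => rfl, fun _ _ => rfl⟩

theorem trans (hTT' : T ≤ T') (h : Agree T c c') (h' : Agree T' c' c'') : Agree T c c'' := by
  refine ⟨fun t ht0 htT => (h'.1 t ht0 (htT.trans_le hTT')).trans (h.1 t ht0 htT), fun i k => ?_⟩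
  rw [← h.2 i k, ← min_eq_right hTT', ← min_assoc, h'.2 i k, min_assoc]

theorem τ_eq (h : Agree T c c') {i : Fin N} {k : ℕ} (hk : c.τ i k < T) :
    c'.τ i k = c.τ i k := by
  have h1 := h.2 i k
  rw [min_eq_left hk.le] at h1
  rcases min_choice (c'.τ i k) T with h2 | h2
  · rwa [h2] at h1
  · rw [h2] at h1; exact absurd h1 hk.ne'

theorem symm (h : Agree T c c') : Agree T c' c :=
  ⟨fun t ht0 htT => (h.1 t ht0 htT).symm, fun i k => (h.2 i k).symm⟩

theorem lt_τ (h : Agree T c c') {i : Fin N} {k : ℕ} {s : EReal} (hs : s < T)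
    (hk : s < c.τ i k) : s < c'.τ i k := by
  have h1 : s < min (c'.τ i k) T := by rw [h.2]; exact lt_min hk hs
  exact h1.trans_le (min_le_left _ _)

theorem last_eq (h : Agree T c c') (i : Fin N) {t : ℝ} (ht : (t : EReal) < T) :
    c'.last i t = c.last i t := by
  unfold last
  congr 1
  ext s
  refine and_congr_right fun hs => exists_congr fun k => ?_
  have hsT : (s : EReal) < T := (EReal.coe_le_coe_iff.2 hs).trans_lt ht
  exact ⟨fun h1 => by rw [← h1] at hsT; rw [h.symm.τ_eq hsT, h1],
    fun h1 => by rw [← h1] at hsT; rw [h.τ_eq hsT, h1]⟩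

theorem last_mem (hc : c.IsSolution P p T) (i : Fin N) {t : ℝ} (ht0 : 0 ≤ t)
    (htT : (t : EReal) < T) : 0 ≤ c.last i t ∧ (c.last i t : EReal) < T := by
  obtain ⟨k, -, h1, h2, -⟩ := hc.exists_sample i ht0 htT
  exact ⟨h2, (EReal.coe_le_coe_iff.2 h1).trans_lt htT⟩

theorem sampledW_eq (h : Agree T c c') (hc : c.IsSolution P p T) {t : ℝ} (ht0 : 0 ≤ t)
    (htT : (t : EReal) < T) : c'.sampledW P t = c.sampledW P t := PiLp.ext fun i => by
  obtain ⟨h1, h2⟩ := last_mem hc i ht0 htT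
  change P.sigWState i (c'.state (c'.last i t)) = P.sigWState i (c.state (c.last i t))
  rw [h.last_eq i htT, h.1 _ h1 h2]

theorem sampledZ_eq (h : Agree T c c') (hc : c.IsSolution P p T) {t : ℝ} (ht0 : 0 ≤ t)
    (htT : (t : EReal) < T) : c'.sampledZ P t = c.sampledZ P t := PiLp.ext fun i => by
  obtain ⟨h1, h2⟩ := last_mem hc i ht0 htT
  change P.sigZState i (c'.state (c'.last i t)) = P.sigZState i (c.state (c.last i t))
  rw [h.last_eq i htT, h.1 _ h1 h2]

theorem errNorm_eq (h : Agree T c c') (i : Fin N) {s t : ℝ} (hs0 : 0 ≤ s)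
    (hsT : (s : EReal) < T) (ht0 : 0 ≤ t) (htT : (t : EReal) < T) :
    c'.errNorm P i s t = c.errNorm P i s t := by
  change ‖WithLp.toLp 2 (P.sigWState i (c'.state t) - P.sigWState i (c'.state s),
    P.sigZState i (c'.state t) - P.sigZState i (c'.state s))‖ = _
  rw [h.1 _ hs0 hsT, h.1 _ ht0 htT]
  rfl

theorem threshold_eq (h : Agree T c c') (i : Fin N) {t : ℝ} (ht0 : 0 ≤ t)
    (htT : (t : EReal) < T) : c'.threshold P p i t = c.threshold P p i t := by
  change P.thrState p i (c'.state t) = _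
  rw [h.1 _ ht0 htT]
  rfl

theorem ode (h : Agree T c c') (hc : c.IsSolution P p T) {t : ℝ} (ht0 : 0 ≤ t)
    (htT : (t : EReal) < T) :
    HasDerivWithinAt c'.state (P.field p (c'.sampledW P t) (c'.sampledZ P t) (c'.state t))
      (Ici t) t := by
  rw [h.sampledW_eq hc ht0 htT, h.sampledZ_eq hc ht0 htT, h.1 t ht0 htT]
  refine (hc.ode_state ht0 htT).congr_of_eventuallyEq ?_ (h.1 t ht0 htT)
  have h1 : ∀ᶠ s : ℝ in 𝓝 t, (s : EReal) < T :=
    continuous_coe_real_ereal.continuousAt.eventually_lt_const htT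
  filter_upwards [nhdsWithin_le_nhds h1, self_mem_nhdsWithin] with s hs hst
  exact h.1 s (ht0.trans hst) hs

theorem err (h : Agree T c c') (hc : c.IsSolution P p T) (i : Fin N) {t : ℝ} (ht0 : 0 ≤ t)
    (htT : (t : EReal) < T) : c'.errNorm P i (c'.last i t) t ≤ c'.threshold P p i t := by
  obtain ⟨h1, h2⟩ := last_mem hc i ht0 htT
  rw [h.last_eq i htT, h.errNorm_eq i h1 h2 ht0 htT, h.threshold_eq i ht0 htT]
  exact hc.errNorm_le i ht0 htT

theorem reached (h : Agree T c c') (hc : c.IsSolution P p T) (i : Fin N) (k : ℕ)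
    (hk : c.τ i (k + 1) < T) : c'.threshold P p i (c'.τ i (k + 1)).toReal ≤
      c'.errNorm P i (c'.τ i k).toReal (c'.τ i (k + 1)).toReal := by
  have hk' : c.τ i k < T := (hc.monotone_τ i k.le_succ).trans_lt hk
  have e1 := hc.coe_toReal_τ (hk.trans_le le_top)
  have e2 := hc.coe_toReal_τ (hk'.trans_le le_top)
  have n1 := EReal.toReal_nonneg (hc.τ_nonneg i (k + 1))
  have n2 := EReal.toReal_nonneg (hc.τ_nonneg i k)
  rw [h.τ_eq hk, h.τ_eq hk', h.errNorm_eq i n2 (by rwa [e2]) n1 (by rwa [e1]),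
    h.threshold_eq i n1 (by rwa [e1])]
  exact hc.reached i k (hk.trans_le le_top)

end Agree

/-- The union of compatible solutions is a solution. -/
theorem isSolution_of_agree (hT : ∀ t : ℝ, (t : EReal) < T' → ∃ c T, (t : EReal) < T ∧ T ≤ T' ∧
      c.IsSolution P p T ∧ Agree T c c') (hpos : 0 < T')
    (hτ : ∀ i k, c'.τ i k < ⊤ → ∃ c T, T ≤ T' ∧ c.IsSolution P p T ∧ Agree T c c' ∧
      c.τ i k < T) : c'.IsSolution P p T' := by
  refine isSolution_of_state hpos ?_ ?_ ?_ ?_ ?_ ?_ ?_ ?_ ?_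
  · rintro t ⟨ht0, htT⟩
    obtain ⟨c, T, h1, h2, hc, h⟩ := hT t htT
    have h3 : ContinuousWithinAt c'.state {t : ℝ | 0 ≤ t ∧ (t : EReal) < T} t :=
      (hc.cont t ⟨ht0, h1⟩).congr (fun s hs => h.1 s hs.1 hs.2) (h.1 t ht0 h1)
    refine h3.mono_of_mem_nhdsWithin ?_
    have h4 : ∀ᶠ s : ℝ in 𝓝 t, (s : EReal) < T :=
      continuous_coe_real_ereal.continuousAt.eventually_lt_const h1
    filter_upwards [nhdsWithin_le_nhds h4, self_mem_nhdsWithin] with s hs hst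
    exact ⟨hst.1, hs⟩
  · intro t ht0 htT
    obtain ⟨c, T, h1, -, hc, h⟩ := hT t htT
    exact h.ode hc ht0 h1
  · intro i
    obtain ⟨c, T, h1, -, hc, h⟩ := hT 0 hpos
    rw [h.τ_eq (by rw [hc.τ_zero]; exact hc.pos), hc.τ_zero]
  · intro i k
    rcases lt_or_eq_of_le (le_top (a := c'.τ i k)) with h0 | h0
    · obtain ⟨c, T, h1, hc, h, h2⟩ := hτ i k h0
      exact Or.inl (by rw [h.τ_eq h2]; exact h2.trans_le h1)
    · exact Or.inr h0
  · intro i k h0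
    obtain ⟨c, T, h1, hc, h, h2⟩ := hτ i k h0
    rw [h.τ_eq h2]
    exact h.lt_τ h2 (hc.τ_lt i k (h2.trans_le le_top))
  · intro i k h0
    by_contra h3
    obtain ⟨c, T, h1, hc, h, h2⟩ := hτ i (k + 1) (lt_of_le_of_ne le_top h3)
    have h4 := (hc.monotone_τ i k.le_succ).trans_lt h2
    rw [h.τ_eq h4] at h0
    exact absurd (h0 ▸ h4 : ⊤ < T) (not_lt.2 le_top)
  · intro i t ht0 htT
    obtain ⟨c, T, h1, -, hc, h⟩ := hT t htT
    exact h.err hc i ht0 h1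
  · intro i k h0
    obtain ⟨c, T, -, hc, h, h2⟩ := hτ i (k + 1) h0
    exact h.reached hc i k h2
  · intro i t htT
    obtain ⟨c, T, h1, -, hc, h⟩ := hT t htT
    obtain ⟨k, hk⟩ := hc.locally_finite i t h1
    exact ⟨k, h.lt_τ h1 hk⟩

/-- With the integrating factor `exp(ν t)` the right derivative vanishes. The formula keeps the
triggering threshold away from zero on bounded time intervals. -/
theorem IsSolution.abs_ξ (hc : c.IsSolution P p T) (i : Fin N) {t : ℝ} (ht0 : 0 ≤ t)
    (htT : (t : EReal) < T) : |c.ξ t i| = |c.ξ 0 i| * Real.exp (-p.ν * t) := by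
  have h := constant_of_has_deriv_right_zero (f := fun s => c.ξ s i * Real.exp (p.ν * s))
    (a := 0) (b := t) ?_ ?_ t (right_mem_Icc.2 ht0)
  · simp only [mul_zero, Real.exp_zero, mul_one] at h
    rw [← h, abs_mul, Real.abs_exp, mul_assoc, ← Real.exp_add]
    simp
  · refine ContinuousOn.mul ?_ (by fun_prop)
    exact (by fun_prop : Continuous fun s : State N d n m => s.2.2.2.2 i).comp_continuousOn
      (hc.cont.mono (IsSolution.Icc_subset htT))
  · intro s hs
    have h1 := hc.ode_ξ s hs.1 ((EReal.coe_lt_coe_iff.2 hs.2).trans htT) i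
    have h2 : HasDerivAt (fun s => Real.exp (p.ν * s)) (Real.exp (p.ν * s) * (p.ν * 1)) s :=
      ((hasDerivAt_id s).const_mul p.ν).exp
    refine (h1.mul h2.hasDerivWithinAt).congr_deriv ?_
    ring

end Run

/-- Hypotheses under which solutions stay in compact sets. -/
structure Admissible (P : Problem N d n m) (p : Params) (W : State N d n m → ℝ) : Prop where
  card_pos : 0 < N
  steady : P.SteadyStateAssumption
  cost : P.CostAssumption
  α₁_pos : 0 < p.α₁
  α₂_pos : 0 < p.α₂
  lam_nonneg : 0 ≤ p.lam
  lyapunov : IsLyapunov P p W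

namespace Run

theorem sums_of_mem_setS' (h : c.state 0 ∈ setS') :
    ∑ i, c.w 0 i = 0 ∧ ∑ i, c.z 0 i = 0 ∧ ∀ i, c.ξ 0 i ≠ 0 := h

/-- On bounded time intervals the intervals between triggering times are bounded below. -/
theorem exists_dwell_time (ha : Admissible P p W) {b : ℝ} (hc : c.IsSolution P p b)
    (h0 : c.state 0 ∈ setS') (i : Fin N) :
    ∃ η > 0, ∀ k, c.τ i (k + 1) < ⊤ → (c.τ i k).toReal + η ≤ (c.τ i (k + 1)).toReal := by
  obtain ⟨hw, hz, hξ⟩ := sums_of_mem_setS' h0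
  obtain ⟨S, hS, hcS⟩ := exists_compact_of_isSolution ha.card_pos ha.steady ha.cost ha.α₁_pos
    ha.lyapunov hc hw hz
  obtain ⟨K, hK0, hK⟩ := exists_state_lipschitz ha.card_pos ha.steady ha.cost ha.α₁_pos.le
    ha.α₂_pos ha.lam_nonneg hS
  obtain ⟨C, hC0, hC⟩ := exists_sigState_lipschitz ha.cost
  -- A lower bound for `|ξ_i|`, hence for the threshold, on all of `[0, b)`; the absolute values
  -- avoid any sign condition.
  set a := |c.ξ 0 i| * Real.exp (-(|p.ν| * |b|)) with ha'
  have ha0 : 0 < a := mul_pos (abs_pos.2 (hξ i)) (Real.exp_pos _)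
  refine ⟨a / (C * K + 1), by positivity, fun k hk => ?_⟩
  have hk' : c.τ i k < ⊤ := (hc.monotone_τ i k.le_succ).trans_lt hk
  have e1 := hc.coe_toReal_τ hk
  have e2 := hc.coe_toReal_τ hk'
  have n1 := EReal.toReal_nonneg (hc.τ_nonneg i (k + 1))
  have n2 := EReal.toReal_nonneg (hc.τ_nonneg i k)
  have hlt := (hc.τ_dom i (k + 1)).resolve_right hk.ne
  have hreach := hc.reached i k hk
  have hle := hc.monotone_τ i k.le_succ
  rw [Nat.succ_eq_add_one, ← e1, ← e2, EReal.coe_le_coe_iff] at hle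
  rw [← e1] at hlt
  set t := (c.τ i (k + 1)).toReal
  set s := (c.τ i k).toReal
  have h1 := (hC i (c.state t) (c.state s)).trans
    (mul_le_mul_of_nonneg_left (hK c b hc hcS s t n2 hle hlt) hC0)
  have h2 : a ≤ c.threshold P p i t := by
    have h3 : 0 ≤ p.lam * ‖c.dirAt P i t‖ := mul_nonneg ha.lam_nonneg (norm_nonneg _)
    have h4 : a ≤ |c.ξ t i| := by
      rw [hc.abs_ξ i n1 hlt, ha']
      gcongr
      have h5 : t ≤ |b| := (EReal.coe_lt_coe_iff.1 hlt).le.trans (le_abs_self b)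
      have h6 := mul_le_mul (le_abs_self p.ν) h5 n1 (abs_nonneg p.ν)
      linarith
    unfold threshold
    linarith
  -- The error is zero at the sampling time, grows at rate at most `C * K`, and must reach a
  -- threshold of at least `a` at the next triggering.
  have h3 : a ≤ C * (K * (t - s)) := h2.trans (hreach.trans h1)
  rw [← le_sub_iff_add_le', div_le_iff₀ (by positivity)]
  nlinarith [sub_nonneg.2 hle]

/-- Infinitely many triggerings separated by a fixed dwell time do not fit before `b`. -/
theorem exists_τ_eq_top (ha : Admissible P p W) {b : ℝ} (hc : c.IsSolution P p b)
    (h0 : c.state 0 ∈ setS') (i : Fin N) : ∃ k, c.τ i k = ⊤ := by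
  by_contra! hcon
  have hlt : ∀ k, c.τ i k < ⊤ := fun k => lt_of_le_of_ne le_top (hcon k)
  obtain ⟨η, hη, h⟩ := exists_dwell_time ha hc h0 i
  have h1 : ∀ k : ℕ, k * η ≤ (c.τ i k).toReal := by
    intro k
    induction k with
    | zero => simp [hc.τ_zero]
    | succ k ih =>
      have := h k (hlt _)
      push_cast
      linarith
  obtain ⟨k, hk⟩ := exists_nat_gt (b / η)
  rw [div_lt_iff₀ hη] at hk
  have h2 := (hc.τ_dom i k).resolve_right (hcon k)
  rw [← hc.coe_toReal_τ (hlt k), EReal.coe_lt_coe_iff] at h2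
  linarith [h1 k]

/-- Local finiteness forces an accumulation point to be at or beyond the horizon `T`, which is then
finite; but on a finite horizon the sequence reaches `⊤`. -/
theorem not_isZeno (ha : Admissible P p W) (hc : c.IsSolution P p T)
    (h0 : c.state 0 ∈ setS') (i : Fin N) : ¬ c.IsZeno i := by
  rintro ⟨b, hb⟩
  have hle : ∀ k, c.τ i k ≤ b := fun k => (hc.monotone_τ i).ge_of_tendsto hb k
  have hT : T ≤ b := by
    by_contra! h
    obtain ⟨k, hk⟩ := hc.locally_finite i b h
    exact absurd (hle k) (not_le.2 hk)
  have hTtop : T ≠ ⊤ := (hT.trans_lt (EReal.coe_lt_top b)).ne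
  lift T to ℝ using ⟨hTtop, (bot_lt_iff_ne_bot.1 (bot_le.trans_lt hc.pos))⟩
  obtain ⟨k, hk⟩ := exists_τ_eq_top ha hc h0 i
  have := hle k
  rw [hk] at this
  exact absurd this (not_le.2 (EReal.coe_lt_top b))

theorem exists_left_limit (ha : Admissible P p W) {b : ℝ} (hc : c.IsSolution P p b)
    (h0 : c.state 0 ∈ setS') :
    ∃ K, 0 ≤ K ∧ (∀ s t : ℝ, 0 ≤ s → s ≤ t → t < b → ‖c.state t - c.state s‖ ≤ K * (t - s)) ∧
      ∃ s₀, ∀ t, 0 ≤ t → t < b → ‖s₀ - c.state t‖ ≤ K * (b - t) := by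
  obtain ⟨hw, hz, hξ⟩ := sums_of_mem_setS' h0
  obtain ⟨S, hS, hcS⟩ := exists_compact_of_isSolution ha.card_pos ha.steady ha.cost ha.α₁_pos
    ha.lyapunov hc hw hz
  obtain ⟨K, hK0, hK⟩ := exists_state_lipschitz ha.card_pos ha.steady ha.cost ha.α₁_pos.le
    ha.α₂_pos ha.lam_nonneg hS
  have hb : 0 < b := EReal.coe_pos.1 hc.pos
  have hK' : ∀ s t : ℝ, 0 ≤ s → s ≤ t → t < b → ‖c.state t - c.state s‖ ≤ K * (t - s) :=
    fun s t hs hst ht => hK c b hc hcS s t hs hst (EReal.coe_lt_coe_iff.2 ht)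
  refine ⟨K, hK0, hK', ?_⟩
  -- Compactness gives a limit along an ultrafilter of times increasing to `b`; the Lipschitz bound
  -- makes it a genuine left limit with a rate.
  set U : Ultrafilter ℝ := Ultrafilter.of (𝓝[<] b)
  have hU : (U : Filter ℝ) ≤ 𝓝[<] b := Ultrafilter.of_le _
  have hlt : ∀ t < b, ∀ᶠ s in (U : Filter ℝ), t < s ∧ s < b := fun t ht =>
    hU (Ioo_mem_nhdsLT ht)
  obtain ⟨s₀, -, hs₀⟩ := hS.ultrafilter_le_nhds' (U.map c.state) (by
    rw [Ultrafilter.mem_map]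
    exact (hlt 0 hb).mono fun s hs => hcS s hs.1.le (EReal.coe_lt_coe_iff.2 hs.2))
  have hs₀' : Tendsto c.state U (𝓝 s₀) := hs₀
  refine ⟨s₀, fun t ht0 htb => ?_⟩
  refine le_of_tendsto (hs₀'.sub_const (c.state t)).norm ((hlt t htb).mono fun s hs => ?_)
  refine (hK' t s ht0 hs.1.le hs.2).trans ?_
  gcongr
  exact hs.2.le

end Run

end EventTriggered

/-! ### Local existence and continuation past a finite horizon. -/

namespace EventTriggered

variable {N d : ℕ} {n m : Fin N → ℕ} {P : Problem N d n m} {c c' : Run N d n m} {p : Params}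
  {T T' : EReal} {W : State N d n m → ℝ}

open Problem

namespace Run

/-- The run with given state trajectory and triggering times. -/
def ofState (y : ℝ → State N d n m) (τ : Fin N → ℕ → EReal) : Run N d n m where
  x t := (y t).1
  u t := (y t).2.1
  w t := (y t).2.2.1
  z t := (y t).2.2.2.1
  ξ t := (y t).2.2.2.2
  τ := τ

theorem thrState_pos (hl : 0 ≤ p.lam) {s : State N d n m} {i : Fin N} (h : s.2.2.2.2 i ≠ 0) :
    0 < P.thrState p i s :=
  add_pos_of_nonneg_of_pos (mul_nonneg hl (norm_nonneg _)) (abs_pos.2 h)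

theorem errState_self {s : State N d n m} {i : Fin N} {q ζ : Stack fun _ : Fin N => d}
    (hq : q i = P.sigWState i s) (hζ : ζ i = P.sigZState i s) : P.errState i q ζ s = 0 := by
  unfold errState
  rw [hq, hζ, sub_self, sub_self]
  exact norm_zero

/-- Right after the initial sampling the errors are zero and the thresholds positive because `ξ_i ≠
0`, so for a short time the samples can be held. -/
theorem exists_isSolution (hss : P.SteadyStateAssumption) (hcost : P.CostAssumption)
    (hl : 0 ≤ p.lam) {s : State N d n m} (hs : s ∈ setS') :
    ∃ (c : Run N d n m) (T : EReal), c.IsSolution P p T ∧ c.state 0 = s := by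
  have hξ : ∀ i, s.2.2.2.2 i ≠ 0 := hs.2.2
  set q : Stack fun _ : Fin N => d := WithLp.toLp 2 fun i => P.sigWState i s with hq
  set ζ : Stack fun _ : Fin N => d := WithLp.toLp 2 fun i => P.sigZState i s with hζ
  obtain ⟨δ, hδ, y, hy0, hyc, hy, herr⟩ := exists_held_solution (p := p) hss hcost 0 s q ζ
    fun i => by rw [errState_self rfl rfl]; exact thrState_pos hl (hξ i)
  rw [zero_add] at hy herr
  set c : Run N d n m := ofState y fun _ k => if k = 0 then 0 else ⊤ with hc
  have hst : ∀ t, c.state t = y t := fun t => rfl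
  have hτ0 : ∀ i, c.τ i 0 = 0 := fun i => rfl
  have hτ1 : ∀ i k, c.τ i (k + 1) = ⊤ := fun i k => rfl
  have hmono : ∀ i, Monotone (c.τ i) := fun i => monotone_nat_of_le_succ fun k => by
    rw [hτ1]; exact le_top
  have hlast : ∀ i t, 0 ≤ t → c.last i t = 0 := fun i t ht =>
    last_eq_of_isGreatest (hmono i) (hτ0 i) ht (by rw [hτ1]; exact EReal.coe_lt_top t)
  have hW : ∀ t, 0 ≤ t → c.sampledW P t = q := fun t ht => PiLp.ext fun i => by
    change P.sigWState i (c.state (c.last i t)) = P.sigWState i s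
    rw [hlast i t ht, hst, hy0]
  have hZ : ∀ t, 0 ≤ t → c.sampledZ P t = ζ := fun t ht => PiLp.ext fun i => by
    change P.sigZState i (c.state (c.last i t)) = P.sigZState i s
    rw [hlast i t ht, hst, hy0]
  refine ⟨c, (δ : ℝ), isSolution_of_state (EReal.coe_pos.2 hδ)
    (hyc.mono fun t ht => ht.1) ?_ hτ0 ?_ ?_ ?_ ?_ ?_ ?_, hy0⟩
  · intro t ht0 htT
    rw [hW t ht0, hZ t ht0]
    exact hy t ht0 (EReal.coe_lt_coe_iff.1 htT)
  · rintro i (_ | k)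
    · exact Or.inl (by rw [hτ0]; exact EReal.coe_pos.2 hδ)
    · exact Or.inr rfl
  · rintro i (_ | k) h
    · rw [hτ0, hτ1]; exact EReal.zero_lt_top
    · exact absurd h (lt_irrefl _)
  · exact fun i k _ => hτ1 i k
  · intro i t ht0 htT
    have h1 := herr t ht0 (EReal.coe_lt_coe_iff.1 htT) i
    change ‖WithLp.toLp 2 (P.sigWState i (c.state t) - P.sigWState i (c.state (c.last i t)),
      P.sigZState i (c.state t) - P.sigZState i (c.state (c.last i t)))‖ ≤ _
    rw [hlast i t ht0, hst 0, hy0]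
    exact h1
  · exact fun i k h => absurd h (lt_irrefl _)
  · exact fun i t _ => ⟨1, by rw [hτ1 i 0]; exact EReal.coe_lt_top t⟩

theorem IsSolution.exists_last_trigger (hc : c.IsSolution P p T) {i : Fin N}
    (h : ∃ k, c.τ i k = ⊤) :
    ∃ j, (∀ k ≤ j, c.τ i k < T ∧ c.τ i k < ⊤) ∧ ∀ k, j < k → c.τ i k = ⊤ := by
  classical
  obtain ⟨j, hj⟩ : ∃ j, Nat.find h = j + 1 := Nat.exists_eq_succ_of_ne_zero fun h' => by
    have h1 := Nat.find_spec h
    rw [h', hc.τ_zero] at h1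
    exact EReal.zero_ne_top h1
  refine ⟨j, fun k hk => ?_, fun k hk => ?_⟩
  · have h1 : c.τ i k ≠ ⊤ := Nat.find_min h (by omega)
    exact ⟨(hc.τ_dom i k).resolve_right h1, lt_of_le_of_ne le_top h1⟩
  · have h1 : c.τ i (j + 1) = ⊤ := hj ▸ Nat.find_spec h
    exact top_le_iff.1 (h1 ▸ hc.monotone_τ i hk)

/-- A solution on a bounded time interval can be extended. -/
theorem exists_extension (ha : Admissible P p W) {b : ℝ} (hc : c.IsSolution P p b)
    (h0 : c.state 0 ∈ setS') :
    ∃ (c' : Run N d n m) (T' : EReal), (b : EReal) < T' ∧ c'.IsSolution P p T' ∧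
      Agree b c c' := by
  classical
  have hb : 0 < b := EReal.coe_pos.1 hc.pos
  obtain ⟨-, -, hξ⟩ := sums_of_mem_setS' h0
  obtain ⟨K, hK0, hK, s₀, hs₀⟩ := exists_left_limit ha hc h0
  have hlim : Tendsto c.state (𝓝[<] b) (𝓝 s₀) := by
    have h1 : Tendsto (fun t => K * (b - t)) (𝓝[<] b) (𝓝 0) := by
      have : Tendsto (fun t => K * (b - t)) (𝓝 b) (𝓝 (K * (b - b))) :=
        (by fun_prop : Continuous fun t => K * (b - t)).tendsto b
      rw [sub_self, mul_zero] at this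
      exact this.mono_left nhdsWithin_le_nhds
    refine tendsto_iff_norm_sub_tendsto_zero.2 (squeeze_zero' (Eventually.of_forall fun _ =>
      norm_nonneg _) ?_ h1)
    filter_upwards [Ioo_mem_nhdsLT hb] with t ht
    rw [norm_sub_rev]
    exact hs₀ t ht.1.le ht.2
  -- The thresholds stay positive at the left limit, so a robot resampled there starts with strictly
  -- admissible error.
  have hξ₀ : ∀ i, s₀.2.2.2.2 i ≠ 0 := fun i => by
    have h1 : Tendsto (fun t => |c.ξ t i|) (𝓝[<] b) (𝓝 |s₀.2.2.2.2 i|) :=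
      ((by fun_prop : Continuous fun s : State N d n m => |s.2.2.2.2 i|).tendsto s₀).comp hlim
    have h2 : Tendsto (fun t => |c.ξ 0 i| * Real.exp (-p.ν * t)) (𝓝[<] b)
        (𝓝 (|c.ξ 0 i| * Real.exp (-p.ν * b))) :=
      ((by fun_prop : Continuous fun t => |c.ξ 0 i| * Real.exp (-p.ν * t)).tendsto b).mono_left
        nhdsWithin_le_nhds
    have h3 : |s₀.2.2.2.2 i| = |c.ξ 0 i| * Real.exp (-p.ν * b) := by
      refine tendsto_nhds_unique h1 (h2.congr' ?_)
      filter_upwards [Ioo_mem_nhdsLT hb] with t ht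
      exact (hc.abs_ξ i ht.1.le (EReal.coe_lt_coe_iff.2 ht.2)).symm
    rw [← abs_pos, h3]
    exact mul_pos (abs_pos.2 (hξ i)) (Real.exp_pos _)
  choose j hj hj' using fun i => hc.exists_last_trigger (exists_τ_eq_top ha hc h0 i)
  set l : Fin N → ℝ := fun i => (c.τ i (j i)).toReal with hl
  have hτl : ∀ i, c.τ i (j i) = l i := fun i => (hc.coe_toReal_τ (hj i _ le_rfl).2).symm
  have hlb : ∀ i, l i < b := fun i => by
    have := (hj i _ le_rfl).1
    rwa [hτl, EReal.coe_lt_coe_iff] at this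
  set q₀ : Stack fun _ : Fin N => d := WithLp.toLp 2 fun i => P.sigWState i (c.state (l i))
  set ζ₀ : Stack fun _ : Fin N => d := WithLp.toLp 2 fun i => P.sigZState i (c.state (l i))
  -- Exactly the robots that have reached their threshold in the limit are resampled at time `b`.
  -- Afterwards every error is strictly below its threshold, as `exists_held_solution` requires.
  set trig : Fin N → Prop := fun i => P.thrState p i s₀ ≤ P.errState i q₀ ζ₀ s₀ with htrig
  set r : Fin N → State N d n m := fun i => if trig i then s₀ else c.state (l i) with hr
  set q : Stack fun _ : Fin N => d := WithLp.toLp 2 fun i => P.sigWState i (r i) with hq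
  set ζ : Stack fun _ : Fin N => d := WithLp.toLp 2 fun i => P.sigZState i (r i) with hζ
  obtain ⟨δ, hδ, y, hy0, hyc, hy, herr⟩ := exists_held_solution (p := p) ha.steady ha.cost b s₀ q ζ
    fun i => by
      by_cases hi : trig i
      · have hri : r i = s₀ := if_pos hi
        rw [errState_self (by simp [hq, hri]) (by simp [hζ, hri])]
        exact thrState_pos ha.lam_nonneg (hξ₀ i)
      · have hri : r i = c.state (l i) := if_neg hi
        refine lt_of_eq_of_lt ?_ (not_le.1 hi)
        simp [errState, hq, hζ, hri, q₀, ζ₀]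
  -- The new triggering takes the first index at which the old sequence is `⊤`, so all earlier
  -- indices keep their meaning.
  set c' : Run N d n m := ofState (fun t => if t < b then c.state t else y t)
    (fun i k => if k = j i + 1 ∧ trig i then b else c.τ i k) with hc'
  have hst : ∀ t, t < b → c'.state t = c.state t := fun t ht =>
    if_pos (c := t < b) (t := c.state t) (e := y t) ht
  have hst' : ∀ t, b ≤ t → c'.state t = y t := fun t ht =>
    if_neg (c := t < b) (t := c.state t) (e := y t) (not_lt.2 ht)
  have hτt : ∀ i, trig i → c'.τ i (j i + 1) = b := fun i hi => if_pos ⟨rfl, hi⟩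
  have hτn : ∀ i k, ¬ (k = j i + 1 ∧ trig i) → c'.τ i k = c.τ i k := fun i k hi => if_neg hi
  have hτle : ∀ i k, k ≤ j i → c'.τ i k = c.τ i k := fun i k hk => hτn i k fun h => by omega
  have hag : Agree b c c' := by
    refine ⟨fun t _ ht => hst t (EReal.coe_lt_coe_iff.1 ht), fun i k => ?_⟩
    by_cases hk : k = j i + 1 ∧ trig i
    · rw [hk.1, hτt i hk.2, hj' i _ (Nat.lt_succ_self _)]
      simp
    · rw [hτn i k hk]
  have τ_lt : ∀ i k, c'.τ i k < ⊤ → c'.τ i k < c'.τ i (k + 1) := by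
    intro i k hk
    by_cases h1 : k = j i + 1 ∧ trig i
    · rw [hτn i (k + 1) (by omega), hj' i (k + 1) (by omega)]
      exact hk
    · rw [hτn i k h1] at hk ⊢
      by_cases h2 : k + 1 = j i + 1 ∧ trig i
      · rw [h2.1, hτt i h2.2]
        exact (hj i k (by omega)).1
      · rw [hτn i _ h2]
        exact hc.τ_lt i k hk
  have τ_top : ∀ i k, c'.τ i k = ⊤ → c'.τ i (k + 1) = ⊤ := by
    intro i k hk
    have h1 : ¬ (k = j i + 1 ∧ trig i) := fun h => by
      rw [h.1, hτt i h.2] at hk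
      exact EReal.coe_ne_top b hk
    rw [hτn i k h1] at hk
    have h2 : j i < k := by
      by_contra! h
      exact (hj i k h).2.ne hk
    rw [hτn i (k + 1) (by omega)]
    exact hj' i _ (by omega)
  have hmono : ∀ i, Monotone (c'.τ i) := fun i => monotone_nat_of_le_succ fun k => by
    rcases lt_or_eq_of_le (le_top (a := c'.τ i k)) with h | h
    · exact (τ_lt i k h).le
    · rw [τ_top i k h]; exact le_top
  have hlast : ∀ i t, b ≤ t → c'.state (c'.last i t) = r i := by
    intro i t ht
    by_cases hi : trig i
    · rw [last_eq_of_isGreatest (hmono i) (hτt i hi) ht (by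
        rw [hτn i _ (by omega), hj' i _ (by omega)]; exact EReal.coe_lt_top t), hst' b le_rfl, hy0]
      exact (if_pos hi).symm
    · rw [last_eq_of_isGreatest (hmono i) (k := j i) (s := l i)
        (by rw [hτle i _ le_rfl, hτl]) ((hlb i).le.trans ht) (by
        rw [hτn i _ (fun h => hi h.2), hj' i _ (by omega)]; exact EReal.coe_lt_top t),
        hst _ (hlb i)]
      exact (if_neg hi).symm
  have hbT : (b : EReal) < ((b + δ : ℝ) : EReal) := EReal.coe_lt_coe_iff.2 (by linarith)
  refine ⟨c', ((b + δ : ℝ) : EReal), hbT, isSolution_of_state (hc.pos.trans hbT) ?_ ?_ ?_ ?_ τ_lt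
    τ_top ?_ ?_ ?_, hag⟩
  · have h1 : ContinuousOn c'.state (Icc 0 b) := by
      refine LipschitzOnWith.continuousOn (K := K.toNNReal)
        (LipschitzOnWith.of_dist_le_mul fun s hs t ht => ?_)
      rw [Real.coe_toNNReal K hK0]
      have h2 : ∀ s t : ℝ, 0 ≤ s → s ≤ t → t ≤ b →
          dist (c'.state s) (c'.state t) ≤ K * dist s t := by
        intro s t hs0 hst1 ht
        rw [Real.dist_eq, abs_of_nonpos (by linarith), neg_sub, dist_comm, dist_eq_norm]
        rcases ht.lt_or_eq with ht | rfl
        · rw [hst t ht, hst s (hst1.trans_lt ht)]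
          exact hK s t hs0 hst1 ht
        · rw [hst' t le_rfl, hy0]
          rcases hst1.lt_or_eq with h | rfl
          · rw [hst s h]
            exact hs₀ s hs0 h
          · rw [hst' s le_rfl, hy0]
            simp
      rcases le_total s t with h | h
      · exact h2 s t hs.1 h ht.2
      · rw [dist_comm, dist_comm s t]
        exact h2 t s ht.1 h hs.2
    have h2 : ContinuousOn c'.state (Ici b) := hyc.congr fun t ht => hst' t ht
    refine (h1.union_of_isClosed h2 isClosed_Icc isClosed_Ici).mono fun t ht => ?_
    rcases le_total t b with h | h
    · exact Or.inl ⟨ht.1, h⟩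
    · exact Or.inr h
  · intro t ht0 htT
    rcases lt_or_ge t b with h | h
    · exact hag.ode hc ht0 (EReal.coe_lt_coe_iff.2 h)
    · have e1 : c'.sampledW P t = q := PiLp.ext fun i => by
        change P.sigWState i (c'.state (c'.last i t)) = P.sigWState i (r i)
        rw [hlast i t h]
      have e2 : c'.sampledZ P t = ζ := PiLp.ext fun i => by
        change P.sigZState i (c'.state (c'.last i t)) = P.sigZState i (r i)
        rw [hlast i t h]
      rw [e1, e2, hst' t h]
      exact (hy t h (EReal.coe_lt_coe_iff.1 htT)).congr
        (fun s hs => hst' s (h.trans hs)) (hst' t h)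
  · intro i
    rw [hτle i 0 (Nat.zero_le _), hc.τ_zero]
  · intro i k
    by_cases hk : k = j i + 1 ∧ trig i
    · rw [hk.1, hτt i hk.2]
      exact Or.inl hbT
    · rw [hτn i k hk]
      exact (hc.τ_dom i k).imp (fun h => h.trans hbT) id
  · intro i t ht0 htT
    rcases lt_or_ge t b with h | h
    · exact hag.err hc i ht0 (EReal.coe_lt_coe_iff.2 h)
    · have h1 := herr t h (EReal.coe_lt_coe_iff.1 htT) i
      change ‖WithLp.toLp 2 (P.sigWState i (c'.state t) - P.sigWState i (c'.state (c'.last i t)),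
        P.sigZState i (c'.state t) - P.sigZState i (c'.state (c'.last i t)))‖ ≤
          P.thrState p i (c'.state t)
      rw [hlast i t h, hst' t h]
      exact h1
  · intro i k hk
    by_cases h1 : k + 1 = j i + 1 ∧ trig i
    · obtain rfl : k = j i := by omega
      rw [hτt i h1.2, hτle i _ le_rfl, hτl, EReal.toReal_coe, EReal.toReal_coe]
      change P.thrState p i (c'.state b) ≤
        ‖WithLp.toLp 2 (P.sigWState i (c'.state b) - P.sigWState i (c'.state (l i)),
        P.sigZState i (c'.state b) - P.sigZState i (c'.state (l i)))‖
      rw [hst' b le_rfl, hy0, hst _ (hlb i)]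
      exact h1.2
    · rw [hτn i _ h1] at hk
      exact hag.reached hc i k ((hc.τ_dom i _).resolve_right hk.ne)
  · intro i t _
    -- The index is `j i + 2` because `j i + 1` may now carry the triggering at `b`.
    exact ⟨j i + 2, by rw [hτn i _ (by omega), hj' i _ (by omega)]; exact EReal.coe_lt_top t⟩

end Run

end EventTriggered

/-! ### Complete extensions by Zorn's lemma. -/

namespace EventTriggered

variable {N d : ℕ} {n m : Fin N → ℕ} {P : Problem N d n m} {c c' : Run N d n m} {p : Params}
  {T T' : EReal} {W : State N d n m → ℝ}

namespace Run

/-- The solution `q'` on `[0, q'.2)` extends the solution `q` on `[0, q.2)`. -/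
def Extends (q q' : Run N d n m × EReal) : Prop := q.2 ≤ q'.2 ∧ Agree q.2 q.1 q'.1

theorem Extends.trans {q q' q'' : Run N d n m × EReal} (h : Extends q q') (h' : Extends q' q'') :
    Extends q q'' := ⟨h.1.trans h'.1, h.2.trans h.1 h'.2⟩

/-- Members of a chain agree on common horizons, so their union is well defined; each requirement on
a solution concerns times below some member's horizon and is inherited from it. -/
theorem exists_chain_bound {C : Set (Run N d n m × EReal)} (hne : C.Nonempty)
    (hsol : ∀ q ∈ C, q.1.IsSolution P p q.2) (hC : IsChain Extends C) :
    ∃ q' : Run N d n m × EReal, q'.1.IsSolution P p q'.2 ∧ ∀ q ∈ C, Extends q q' := by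
  classical
  have htot : ∀ q ∈ C, ∀ q' ∈ C, Extends q q' ∨ Extends q' q := fun q hq q' hq' => by
    by_cases h : q = q'
    · subst h
      exact Or.inl ⟨le_rfl, Agree.refl _ _⟩
    · exact hC hq hq' h
  set T' : EReal := sSup (Prod.snd '' C) with hT'
  set y : ℝ → State N d n m := fun t =>
    if h : ∃ q ∈ C, (t : EReal) < q.2 then h.choose.1.state t else 0 with hy
  -- A member records `⊤` for a triggering beyond its horizon; the infimum picks the finite value as
  -- soon as some member reaches it.
  set c' : Run N d n m := ofState y fun i k => ⨅ q ∈ C, q.1.τ i k with hc'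
  have hle : ∀ q ∈ C, q.2 ≤ T' := fun q hq => le_sSup (mem_image_of_mem _ hq)
  have hτ : ∀ q ∈ C, ∀ q' ∈ C, ∀ i k, min (q.1.τ i k) q.2 ≤ q'.1.τ i k := by
    intro q hq q' hq' i k
    rcases htot q hq q' hq' with h | h
    · rw [← h.2.2]
      exact min_le_left _ _
    · rcases (hsol q' hq').τ_dom i k with h1 | h1
      · exact (min_le_left _ _).trans (h.2.τ_eq h1).le
      · exact le_top.trans h1.ge
  have hag : ∀ q ∈ C, Agree q.2 q.1 c' := by
    intro q hq
    refine ⟨fun t ht0 htT => ?_, fun i k => le_antisymm ?_ ?_⟩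
    · have h : ∃ q ∈ C, (t : EReal) < q.2 := ⟨q, hq, htT⟩
      have h1 : c'.state t = h.choose.1.state t := dif_pos h
      rw [h1]
      rcases htot q hq _ h.choose_spec.1 with h2 | h2
      · exact h2.2.1 t ht0 htT
      · exact (h2.2.1 t ht0 h.choose_spec.2).symm
    · exact min_le_min_right _ (iInf₂_le q hq)
    · exact le_min (le_iInf₂ fun q' hq' => hτ q hq q' hq' i k) (min_le_right _ _)
  refine ⟨(c', T'), isSolution_of_agree ?_ ?_ ?_, fun q hq => ⟨hle q hq, hag q hq⟩⟩
  · intro t ht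
    obtain ⟨_, ⟨q, hq, rfl⟩, h⟩ := lt_sSup_iff.1 ht
    exact ⟨q.1, q.2, h, hle q hq, hsol q hq, hag q hq⟩
  · obtain ⟨q, hq⟩ := hne
    exact (hsol q hq).pos.trans_le (hle q hq)
  · intro i k hk
    obtain ⟨q, hk⟩ := iInf_lt_iff.1 hk
    obtain ⟨hq, hk⟩ := iInf_lt_iff.1 hk
    exact ⟨q.1, q.2, hle q hq, hsol q hq, hag q hq, ((hsol q hq).τ_dom i k).resolve_right hk.ne⟩

/-- Every solution that starts with nonzero components of `ξ` extends to a complete one. -/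
theorem IsSolution.hasCompletion (ha : Admissible P p W) (hc : c.IsSolution P p T)
    (h0 : c.state 0 ∈ setS') : c.HasCompletion P p T := by
  let α := {q : Run N d n m × EReal // q.1.IsSolution P p q.2 ∧ Extends (c, T) q}
  let q₀ : α := ⟨(c, T), hc, le_rfl, Agree.refl T c⟩
  have : Nonempty α := ⟨q₀⟩
  obtain ⟨⟨⟨c', T'⟩, hc', hTT', hag⟩, hmax⟩ := exists_maximal_of_nonempty_chains_bounded
    (α := α) (r := fun q q' => Extends q.1 q'.1) (fun C hC hne => by
      obtain ⟨q', hq', h⟩ := exists_chain_bound (P := P) (p := p) (C := Subtype.val '' C)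
        (hne.image _) (by rintro _ ⟨q, -, rfl⟩; exact q.2.1)
        (by
          rintro _ ⟨q, hq, rfl⟩ _ ⟨q', hq', rfl⟩ hne'
          exact hC hq hq' fun h => hne' (by rw [h]))
      obtain ⟨q, hq⟩ := hne
      exact ⟨⟨q', hq', q.2.2.trans (h _ (mem_image_of_mem _ hq))⟩,
        fun q hq => h _ (mem_image_of_mem _ hq)⟩) (fun h h' => h.trans h')
  change T ≤ T' at hTT'
  change Agree T c c' at hag
  change c'.IsSolution P p T' at hc'
  -- A maximal solution with finite horizon would have a strictly longer extension.
  have hTtop : T' = ⊤ := by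
    by_contra hne
    lift T' to ℝ using ⟨hne, (bot_lt_iff_ne_bot.1 (bot_le.trans_lt hc'.pos))⟩
    obtain ⟨c'', T'', hlt, hc'', hag'⟩ := exists_extension ha hc' (by
      rw [hag.1 0 le_rfl hc.pos]; exact h0)
    have h1 : Extends (c, T) (c'', T'') :=
      Extends.trans (q' := (c', (T' : EReal))) ⟨hTT', hag⟩ ⟨hlt.le, hag'⟩
    exact absurd (hmax ⟨(c'', T''), hc'', h1⟩ ⟨hlt.le, hag'⟩).1 (not_le.2 hlt)
  subst hTtop
  exact ⟨c', hc', hag⟩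

end Run

end EventTriggered

end

/-! ### The main theorem. -/

open EventTriggered in
theorem theorem1 (N d : ℕ) (hN : 0 < N) (n m : Fin N → ℕ) (P : Problem N d n m)
    (hnet : P.NetworkAssumption) (hss : P.SteadyStateAssumption) (hcost : P.CostAssumption) :
    ∃ α₁' > 0, ∃ α₂' > 0, ∃ lam' > 0, ∃ ν' > 0,
      ∀ p : Params, p.α₁ ∈ Set.Ioo 0 α₁' → p.α₂ ∈ Set.Ioo 0 α₂' → p.lam ∈ Set.Ioo 0 lam' →
        ν' < p.ν →
        -- well-posedness: complete solutions exist, every solution extends to a complete one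
        (∀ s ∈ (setS' : Set (State N d n m)),
          ∃ c : Run N d n m, c.IsSolution P p ⊤ ∧ c.state 0 = s) ∧
        (∀ (c : Run N d n m) (T : EReal), c.IsSolution P p T → c.state 0 ∈ setS' →
          c.HasCompletion P p T) ∧
        -- boundedness and convergence
        (∀ (c : Run N d n m) (T : EReal), c.IsSolution P p T → c.w 0 = 0 → c.z 0 = 0 →
          (∀ i, c.ξ 0 i ≠ 0) →
          (∃ M : ℝ, ∀ t : ℝ, 0 ≤ t → (t : EReal) < T → ‖c.state t‖ ≤ M) ∧
          (T = ⊤ →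
            Tendsto (fun t => Metric.infEDist (c.state t) P.configX) atTop (𝓝 0))) ∧
        -- local asymptotic stability
        (∀ u : Stack m, gradient P.reducedCost u = 0 →
          (∀ᶠ v in 𝓝[≠] u, gradient P.reducedCost v ≠ 0) → IsLocalMin P.reducedCost u →
          LocallyAsymptoticallyStable P p setS (P.eqPoint u)) ∧
        -- no Zeno behavior
        (∀ (c : Run N d n m) (T : EReal), c.IsSolution P p T → c.state 0 ∈ setS' →
          ∀ i, ¬ c.IsZeno i) := by
  obtain ⟨α₁', hα₁', α₂', hα₂', lam', hlam', h⟩ := exists_isLyapunov hN hnet hss hcost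
  -- The bound `1` for `ν` is enough because the weight of `‖ξ‖²` in the Lyapunov function was
  -- chosen large.
  refine ⟨α₁', hα₁', α₂', hα₂', lam', hlam', 1, one_pos, fun p h1 h2 h3 h4 => ?_⟩
  obtain ⟨W, hW⟩ := h p h1 h2 h3 h4
  have ha : Admissible P p W := ⟨hN, hss, hcost, h1.1, h2.1, h3.1.le, hW⟩
  refine ⟨fun s hs => ?_, fun c T hc h0 => hc.hasCompletion ha h0, fun c T hc hw hz _ => ?_,
    fun u hu hiso hmin => ?_, fun c T hc h0 => Run.not_isZeno ha hc h0⟩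
  · obtain ⟨c, T, hc, rfl⟩ := Run.exists_isSolution (p := p) hss hcost h3.1.le hs
    obtain ⟨c', hc', h5, -⟩ := hc.hasCompletion ha hs
    exact ⟨c', hc', h5 0 le_rfl hc.pos⟩
  · have hw0 : ∑ i, c.w 0 i = 0 := by simp [hw]
    have hz0 : ∑ i, c.z 0 i = 0 := by simp [hz]
    constructor
    · obtain ⟨S, hS, hcS⟩ := exists_compact_of_isSolution hN hss hcost h1.1 hW hc hw0 hz0
      obtain ⟨M, hM⟩ := hS.isBounded.exists_norm_le
      exact ⟨M, fun t ht0 htT => hM _ (hcS t ht0 htT)⟩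
    · rintro rfl
      exact tendsto_infEDist_configX hN hss hcost h1.1 h2.1 h3.1.le hW hc hw0 hz0
  · exact locallyAsymptoticallyStable_eqPoint hN hss hcost h1.1 h2.1 h3.1.le hW hu hiso hmin
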